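/- **Setting.** $B_n$ is the group of $n$-braids with Artin generators $\sigma_1,\dots,\sigma_{n-1}$, products being read from left to right (braids act from the right). A *permutation braid* is a positive braid in which any two strands cross at most once; it is determined by its permutation ($i\mapsto j$ if the strand starting at position $i$ ends at position $j$). For a braid $\beta$ let $S(\beta)$ (resp. $F(\beta)$) be the set of $i$ such that $\beta=\sigma_i\beta'$ (resp. $\beta=\beta'\sigma_i$) with $\beta'$ a permutation braid. Let $\Delta$ be the half twist and $\tau(\beta)=\Delta^{-1}\beta\Delta$. An expression $\beta=\Delta^m\beta_1\cdots\beta_\ell$ is the *left canonical form* of $\beta$ if the $\beta_i$ are permutation braids different from $1$ and $\Delta$ and it is left weighted, i.e. $F(\beta_i)\supseteq S(\beta_{i+1})$ for $1\le i<\ell$. If $\ell\ge1$ and moreover $F(\beta_\ell)\supseteq S(\tau^m(\beta_1))$, then $\beta$ is *rigid*. A *standard circle* in the disk with punctures $1,\dots,n$ on an axis is a circle meeting the axis exactly twice and enclosing at least two but not all of the punctures (so it encloses consecutive punctures $i,\dots,j$). A *standard reduction system* for $\beta$ is a non-empty family of pairwise disjoint standard circles that is preserved, up to isotopy, by the action of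 $\beta$ on the punctured disk. **The braids.** For $\mathbf a=(a_1,\dots,a_p)\in\{0,1\}^p$ let $\alpha(\mathbf a)$ be the permutation braid on $2p+2$ strands whose strands run as follows. * If $a_j=0$, the strand $2j+1$ ends at $2j$, and the strand $2j$ ends at $2j'+1$, where $j'>j$ is the smallest index with $a_{j'}=0$, or at $2p+2$ if there is none. * If $a_j=1$, the strand $2j$ ends at $2j+1$, and the strand $2j+1$ ends at $2j'$, where $j'<j$ is the largest index with $a_{j'}=1$, or at $1$ if there is none. * The strand $1$ ends at $2j'+1$ for the smallest $j'$ with $a_{j'}=0$, or at $2p+2$ if there is none; the strand $2p+2$ ends at $2j'$ for the largest $j'$ with $a_{j'}=1$, or at $1$ if there is none. For $b\in\{0,\dots,p\}$ let $\alpha(\mathbf a,b)$ be the permutation braid on $2p+3$ strands obtained from $\alpha(\mathbf a)$, drawn with straight strands, by adding a straight vertical strand between the $(2b+1)$-st and the $(2b+2)$-nd position. For a binary $k\times p$ matrix $A$ with rows $A_1,\dots,A_k$ put $\alpha(A)=\alpha(A_1)\cdots\alpha(A_k)$ and $\alpha(A,b)=\alpha(A_1,b)\cdots\alpha(A_k,b)$,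 which is $\alpha(A)$ with a straight vertical strand added. For $k\ge1$ and $n\ge6$ let $\mathcal M_{k,n}$ be the set of binary $k\times p$ matrices $A$ whose first column is $\mathbf 0$ and whose last column is $\mathbf 1$ if $n=2p+2$, and the set of pairs $(A,b)$ of such a matrix and $b\in\{0,\dots,p\}$ if $n=2p+3$. This gives a function $\alpha:\mathcal M_{k,n}\to B_n$. **Lemma 2.2.** Let $k\ge1$ and $n\ge6$. 1. For every element of $\mathcal M_{k,n}$ the product $\alpha(A)=\alpha(A_1)\cdots\alpha(A_k)$ (if $n$ is even), respectively $\alpha(A,b)=\alpha(A_1,b)\cdots\alpha(A_k,b)$ (if $n$ is odd), is a left canonical form as written (with $m=0$ and $\ell=k$), and this braid is rigid. In fact $F(\alpha(A_i))\supseteq S(\alpha(A_j))$, respectively $F(\alpha(A_i,b))\supseteq S(\alpha(A_j,b))$, for all $i,j\in\{1,\dots,k\}$. The function $\alpha:\mathcal M_{k,n}\to B_n$ is injective. 2. None of the braids $\alpha(A)$, respectively $\alpha(A,b)$, in $\alpha(\mathcal M_{k,n})$ has a standard reduction system. -/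

import Mathlib

noncomputable section

/-! ### The braid group

Punctures, positions of strands and Artin generators are numbered from `0`: the Artin generator
`σ_{i+1}` of the usual numbering is `Braid.σ i`, and it exchanges the positions `i` and `i+1`. -/

/-- The position `s` (out of `n`) on the left of the `s`-th gap. -/
def leftPos {n : ℕ} (s : Fin (n - 1)) : Fin n := ⟨s.1, by omega⟩

/-- The position `s + 1` (out of `n`) on the right of the `s`-th gap. -/
def rightPos {n : ℕ} (s : Fin (n - 1)) : Fin n := ⟨s.1 + 1, by omega⟩

/-- Artin's relators: `σᵢ σⱼ = σⱼ σᵢ` for `|i - j| > 1`, `σᵢ σⱼ σᵢ = σⱼ σᵢ σⱼ` for `|i - j| = 1`. -/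
def braidRels (n : ℕ) : Set (FreeGroup (Fin (n - 1))) :=
  {r | ∃ i j : Fin (n - 1),
    (i.1 + 1 < j.1 ∧ r = (FreeGroup.of i * FreeGroup.of j) *
      (FreeGroup.of j * FreeGroup.of i)⁻¹) ∨
    (i.1 + 1 = j.1 ∧ r = (FreeGroup.of i * FreeGroup.of j * FreeGroup.of i) *
      (FreeGroup.of j * FreeGroup.of i * FreeGroup.of j)⁻¹)}

/-- The group of braids on `n` strands. -/
abbrev Braid (n : ℕ) : Type := PresentedGroup (braidRels n)

namespace Braid

variable {n : ℕ}

/-- The Artin generators. -/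
def σ (i : Fin (n - 1)) : Braid n := PresentedGroup.of i

/-- The positive braid represented by a word in the Artin generators, read from left to right. -/
def ofWord (w : List (Fin (n - 1))) : Braid n := (w.map σ).prod

/-- The number of times the strands starting at the positions `i` and `j` cross each other in a
positive braid word. -/
def crossings : List (Fin (n - 1)) → Fin n → Fin n → ℕ
  | [], _, _ => 0
  | s :: w, i, j =>
    (if (i = leftPos s ∧ j = rightPos s) ∨ (i = rightPos s ∧ j = leftPos s) then 1 else 0) +
      crossings w (Equiv.swap (leftPos s) (rightPos s) i) (Equiv.swap (leftPos s) (rightPos s) j)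

/-- A permutation braid: a positive braid in which any two strands cross at most once. -/
def IsPermutationBraid (β : Braid n) : Prop :=
  ∃ w : List (Fin (n - 1)), ofWord w = β ∧ ∀ i j : Fin n, i ≠ j → crossings w i j ≤ 1

/-- The starting set `S(β)`. -/
def startingSet (β : Braid n) : Set (Fin (n - 1)) :=
  {i | ∃ β' : Braid n, IsPermutationBraid β' ∧ β = σ i * β'}

/-- The finishing set `F(β)`. -/
def finishingSet (β : Braid n) : Set (Fin (n - 1)) :=
  {i | ∃ β' : Braid n, IsPermutationBraid β' ∧ β = β' * σ i}

/-- The number of strands that start to the left of the strand `j` and end to its right when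
every strand `i` ends at the position `f i`. -/
def crossedFromLeft (f : Equiv.Perm (Fin n)) (j : Fin n) : ℕ :=
  (Finset.univ.filter fun i : Fin n => i < j ∧ f j < f i).card

/-- A positive word for the braid in which the strand starting at `i` runs straight to `f i`.
The strands are put in place one after the other: when the strands `0, …, j - 1` have been brought
into their final relative order, the strand `j` moves to the left across the `c` strands among them
which have to end on its right, which contributes the letters `σ (j-1), σ (j-2), …, σ (j-c)`. -/
def permWord (f : Equiv.Perm (Fin n)) : List (Fin (n - 1)) :=
  (List.finRange n).flatMap fun j =>
    (List.finRange (n - 1)).reverse.filter fun s =>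
      decide (j.1 - crossedFromLeft f j ≤ s.1 ∧ s.1 < j.1)

/-- The permutation braid whose strand starting at position `i` ends at position `f i`. -/
def permBraid (f : Equiv.Perm (Fin n)) : Braid n := ofWord (permWord f)

/-- The half twist `Δ`. -/
def halfTwist (n : ℕ) : Braid n := permBraid Fin.revPerm

/-- The involution `τ(β) = Δ⁻¹ β Δ`, iterated `m` times. -/
def tauPow (m : ℤ) (β : Braid n) : Braid n := (halfTwist n ^ m)⁻¹ * β * halfTwist n ^ m

/-- `β = Δ^m β₁ ⋯ β_ℓ` is the left canonical form of `β`, where `L = [β₁, …, β_ℓ]`: the factors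
are permutation braids other than `1` and `Δ`, and consecutive factors are left weighted, that is,
`F(βᵢ) ⊇ S(βᵢ₊₁)`. -/
structure IsLeftCanonicalForm (β : Braid n) (m : ℤ) (L : List (Braid n)) : Prop where
  eq_prod : β = halfTwist n ^ m * L.prod
  isPermutationBraid : ∀ x ∈ L, IsPermutationBraid x
  ne_one : ∀ x ∈ L, x ≠ 1
  ne_halfTwist : ∀ x ∈ L, x ≠ halfTwist n
  leftWeighted : L.IsChain fun x y => startingSet y ⊆ finishingSet x

/-- A braid with left canonical form `Δ^m β₁ ⋯ β_ℓ`, `ℓ ≥ 1`, is rigid if the form stays left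
weighted when it is closed up cyclically: `F(β_ℓ) ⊇ S(τ^m(β₁))`. -/
def IsRigid (β : Braid n) : Prop :=
  ∃ (m : ℤ) (L : List (Braid n)) (hL : L ≠ []), IsLeftCanonicalForm β m L ∧
    startingSet (tauPow m (L.head hL)) ⊆ finishingSet (L.getLast hL)

/-! ### The action on curves in the punctured disk

The fundamental group of the `n`-punctured disk is free on the classes `x₀, …, x_{n-1}` of loops
around the punctures, chosen so that `x₀ x₁ ⋯ x_{n-1}` is the class of the boundary. -/

/-- Images of the free generators under the half twist exchanging two neighbouring punctures. -/
def artinFun (s : Fin (n - 1)) (k : Fin n) : FreeGroup (Fin n) :=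
  if k = leftPos s then
    FreeGroup.of (leftPos s) * FreeGroup.of (rightPos s) * (FreeGroup.of (leftPos s))⁻¹
  else if k = rightPos s then FreeGroup.of (leftPos s)
  else FreeGroup.of k

/-- Images of the free generators under the inverse half twist. -/
def artinInvFun (s : Fin (n - 1)) (k : Fin n) : FreeGroup (Fin n) :=
  if k = leftPos s then FreeGroup.of (rightPos s)
  else if k = rightPos s then
    (FreeGroup.of (rightPos s))⁻¹ * FreeGroup.of (leftPos s) * FreeGroup.of (rightPos s)
  else FreeGroup.of k

lemma leftPos_ne_rightPos (s : Fin (n - 1)) : leftPos s ≠ rightPos s := by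
  simp [leftPos, rightPos, Fin.ext_iff]

/-- The automorphism of the fundamental group induced by the half twist exchanging two
neighbouring punctures: `xₛ ↦ xₛ xₛ₊₁ xₛ⁻¹`, `xₛ₊₁ ↦ xₛ`. -/
def artinAut (s : Fin (n - 1)) : MulAut (FreeGroup (Fin n)) :=
  MonoidHom.toMulEquiv (FreeGroup.lift (artinFun s)) (FreeGroup.lift (artinInvFun s))
    (by
      have h := leftPos_ne_rightPos s
      ext k
      by_cases h1 : k = leftPos s
      · subst h1; simp [artinFun, artinInvFun, h.symm, mul_assoc]
      · by_cases h2 : k = rightPos s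
        · subst h2; simp [artinFun, artinInvFun, h.symm]
        · simp [artinFun, artinInvFun, h1, h2])
    (by
      have h := leftPos_ne_rightPos s
      ext k
      by_cases h1 : k = leftPos s
      · subst h1; simp [artinFun, artinInvFun, h.symm]
      · by_cases h2 : k = rightPos s
        · subst h2; simp [artinFun, artinInvFun, h.symm, mul_assoc]
        · simp [artinFun, artinInvFun, h1, h2])

lemma artinAut_of (s : Fin (n - 1)) (k : Fin n) :
    artinAut s (FreeGroup.of k) = artinFun s k := by
  simp [artinAut]

lemma mulAut_ext {f g : MulAut (FreeGroup (Fin n))}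
    (h : ∀ k, f (FreeGroup.of k) = g (FreeGroup.of k)) : f = g := by
  have : f.toMonoidHom = g.toMonoidHom := by
    ext k; exact h k
  exact MulEquiv.toMonoidHom_injective this

lemma artinAut_comm {i j : Fin (n - 1)} (hij : i.1 + 1 < j.1) :
    artinAut i * artinAut j = artinAut j * artinAut i := by
  have h1 : leftPos i ≠ leftPos j := by simp [leftPos, Fin.ext_iff]; omega
  have h2 : leftPos i ≠ rightPos j := by simp [leftPos, rightPos, Fin.ext_iff]; omega
  have h3 : rightPos i ≠ leftPos j := by simp [leftPos, rightPos, Fin.ext_iff]; omega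
  have h4 : rightPos i ≠ rightPos j := by simp [rightPos, Fin.ext_iff]; omega
  have h5 := leftPos_ne_rightPos i
  have h6 := leftPos_ne_rightPos j
  apply mulAut_ext
  intro k
  simp only [MulAut.mul_apply, artinAut_of]
  by_cases e1 : k = leftPos i
  · subst e1
    simp [artinFun, artinAut_of, h1, h2, h3, h4]
  by_cases e2 : k = rightPos i
  · subst e2
    simp [artinFun, artinAut_of, h1, h2, h3, h4, h5.symm]
  by_cases e3 : k = leftPos j
  · subst e3
    simp [artinFun, artinAut_of, h1.symm, h2.symm, h3.symm, h4.symm]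
  by_cases e4 : k = rightPos j
  · subst e4
    simp [artinFun, artinAut_of, h1.symm, h2.symm, h3.symm, h4.symm, h6.symm]
  simp [artinFun, artinAut_of, e1, e2, e3, e4]

lemma artinAut_braid {i j : Fin (n - 1)} (hij : i.1 + 1 = j.1) :
    artinAut i * artinAut j * artinAut i = artinAut j * artinAut i * artinAut j := by
  have h0 : rightPos i = leftPos j := by simp [leftPos, rightPos, Fin.ext_iff]; omega
  have h1 : leftPos i ≠ leftPos j := by simp [leftPos, Fin.ext_iff]; omega
  have h2 : leftPos i ≠ rightPos j := by simp [leftPos, rightPos, Fin.ext_iff]; omega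
  have h6 := leftPos_ne_rightPos j
  apply mulAut_ext
  intro k
  simp only [MulAut.mul_apply, artinAut_of]
  by_cases e1 : k = leftPos i
  · subst e1
    simp [artinFun, artinAut_of, h0, h1, h2, h1.symm, h2.symm, h6.symm, mul_assoc]
  by_cases e2 : k = leftPos j
  · subst e2
    simp [artinFun, artinAut_of, h0, h1, h2, h1.symm, h2.symm, h6.symm, mul_assoc]
  by_cases e3 : k = rightPos j
  · subst e3
    simp [artinFun, artinAut_of, h0, h1, h2, h1.symm, h2.symm, h6.symm]
  simp [artinFun, artinAut_of, h0, e1, e2, e3]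

lemma lift_artinAut_eq_one (r : FreeGroup (Fin (n - 1))) (hr : r ∈ braidRels n) :
    FreeGroup.lift (fun s => MulOpposite.op (artinAut s)) r = 1 := by
  obtain ⟨i, j, ⟨h, rfl⟩ | ⟨h, rfl⟩⟩ := hr
  · rw [map_mul, map_inv, mul_inv_eq_one]
    simp only [map_mul, FreeGroup.lift_apply_of, ← MulOpposite.op_mul]
    rw [artinAut_comm h]
  · rw [map_mul, map_inv, mul_inv_eq_one]
    simp only [map_mul, FreeGroup.lift_apply_of, ← MulOpposite.op_mul, ← mul_assoc]
    rw [artinAut_braid h]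

/-- Artin's representation: the action of braids, from the right, on the fundamental group of the
punctured disk. -/
def artinRep (n : ℕ) : Braid n →* (MulAut (FreeGroup (Fin n)))ᵐᵒᵖ :=
  PresentedGroup.toGroup (f := fun s => MulOpposite.op (artinAut s)) lift_artinAut_eq_one

/-- Free homotopy of unoriented loops: conjugacy in the fundamental group up to inversion. -/
def loopSetoid (n : ℕ) : Setoid (FreeGroup (Fin n)) where
  r g h := IsConj g h ∨ IsConj g h⁻¹
  iseqv := by
    have hinv : ∀ {a b : FreeGroup (Fin n)}, IsConj a b → IsConj a⁻¹ b⁻¹ := by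
      intro a b h
      obtain ⟨c, hc⟩ := isConj_iff.1 h
      exact isConj_iff.2 ⟨c, by rw [← hc]; group⟩
    refine ⟨fun g => Or.inl (IsConj.refl g), ?_, ?_⟩
    · rintro g h (h1 | h1)
      · exact Or.inl h1.symm
      · exact Or.inr (by simpa using (hinv h1).symm)
    · rintro g h k (h1 | h1) (h2 | h2)
      · exact Or.inl (h1.trans h2)
      · exact Or.inr (h1.trans h2)
      · exact Or.inr (h1.trans (hinv h2))
      · exact Or.inl (h1.trans (by simpa using hinv h2))

/-- Free homotopy classes of unoriented loops in the `n`-punctured disk. Isotopy classes of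
essential simple closed curves are among them, as homotopic essential simple closed curves are
isotopic. -/
def LoopClass (n : ℕ) : Type := Quotient (loopSetoid n)

/-- The image of a curve under a braid, which acts from the right. -/
def actOnLoop (β : Braid n) : LoopClass n → LoopClass n :=
  Quotient.map (artinRep n β).unop (by
    rintro g h (h1 | h1)
    · exact Or.inl ((artinRep n β).unop.toMonoidHom.map_isConj h1)
    · exact Or.inr (by
        have := (artinRep n β).unop.toMonoidHom.map_isConj h1
        simpa using this))

/-- A standard circle, that is, a circle meeting the axis of the punctures exactly twice, given by
the first and the last puncture inside it. It is essential and not peripheral: it encloses at least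
two punctures, but not all of them. -/
structure StandardCircle (n : ℕ) where
  first : Fin n
  last : Fin n
  first_lt_last : first < last
  not_peripheral : ¬ (first.1 = 0 ∧ last.1 + 1 = n)

/-- The punctures enclosed by a standard circle. -/
def StandardCircle.inside (C : StandardCircle n) : Set (Fin n) := Set.Icc C.first C.last

/-- The curve given by a standard circle: the class of `xᵢ xᵢ₊₁ ⋯ xⱼ`. -/
def StandardCircle.curve (C : StandardCircle n) : LoopClass n :=
  Quotient.mk (loopSetoid n)
    ((((List.finRange n).filter fun k => decide (C.first ≤ k ∧ k ≤ C.last)).map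
      FreeGroup.of).prod)

/-- Two standard circles can be made disjoint: they are nested or lie outside each other. -/
def StandardCircle.AreDisjoint (C C' : StandardCircle n) : Prop :=
  C.inside ⊆ C'.inside ∨ C'.inside ⊆ C.inside ∨ Disjoint C.inside C'.inside

/-- A standard reduction system for `β`: a non-empty family of pairwise disjoint standard circles
which is preserved by `β` up to isotopy. -/
structure IsStandardReductionSystem (β : Braid n) (𝒞 : Set (StandardCircle n)) : Prop where
  nonempty : 𝒞.Nonempty
  disjoint : 𝒞.Pairwise StandardCircle.AreDisjoint
  preserved : (fun C => actOnLoop β C.curve) '' 𝒞 = StandardCircle.curve '' 𝒞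

end Braid

/-! ### The braids of binary matrices

For a binary row `a = (a₀, …, a_{p-1})`, the braid `α(a)` has `2p + 2` strands. Between the first
and the last position lie `p` pairs of positions, `(2j+1, 2j+2)` being the `j`-th pair. -/

namespace BinaryBraid

open Braid

variable {p : ℕ}

/-- The right position `2j+2` of the first pair `j ≥ m` with `a j = 0`, and the last position if
there is no such pair. -/
def nextZero (a : Fin p → Fin 2) (m : ℕ) : Fin (2 * p + 2) :=
  (insert (Fin.last (2 * p + 1))
    ((Finset.univ.filter fun j : Fin p => m ≤ j.1 ∧ a j = 0).image
      fun j => (⟨2 * j.1 + 2, by omega⟩ : Fin (2 * p + 2)))).min' (Finset.insert_nonempty _ _)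

/-- The left position `2j+1` of the last pair `j < m` with `a j = 1`, and the first position if
there is no such pair. -/
def prevOne (a : Fin p → Fin 2) (m : ℕ) : Fin (2 * p + 2) :=
  (insert (0 : Fin (2 * p + 2))
    ((Finset.univ.filter fun j : Fin p => j.1 < m ∧ a j = 1).image
      fun j => (⟨2 * j.1 + 1, by omega⟩ : Fin (2 * p + 2)))).max' (Finset.insert_nonempty _ _)

/-- The position at which the strand of `α(a)` starting at position `i` ends. In the `j`-th pair,
if `a j = 0` then the right strand moves one step to the left and the left strand goes to the
right up to the next pair marked `0`; if `a j = 1` then the left strand moves one step to the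
right and the right strand goes to the left up to the previous pair marked `1`. The first strand
goes to the first pair marked `0`, and the last strand to the last pair marked `1`. -/
def strandEnd (a : Fin p → Fin 2) (i : Fin (2 * p + 2)) : Fin (2 * p + 2) :=
  if h0 : i.1 = 0 then nextZero a 0
  else if hl : i.1 = 2 * p + 1 then prevOne a p
  else
    let j : Fin p := ⟨(i.1 - 1) / 2, by omega⟩
    if i.1 % 2 = 1 then
      if a j = 0 then nextZero a (j.1 + 1) else ⟨i.1 + 1, by omega⟩
    else
      if a j = 0 then ⟨i.1 - 1, by omega⟩ else prevOne a j.1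

lemma nextZero_mem (a : Fin p → Fin 2) (m : ℕ) : (nextZero a m).1 = 2 * p + 1 ∨
    ∃ j : Fin p, m ≤ j.1 ∧ a j = 0 ∧ (nextZero a m).1 = 2 * j.1 + 2 := by
  have h := Finset.min'_mem _ (Finset.insert_nonempty (Fin.last (2 * p + 1))
    ((Finset.univ.filter fun j : Fin p => m ≤ j.1 ∧ a j = 0).image
      fun j => (⟨2 * j.1 + 2, by omega⟩ : Fin (2 * p + 2))))
  rw [Finset.mem_insert, Finset.mem_image] at h
  rcases h with h | ⟨j, hj, h⟩
  · exact Or.inl (congrArg Fin.val h)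
  · rw [Finset.mem_filter] at hj
    exact Or.inr ⟨j, hj.2.1, hj.2.2, (congrArg Fin.val h).symm⟩

lemma nextZero_le (a : Fin p → Fin 2) (m : ℕ) (j : Fin p) (hm : m ≤ j.1) (hj : a j = 0) :
    (nextZero a m).1 ≤ 2 * j.1 + 2 := by
  have h : nextZero a m ≤ (⟨2 * j.1 + 2, by omega⟩ : Fin (2 * p + 2)) :=
    Finset.min'_le _ _ (Finset.mem_insert_of_mem (Finset.mem_image.2
      ⟨j, Finset.mem_filter.2 ⟨Finset.mem_univ _, hm, hj⟩, rfl⟩))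
  exact h

lemma prevOne_mem (a : Fin p → Fin 2) (m : ℕ) : (prevOne a m).1 = 0 ∨
    ∃ j : Fin p, j.1 < m ∧ a j = 1 ∧ (prevOne a m).1 = 2 * j.1 + 1 := by
  have h := Finset.max'_mem _ (Finset.insert_nonempty (0 : Fin (2 * p + 2))
    ((Finset.univ.filter fun j : Fin p => j.1 < m ∧ a j = 1).image
      fun j => (⟨2 * j.1 + 1, by omega⟩ : Fin (2 * p + 2))))
  rw [Finset.mem_insert, Finset.mem_image] at h
  rcases h with h | ⟨j, hj, h⟩
  · exact Or.inl (congrArg Fin.val h)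
  · rw [Finset.mem_filter] at hj
    exact Or.inr ⟨j, hj.2.1, hj.2.2, (congrArg Fin.val h).symm⟩

lemma le_prevOne (a : Fin p → Fin 2) (m : ℕ) (j : Fin p) (hm : j.1 < m) (hj : a j = 1) :
    2 * j.1 + 1 ≤ (prevOne a m).1 := by
  have h : (⟨2 * j.1 + 1, by omega⟩ : Fin (2 * p + 2)) ≤ prevOne a m :=
    Finset.le_max' _ (⟨2 * j.1 + 1, by omega⟩ : Fin (2 * p + 2)) (Finset.mem_insert_of_mem (Finset.mem_image.2
      ⟨j, Finset.mem_filter.2 ⟨Finset.mem_univ _, hm, hj⟩, rfl⟩))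
  exact h

lemma strandEnd_cases (a : Fin p → Fin 2) (i : Fin (2 * p + 2)) :
    (i.1 = 0 ∧ strandEnd a i = nextZero a 0) ∨
    (i.1 = 2 * p + 1 ∧ strandEnd a i = prevOne a p) ∨
    (∃ j : Fin p, i.1 = 2 * j.1 + 1 ∧ a j = 0 ∧ strandEnd a i = nextZero a (j.1 + 1)) ∨
    (∃ j : Fin p, i.1 = 2 * j.1 + 1 ∧ a j = 1 ∧ (strandEnd a i).1 = 2 * j.1 + 2) ∨
    (∃ j : Fin p, i.1 = 2 * j.1 + 2 ∧ a j = 0 ∧ (strandEnd a i).1 = 2 * j.1 + 1) ∨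
    (∃ j : Fin p, i.1 = 2 * j.1 + 2 ∧ a j = 1 ∧ strandEnd a i = prevOne a j.1) := by
  by_cases h0 : i.1 = 0
  · exact Or.inl ⟨h0, by simp [strandEnd, h0]⟩
  by_cases hl : i.1 = 2 * p + 1
  · exact Or.inr (Or.inl ⟨hl, by simp [strandEnd, hl]⟩)
  have hlt := i.2
  obtain ⟨j, hj⟩ : ∃ j : Fin p, j.1 = (i.1 - 1) / 2 := ⟨⟨(i.1 - 1) / 2, by omega⟩, rfl⟩
  have hj' : (⟨(i.1 - 1) / 2, by omega⟩ : Fin p) = j := Fin.ext hj.symm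
  have ha : a j = 0 ∨ a j = 1 := by omega
  by_cases hi : i.1 % 2 = 1
  · have e : i.1 = 2 * j.1 + 1 := by omega
    rcases ha with ha | ha
    · exact Or.inr (Or.inr (Or.inl ⟨j, e, ha, by simp [strandEnd, h0, hl, hi, ha, ← hj]⟩))
    · exact Or.inr (Or.inr (Or.inr (Or.inl
        ⟨j, e, ha, by simp [strandEnd, h0, hl, hi, hj', ha]; omega⟩)))
  · have e : i.1 = 2 * j.1 + 2 := by omega
    rcases ha with ha | ha
    · exact Or.inr (Or.inr (Or.inr (Or.inr (Or.inl
        ⟨j, e, ha, by simp [strandEnd, h0, hl, hi, hj', ha]; omega⟩))))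
    · exact Or.inr (Or.inr (Or.inr (Or.inr (Or.inr
        ⟨j, e, ha, by simp [strandEnd, h0, hl, hi, ha, ← hj]⟩))))

lemma nextZero_gt (a : Fin p → Fin 2) (j : Fin p) : 2 * j.1 + 2 < (nextZero a (j.1 + 1)).1 := by
  rcases nextZero_mem a (j.1 + 1) with h | ⟨j', h, -, h'⟩ <;> omega

lemma prevOne_lt (a : Fin p → Fin 2) (j : Fin p) : (prevOne a j.1).1 < 2 * j.1 + 1 := by
  rcases prevOne_mem a j.1 with h | ⟨j', h, -, h'⟩ <;> omega

lemma nextZero_ne (a : Fin p → Fin 2) (j : Fin p) (m : ℕ) (hm : m ≤ j.1) (hj : a j = 0) :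
    (nextZero a m).1 ≠ (nextZero a (j.1 + 1)).1 := by
  have h1 := nextZero_le a m j hm hj
  have h2 := nextZero_gt a j
  omega

lemma prevOne_ne (a : Fin p → Fin 2) (j : Fin p) (m : ℕ) (hm : j.1 < m) (hj : a j = 1) :
    (prevOne a m).1 ≠ (prevOne a j.1).1 := by
  have h1 := le_prevOne a m j hm hj
  have h2 := prevOne_lt a j
  omega

lemma nextZero_ne_prevOne (a : Fin p → Fin 2) (m m' : ℕ) :
    (nextZero a m).1 ≠ (prevOne a m').1 := by
  rcases nextZero_mem a m with h | ⟨j, -, -, h⟩ <;>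
  rcases prevOne_mem a m' with h' | ⟨j', -, -, h'⟩ <;> omega

lemma nextZero_ne_left (a : Fin p → Fin 2) (m : ℕ) (j : Fin p) :
    (nextZero a m).1 ≠ 2 * j.1 + 1 := by
  rcases nextZero_mem a m with h | ⟨j', -, -, h⟩ <;> omega

lemma nextZero_ne_right (a : Fin p → Fin 2) (m : ℕ) (j : Fin p) (hj : a j = 1) :
    (nextZero a m).1 ≠ 2 * j.1 + 2 := by
  intro hh
  rcases nextZero_mem a m with h | ⟨j', -, h0, h⟩
  · omega
  · have : j' = j := Fin.ext (by omega)
    subst this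
    omega

lemma prevOne_ne_right (a : Fin p → Fin 2) (m : ℕ) (j : Fin p) :
    (prevOne a m).1 ≠ 2 * j.1 + 2 := by
  rcases prevOne_mem a m with h | ⟨j', -, -, h⟩ <;> omega

lemma prevOne_ne_left (a : Fin p → Fin 2) (m : ℕ) (j : Fin p) (hj : a j = 0) :
    (prevOne a m).1 ≠ 2 * j.1 + 1 := by
  intro hh
  rcases prevOne_mem a m with h | ⟨j', -, h0, h⟩
  · omega
  · have : j' = j := Fin.ext (by omega)
    subst this
    omega

lemma strandEnd_ne_of_lt (a : Fin p → Fin 2) {i i' : Fin (2 * p + 2)} (hlt : i < i') :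
    (strandEnd a i).1 ≠ (strandEnd a i').1 := by
  have hlt' : i.1 < i'.1 := hlt
  have hi' := i'.2
  have c := strandEnd_cases a i
  have c' := strandEnd_cases a i'
  have z1 := nextZero_ne a
  have z2 := nextZero_ne_left a
  have z3 := nextZero_ne_right a
  have o1 := prevOne_ne a
  have o2 := prevOne_ne_left a
  have o3 := prevOne_ne_right a
  have zo := nextZero_ne_prevOne a
  simp only [Fin.ext_iff (b := nextZero a _), Fin.ext_iff (b := prevOne a _)] at c c'
  obtain ⟨Z, hZ⟩ : ∃ Z : ℕ → ℕ, ∀ m, (nextZero a m).1 = Z m := ⟨_, fun _ => rfl⟩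
  obtain ⟨O, hO⟩ : ∃ O : ℕ → ℕ, ∀ m, (prevOne a m).1 = O m := ⟨_, fun _ => rfl⟩
  simp only [hZ, hO] at c c' z1 z2 z3 o1 o2 o3 zo
  rcases c with ⟨h, e⟩ | ⟨h, e⟩ | ⟨j, h, hj, e⟩ | ⟨j, h, hj, e⟩ | ⟨j, h, hj, e⟩ | ⟨j, h, hj, e⟩ <;>
  rcases c' with ⟨h', e'⟩ | ⟨h', e'⟩ | ⟨j', h', hj', e'⟩ | ⟨j', h', hj', e'⟩ | ⟨j', h', hj', e'⟩ |
    ⟨j', h', hj', e'⟩ <;>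
  rw [e, e'] <;>
  first
  | omega
  | exact zo _ _
  | exact (zo _ _).symm
  | exact z2 _ _
  | exact (z2 _ _).symm
  | exact o3 _ _
  | exact (o3 _ _).symm
  | exact z3 _ _ ‹_›
  | exact (z3 _ _ ‹_›).symm
  | exact o2 _ _ ‹_›
  | exact (o2 _ _ ‹_›).symm
  | exact z1 _ _ (by omega) ‹_›
  | exact (o1 _ _ (by omega) ‹_›).symm

lemma strandEnd_injective (a : Fin p → Fin 2) : Function.Injective (strandEnd a) := by
  intro i i' h
  rcases lt_trichotomy i i' with hlt | heq | hlt
  · exact absurd (congrArg Fin.val h) (strandEnd_ne_of_lt a hlt)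
  · exact heq
  · exact absurd (congrArg Fin.val h).symm (strandEnd_ne_of_lt a hlt)

/-- The permutation induced by `α(a)`: the strand `i` ends at the position `rowPerm a i`. -/
def rowPerm (a : Fin p → Fin 2) : Equiv.Perm (Fin (2 * p + 2)) :=
  Equiv.ofBijective (strandEnd a) (Finite.injective_iff_bijective.1 (strandEnd_injective a))

/-- The permutation obtained by adding a new point at the position `q` which is kept fixed. -/
def insertFixed {n : ℕ} (q : Fin (n + 1)) (f : Equiv.Perm (Fin n)) : Equiv.Perm (Fin (n + 1)) :=
  ((finSuccEquiv' q).trans f.optionCongr).trans (finSuccEquiv' q).symm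

/-- `α(a)`, the permutation braid on `2p + 2` strands given by a binary row. -/
def rowBraid (a : Fin p → Fin 2) : Braid (2 * p + 2) := permBraid (rowPerm a)

/-- `α(a, b)`, obtained from `α(a)` by adding a straight vertical strand, immediately to the left
of the `b`-th pair (for `b < p`) or immediately to the left of the last strand (for `b = p`).
The new strand is at the position `2b + 1`, and all strands of the result are still straight. -/
def rowBraidOdd (a : Fin p → Fin 2) (b : Fin (p + 1)) : Braid (2 * p + 3) :=
  permBraid (insertFixed (⟨2 * b.1 + 1, by omega⟩ : Fin (2 * p + 2 + 1)) (rowPerm a))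

/-- Binary `k × p` matrices with first column `0` and last column `1`. -/
def AdmissibleMatrix (k p : ℕ) : Type :=
  {A : Matrix (Fin k) (Fin p) (Fin 2) //
    ∀ (i : Fin k) (j : Fin p), (j.1 = 0 → A i j = 0) ∧ (j.1 + 1 = p → A i j = 1)}

/-- `α(A) = α(A₁) ⋯ α(A_k)`, on `2p + 2` strands. -/
def alphaEven {k : ℕ} (A : AdmissibleMatrix k p) : Braid (2 * p + 2) :=
  (List.ofFn fun i => rowBraid (A.1 i)).prod

/-- `α(A, b) = α(A₁, b) ⋯ α(A_k, b)`, on `2p + 3` strands: the braid `α(A)` with a vertical strand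
added. -/
def alphaOdd {k : ℕ} (A : AdmissibleMatrix k p × Fin (p + 1)) : Braid (2 * p + 3) :=
  (List.ofFn fun i => rowBraidOdd (A.1.1 i) A.2).prod

end BinaryBraid

end

/-! ### Words of permutation braids -/

namespace Braid

variable {n : ℕ}

/-! A permutation braid is handled through its permutation: it ends with a crossing at `s` when the
strands ending at `s` and `s + 1` cross, and it begins with one only when the strands starting there
cross. So `F(β) ⊇ S(γ)` follows from a statement about descents, `LeftWeighted`. In an admissible
row, neighbouring strands at the start cross only inside a pair, because right strands of pairs go
left, left strands go right and the two outermost strands go inwards to the first and the last pair.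
On the other hand, the strands ending in a pair cross in every row. Hence any two rows are left
weighted (`leftWeighted_rowPerm`, and `leftWeighted_rowPermOdd` with the vertical strand), which
gives the canonical form and rigidity.

Injectivity needs that a left weighted product determines its factors (`leftWeighted_unique`). The
tool is the Lawrence–Krammer representation in the limit `t → 0`. It is singular there, but positive
words for the same braid still act equally, by continuity, and they act with nonnegative
coefficients. A permutation braid kills a unit mass at a pair of strands that it crosses.
Conversely, if the first factor does not cross a suitably chosen pair, the mass reaches a pair of
neighbouring positions whose strands have not crossed; left weightedness keeps the next factor from
killing it, and so on. Thus the crossings of the first factor are visible in the whole product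
(`inversion_of_mul_eq`).

For reduction systems, a loop is recorded by the gaps of the axis that it crosses, and a standard
circle becomes `c e⁻¹`. A braid with straight strands carries the vertical path through a gap to a
path that crosses the axis monotonically and separates the ends of the strands from the left of the
gap from those from its right (`permHom`). A letter at which the winding number has a local minimum
produces a minimum again if the strands on its two sides do not cross, and all minima of the image
lie in gaps at which the ending strands have not crossed. By left weightedness these gaps are good
for the next factor, so each factor destroys at most one minimum of a word, however long
(`exists_image`). The power `(c e⁻¹)^N` has no minima, but its image under the first factor has at
least `N - 2` as soon as a foreign strand ends between two strands from inside the circle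
(`Separates`), and this number survives up to a constant. A fixed conjugate of `(c' e'⁻¹)^N` has a
number of minima bounded independently of `N`, so no standard circle is sent to a standard circle
(`not_conj_of_separates`). What remains is that a binary row leaves no proper interval of at least
two strands together (`encloses_rowPerm`). -/

lemma ofWord_append (u v : List (Fin (n - 1))) : ofWord (u ++ v) = ofWord u * ofWord v := by
  simp [ofWord]

lemma ofWord_nil : ofWord ([] : List (Fin (n - 1))) = 1 := rfl

lemma ofWord_singleton (s : Fin (n - 1)) : ofWord [s] = σ s := by
  simp [ofWord]

lemma ofWord_cons (s : Fin (n - 1)) (w : List (Fin (n - 1))) :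
    ofWord (s :: w) = σ s * ofWord w := by
  simp [ofWord]

lemma σ_comm {i j : Fin (n - 1)} (h : i.1 + 1 < j.1) : σ i * σ j = σ j * σ i := by
  have h1 : (PresentedGroup.mk (braidRels n)) ((FreeGroup.of i * FreeGroup.of j) *
      (FreeGroup.of j * FreeGroup.of i)⁻¹) = 1 :=
    (PresentedGroup.mk_eq_one_iff).2 (Subgroup.subset_normalClosure ⟨i, j, Or.inl ⟨h, rfl⟩⟩)
  rw [map_mul, map_inv, mul_inv_eq_one] at h1
  simp only [map_mul] at h1
  exact h1

lemma σ_braid {i j : Fin (n - 1)} (h : i.1 + 1 = j.1) :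
    σ i * σ j * σ i = σ j * σ i * σ j := by
  have h1 : (PresentedGroup.mk (braidRels n))
      ((FreeGroup.of i * FreeGroup.of j * FreeGroup.of i) *
      (FreeGroup.of j * FreeGroup.of i * FreeGroup.of j)⁻¹) = 1 :=
    (PresentedGroup.mk_eq_one_iff).2 (Subgroup.subset_normalClosure ⟨i, j, Or.inr ⟨h, rfl⟩⟩)
  rw [map_mul, map_inv, mul_inv_eq_one] at h1
  simp only [map_mul] at h1
  exact h1

/-- The Artin generator with a natural number as its index, extended by `1`. -/
def gen (n k : ℕ) : Braid n := if h : k < n - 1 then σ ⟨k, h⟩ else 1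

lemma gen_val (s : Fin (n - 1)) : gen n s.1 = σ s := by simp [gen]

lemma gen_comm {i j : ℕ} (h : i + 1 < j) : gen n i * gen n j = gen n j * gen n i := by
  unfold gen
  split_ifs
  · exact σ_comm h
  all_goals simp

lemma gen_braid {i : ℕ} (h : i + 1 < n - 1) :
    gen n i * gen n (i + 1) * gen n i = gen n (i + 1) * gen n i * gen n (i + 1) := by
  unfold gen
  rw [dif_pos h, dif_pos (show i < n - 1 by omega)]
  exact σ_braid rfl

/-- The braid `σ (hi-1) ⋯ σ lo`, in which one strand moves from `hi` to `lo`. -/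
def strandMove (n lo hi : ℕ) : Braid n :=
  ofWord ((List.finRange (n - 1)).reverse.filter fun s => decide (lo ≤ s.1 ∧ s.1 < hi))

lemma strandMove_self (k : ℕ) : strandMove n k k = 1 := by
  have : ((List.finRange (n - 1)).reverse.filter fun s => decide (k ≤ s.1 ∧ s.1 < k)) = [] := by
    rw [List.filter_eq_nil_iff]
    intro a _
    simp only [decide_eq_true_eq]
    omega
  rw [strandMove, this, ofWord_nil]

lemma strandMove_eq_mul {lo hi : ℕ} (h : lo < hi) (hn : hi ≤ n - 1) :
    strandMove n lo hi = strandMove n (lo + 1) hi * gen n lo := by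
  have key : ((List.finRange (n - 1)).filter fun s => decide (lo ≤ s.1 ∧ s.1 < hi)) =
      ⟨lo, by omega⟩ ::
        ((List.finRange (n - 1)).filter fun s => decide (lo + 1 ≤ s.1 ∧ s.1 < hi)) := by
    apply List.Pairwise.eq_of_mem_iff (r := (· < ·))
    · exact (List.pairwise_lt_finRange _).filter _
    · refine List.Pairwise.cons ?_ ((List.pairwise_lt_finRange _).filter _)
      intro a ha
      simp only [List.mem_filter, decide_eq_true_eq] at ha
      rw [Fin.lt_def]
      simp only
      omega
    · intro a
      simp only [List.mem_filter, List.mem_finRange, true_and, decide_eq_true_eq,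
        List.mem_cons, Fin.ext_iff]
      omega
  rw [strandMove, strandMove, List.filter_reverse, key, List.reverse_cons, ofWord_append,
    ofWord_singleton, ← List.filter_reverse, ← gen_val]

lemma strandMove_mul_gen_of_lt {lo hi k : ℕ} (h : k + 1 < lo) (hlh : lo ≤ hi) (hn : hi ≤ n - 1) :
    strandMove n lo hi * gen n k = gen n k * strandMove n lo hi := by
  induction hlh using Nat.decreasingInduction with
  | self => simp [strandMove_self]
  | of_succ lo hlt ih =>
    rw [strandMove_eq_mul hlt hn, mul_assoc, ← gen_comm h, ← mul_assoc, ih (by omega), mul_assoc]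

/-- The moving strand shifts the strands at `lo, …, hi - 1` one place to the right, so a crossing of
two of them passes through the move with its index changed by one. This takes one braid relation, at
`k` and `k + 1`, and commutations. -/
lemma strandMove_mul_gen_of_ge {lo hi k : ℕ} (h : lo ≤ k) (hlh : k + 1 < hi) (hn : hi ≤ n - 1) :
    strandMove n lo hi * gen n (k + 1) = gen n k * strandMove n lo hi := by
  induction h using Nat.decreasingInduction with
  | self =>
    rw [strandMove_eq_mul (show k < hi by omega) hn, strandMove_eq_mul hlh hn, mul_assoc,
      mul_assoc, ← mul_assoc (gen n (k + 1)) (gen n k), ← gen_braid (by omega), ← mul_assoc,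
      ← mul_assoc, strandMove_mul_gen_of_lt (by omega) (by omega) hn]
    simp only [mul_assoc]
  | of_succ lo hlt ih =>
    rw [strandMove_eq_mul (show lo < hi by omega) hn, mul_assoc, gen_comm (by omega), ← mul_assoc,
      ih, mul_assoc]

/-- The part of `permBraid f` that puts the first `J` strands in place. -/
def permBraidUpTo (f : Equiv.Perm (Fin n)) (J : ℕ) : Braid n :=
  ((List.range J).map fun j =>
    if h : j < n then strandMove n (j - crossedFromLeft f ⟨j, h⟩) j else 1).prod

lemma permBraidUpTo_succ (f : Equiv.Perm (Fin n)) (j : Fin n) :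
    permBraidUpTo f (j.1 + 1) =
      permBraidUpTo f j.1 * strandMove n (j.1 - crossedFromLeft f j) j.1 := by
  simp [permBraidUpTo, List.range_succ]

lemma permBraid_eq_upTo (f : Equiv.Perm (Fin n)) : permBraid f = permBraidUpTo f n := by
  rw [permBraidUpTo, ← List.map_coe_finRange_eq_range, List.map_map, permBraid, permWord]
  generalize List.finRange n = L
  induction L with
  | nil => rfl
  | cons j L ih =>
    rw [List.flatMap_cons, ofWord_append, ih, List.map_cons, List.prod_cons]
    simp [strandMove]

/-- The number of strands among the first `J` that end on the left of `k`. -/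
def endLeft (f : Equiv.Perm (Fin n)) (J k : ℕ) : ℕ :=
  (Finset.univ.filter fun i : Fin n => i.1 < J ∧ (f i).1 < k).card

lemma endLeft_succ (f : Equiv.Perm (Fin n)) (j : Fin n) (k : ℕ) :
    endLeft f (j.1 + 1) k = endLeft f j.1 k + if (f j).1 < k then 1 else 0 := by
  unfold endLeft
  split_ifs with h
  · rw [← Finset.card_insert_of_notMem (a := j) (by simp)]
    congr 1
    ext i
    simp only [Finset.mem_filter, Finset.mem_univ, true_and, Finset.mem_insert, Fin.ext_iff]
    constructor
    · rintro ⟨h1, h2⟩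
      by_cases hij : i.1 = j.1
      · exact Or.inl hij
      · exact Or.inr ⟨by omega, h2⟩
    · rintro (h1 | h1)
      · have : i = j := Fin.ext h1
        subst this
        exact ⟨by omega, h⟩
      · exact ⟨by omega, h1.2⟩
  · rw [add_zero]
    congr 1
    ext i
    simp only [Finset.mem_filter, Finset.mem_univ, true_and]
    constructor
    · rintro ⟨h1, h2⟩
      have : i.1 ≠ j.1 := fun e => h (by rw [← Fin.ext e]; exact h2)
      exact ⟨by omega, h2⟩
    · rintro ⟨h1, h2⟩
      exact ⟨by omega, h2⟩

lemma crossedFromLeft_add_endLeft (f : Equiv.Perm (Fin n)) (j : Fin n) :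
    crossedFromLeft f j + endLeft f j.1 (f j).1 = j.1 := by
  unfold crossedFromLeft endLeft
  rw [← Finset.card_union_of_disjoint]
  · have : (Finset.univ.filter fun i : Fin n => i < j ∧ f j < f i) ∪
        (Finset.univ.filter fun i : Fin n => i.1 < j.1 ∧ (f i).1 < (f j).1) = Finset.Iio j := by
      ext i
      simp only [Finset.mem_union, Finset.mem_filter, Finset.mem_univ, true_and, Finset.mem_Iio,
        Fin.lt_def]
      constructor
      · rintro (h | h) <;> exact h.1
      · intro h
        have : (f i).1 ≠ (f j).1 := fun e => by
          have := f.injective (Fin.ext e)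
          subst this
          omega
        omega
    rw [this, Fin.card_Iio]
  · rw [Finset.disjoint_left]
    intro i hi hi'
    simp only [Finset.mem_filter, Finset.mem_univ, true_and, Fin.lt_def] at hi hi'
    omega

lemma endLeft_mono (f : Equiv.Perm (Fin n)) (J : ℕ) {k l : ℕ} (h : k ≤ l) :
    endLeft f J k ≤ endLeft f J l := by
  apply Finset.card_le_card
  intro i
  simp only [Finset.mem_filter, Finset.mem_univ, true_and]
  omega

lemma endLeft_lt (f : Equiv.Perm (Fin n)) {J k l : ℕ} (i : Fin n) (hi : i.1 < J)
    (hk : k ≤ (f i).1) (hl : (f i).1 < l) : endLeft f J k < endLeft f J l := by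
  apply Finset.card_lt_card
  rw [Finset.ssubset_iff_of_subset]
  · exact ⟨i, by simp [hi, hl], by simp [hk]⟩
  · intro i
    simp only [Finset.mem_filter, Finset.mem_univ, true_and]
    omega

lemma endLeft_self (f : Equiv.Perm (Fin n)) {k : ℕ} (hk : k ≤ n) : endLeft f n k = k := by
  unfold endLeft
  have : (Finset.univ.filter fun i : Fin n => i.1 < n ∧ (f i).1 < k) =
      (Finset.univ.filter fun i : Fin n => i.1 < k).map f.symm.toEmbedding := by
    ext i
    simp
  rw [this, Finset.card_map]
  have : (Finset.univ.filter fun i : Fin n => i.1 < k) =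
      (Finset.univ : Finset (Fin k)).map (Fin.castLEEmb hk) := by
    ext i
    simp only [Finset.mem_filter, Finset.mem_univ, true_and, Finset.mem_map]
    constructor
    · exact fun h => ⟨⟨i.1, h⟩, rfl⟩
    · rintro ⟨a, rfl⟩
      exact a.2
  rw [this, Finset.card_map, Finset.card_univ, Fintype.card_fin]

/-- The permutation in which the strands ending at the positions `s` and `s + 1` are exchanged. -/
def swapEnds (s : Fin (n - 1)) (f : Equiv.Perm (Fin n)) : Equiv.Perm (Fin n) :=
  Equiv.swap (leftPos s) (rightPos s) * f

lemma swapEnds_apply (s : Fin (n - 1)) (f : Equiv.Perm (Fin n)) (i : Fin n) :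
    swapEnds s f i = Equiv.swap (leftPos s) (rightPos s) (f i) := rfl

lemma swapEnds_swapEnds (s : Fin (n - 1)) (f : Equiv.Perm (Fin n)) :
    swapEnds s (swapEnds s f) = f := by
  simp [swapEnds, ← mul_assoc]

lemma swapEnds_symm (s : Fin (n - 1)) (f : Equiv.Perm (Fin n)) (a : Fin n) :
    (swapEnds s f).symm a = f.symm (Equiv.swap (leftPos s) (rightPos s) a) := by
  rw [Equiv.symm_apply_eq, swapEnds_apply]
  simp

lemma swapEnds_symm_left (s : Fin (n - 1)) (f : Equiv.Perm (Fin n)) :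
    (swapEnds s f).symm (leftPos s) = f.symm (rightPos s) := by
  rw [swapEnds_symm, Equiv.swap_apply_left]

lemma swapEnds_symm_right (s : Fin (n - 1)) (f : Equiv.Perm (Fin n)) :
    (swapEnds s f).symm (rightPos s) = f.symm (leftPos s) := by
  rw [swapEnds_symm, Equiv.swap_apply_right]

lemma swap_val (s : Fin (n - 1)) (a : Fin n) :
    (Equiv.swap (leftPos s) (rightPos s) a).1 =
      if a.1 = s.1 then s.1 + 1 else if a.1 = s.1 + 1 then s.1 else a.1 := by
  rw [Equiv.swap_apply_def]
  simp only [leftPos, rightPos, Fin.ext_iff]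
  split_ifs <;> rfl

/-- Exchanging the ends `s` and `s + 1` changes the relative order of the ends of only one pair of
strands, which is counted at the one starting later. -/
lemma crossedFromLeft_swapEnds (s : Fin (n - 1)) (f : Equiv.Perm (Fin n))
    (h : f.symm (leftPos s) < f.symm (rightPos s)) (j : Fin n) :
    crossedFromLeft (swapEnds s f) j =
      crossedFromLeft f j + if j = f.symm (rightPos s) then 1 else 0 := by
  have hl : (f (f.symm (leftPos s))).1 = s.1 := by simp [leftPos]
  have hr : (f (f.symm (rightPos s))).1 = s.1 + 1 := by simp [rightPos]
  have hinj : ∀ i i', (f i).1 = (f i').1 → i = i' := fun i i' e => f.injective (Fin.ext e)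
  unfold crossedFromLeft
  split_ifs with hj
  · subst hj
    rw [← Finset.card_insert_of_notMem (a := f.symm (leftPos s))
      (by simp only [Finset.mem_filter, Equiv.apply_symm_apply, leftPos, rightPos, Fin.lt_def]
          omega)]
    congr 1
    ext i
    simp only [Finset.mem_filter, Finset.mem_univ, true_and, Finset.mem_insert, Fin.lt_def,
      swapEnds_apply, swap_val] at *
    rw [hr]
    by_cases e : i = f.symm (leftPos s)
    · subst e
      rw [hl]
      simp only [h, true_and, true_or, if_true, iff_true]
      split_ifs <;> omega
    · have : (f i).1 ≠ s.1 := fun e' => e (hinj _ _ (by rw [e', hl]))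
      simp only [e, false_or, this, if_false, if_true]
      constructor
      · rintro ⟨h1, h2⟩
        refine ⟨h1, ?_⟩
        split_ifs at h2 <;> omega
      · rintro ⟨h1, h2⟩
        refine ⟨h1, ?_⟩
        split_ifs <;> omega
  · rw [add_zero]
    congr 1
    ext i
    simp only [Finset.mem_filter, Finset.mem_univ, true_and, Fin.lt_def, swapEnds_apply, swap_val]
    have h1 : (f j).1 ≠ s.1 + 1 := fun e => hj (hinj _ _ (by rw [e, hr]))
    have h2 : (f i).1 = s.1 + 1 → i = f.symm (rightPos s) := fun e => hinj _ _ (by rw [e, hr])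
    have h3 : (f j).1 = s.1 → j = f.symm (leftPos s) := fun e => hinj _ _ (by rw [e, hl])
    apply and_congr_right
    intro hij
    by_cases e : (f i).1 = s.1 + 1
    · have e1 := h2 e
      have : (f j).1 ≠ s.1 := fun e' => by
        have e2 := h3 e'
        rw [← e1, ← e2, Fin.lt_def] at h
        omega
      simp only [h1, e, this, if_false, if_true]
      split_ifs <;> omega
    · split_ifs <;> omega

/-- Let `l < r` be the starts of the strands ending at `s` and `s + 1`. The two standard words agree
up to the strand `r`, which then makes one more step, across `l`. This extra letter slides to the
right through the moves of all later strands and comes out as `σ s`. -/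
lemma permBraid_swapEnds (s : Fin (n - 1)) (f : Equiv.Perm (Fin n))
    (h : f.symm (leftPos s) < f.symm (rightPos s)) :
    permBraid (swapEnds s f) = permBraid f * σ s := by
  have hl : (f (f.symm (leftPos s))).1 = s.1 := by simp [leftPos]
  have hr : (f (f.symm (rightPos s))).1 = s.1 + 1 := by simp [rightPos]
  have hinj : ∀ i i', (f i).1 = (f i').1 → i = i' := fun i i' e => f.injective (Fin.ext e)
  set l := f.symm (leftPos s) with hl'
  set r := f.symm (rightPos s) with hr'
  have hcr := crossedFromLeft_swapEnds s f h
  rw [← hr'] at hcr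
  have before : ∀ J, J ≤ r.1 → permBraidUpTo (swapEnds s f) J = permBraidUpTo f J := by
    intro J hJ
    induction J with
    | zero => rfl
    | succ J ih =>
      have hJn : J < n := by omega
      rw [permBraidUpTo_succ f ⟨J, hJn⟩, permBraidUpTo_succ (swapEnds s f) ⟨J, hJn⟩,
        ih (by omega), hcr, if_neg (by simp [Fin.ext_iff]; omega), add_zero]
  -- After `J` strands are in place, the extra crossing sits at the current position of `l`, which
  -- is the number of strands among them ending to the left of `s`.
  have after : ∀ J, r.1 < J → J ≤ n → permBraidUpTo (swapEnds s f) J =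
      permBraidUpTo f J * gen n (endLeft f J s.1) := by
    intro J hJ
    induction J, hJ using Nat.le_induction with
    | base =>
      intro _
      have e1 := crossedFromLeft_add_endLeft f r
      have e2 : endLeft f r.1 s.1 < endLeft f r.1 (f r).1 :=
        endLeft_lt f l h (by omega) (by omega)
      -- Only `l` ends at `s`, so passing from `s` to `s + 1` adds just one strand to the count.
      -- With `e2`, the move of `r` in `f` stops immediately to the right of `l`.
      have e3 : endLeft f r.1 (f r).1 ≤ endLeft f r.1 s.1 + 1 := by
        have : endLeft f r.1 (f r).1 ≤ endLeft f (l.1 + 1) (f r).1 + (endLeft f r.1 s.1 -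
            endLeft f (l.1 + 1) s.1) := by
          have hsub : ∀ J, l.1 < J → J ≤ n → endLeft f J (s.1 + 1) = endLeft f J s.1 + 1 := by
            intro J hJ
            induction J, hJ using Nat.le_induction with
            | base =>
              intro _
              have : endLeft f l.1 (s.1 + 1) = endLeft f l.1 s.1 := by
                unfold endLeft
                congr 1
                ext i
                simp only [Finset.mem_filter, Finset.mem_univ, true_and]
                have := hinj i l
                constructor
                · rintro ⟨h1, h2⟩
                  refine ⟨h1, ?_⟩
                  by_contra h3
                  have := this (by omega)
                  subst this
                  omega
                · rintro ⟨h1, h2⟩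
                  omega
              rw [Nat.succ_eq_add_one, endLeft_succ, endLeft_succ, this, if_pos (by omega),
                if_neg (by omega)]
            | succ J hJ ih =>
              intro hJn
              have e := endLeft_succ f ⟨J, by omega⟩
              simp only at e
              rw [e, e, ih (by omega)]
              have : (f ⟨J, by omega⟩).1 ≠ s.1 := fun e' => by
                have e2 := hinj _ l (by rw [e', hl])
                have := congrArg Fin.val e2
                simp only at this
                omega
              split_ifs <;> omega
          have e4 := hsub r.1 h (by omega)
          have e5 := hsub (l.1 + 1) (by omega) (by omega)
          rw [hr, e4, e5]
          omega
        have e6 : endLeft f (l.1 + 1) s.1 ≤ endLeft f r.1 s.1 := by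
          apply Finset.card_le_card
          intro i
          have := Fin.lt_def.1 h
          simp only [Finset.mem_filter, Finset.mem_univ, true_and]
          omega
        have e7 : endLeft f (l.1 + 1) (f r).1 ≤ endLeft f (l.1 + 1) s.1 + 1 := by
          rw [hr, endLeft_succ, endLeft_succ, if_pos (by omega), if_neg (by omega)]
          have : endLeft f l.1 (s.1 + 1) ≤ endLeft f l.1 s.1 := by
            apply Finset.card_le_card
            intro i
            simp only [Finset.mem_filter, Finset.mem_univ, true_and]
            rintro ⟨h1, h2⟩
            refine ⟨h1, ?_⟩
            by_contra h3
            have := hinj i l (by omega)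
            subst this
            omega
          omega
        omega
      have e4 := endLeft_succ f r s.1
      rw [if_neg (by omega), add_zero] at e4
      rw [Nat.succ_eq_add_one, permBraidUpTo_succ, permBraidUpTo_succ, before _ le_rfl, hcr,
        if_pos rfl, e4, mul_assoc]
      congr 1
      have e5 : r.1 - crossedFromLeft f r = endLeft f r.1 s.1 + 1 := by omega
      have e6 : r.1 - (crossedFromLeft f r + 1) = endLeft f r.1 s.1 := by omega
      rw [e5, e6]
      exact strandMove_eq_mul (by omega) (by omega)
    | succ J hJ ih =>
      intro hJn
      have hJn' : J < n := hJn
      have c1 := permBraidUpTo_succ f ⟨J, hJn'⟩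
      have c2 := permBraidUpTo_succ (swapEnds s f) ⟨J, hJn'⟩
      have c3 := endLeft_succ f ⟨J, hJn'⟩ s.1
      have c4 := crossedFromLeft_add_endLeft f ⟨J, hJn'⟩
      have hne : (f ⟨J, hJn'⟩).1 ≠ s.1 := fun e => by
        have := congrArg Fin.val (hinj _ l (by rw [e, hl]))
        have h' := Fin.lt_def.1 h
        simp only at this
        omega
      have hne' : (f ⟨J, hJn'⟩).1 ≠ s.1 + 1 := fun e => by
        have := congrArg Fin.val (hinj _ r (by rw [e, hr]))
        simp only at this
        omega
      simp only at c1 c2 c3 c4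
      rw [c1, c2, ih (by omega), hcr, if_neg (by simp [Fin.ext_iff]; omega), add_zero, mul_assoc,
        mul_assoc, c3]
      congr 1
      have hlJ : l.1 < J := by
        have := Fin.lt_def.1 h
        omega
      -- A strand ending to the left of `s` passes both `l` and `r`, which raises the index of the
      -- crossing by one; any other strand stops to the right of both and its move commutes with the
      -- crossing.
      by_cases hlt : (f ⟨J, hJn'⟩).1 < s.1
      · rw [if_pos hlt, strandMove_mul_gen_of_ge _ _ (by omega)]
        · have := endLeft_mono f J hlt.le
          omega
        · have h1 := endLeft_lt f (J := J) (k := s.1) (l := s.1 + 1) l hlJ (by omega) (by omega)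
          have h2 := endLeft_lt f (J := J) (k := s.1 + 1) (l := n) r (by omega) (by omega)
            (f r).2
          have h3 : endLeft f J n ≤ J := by
            calc endLeft f J n ≤ (Finset.Iio (⟨J, hJn'⟩ : Fin n)).card := by
                  apply Finset.card_le_card
                  intro i
                  simp only [Finset.mem_filter, Finset.mem_univ, true_and, Finset.mem_Iio,
                    Fin.lt_def]
                  exact fun h => h.1
              _ = J := by rw [Fin.card_Iio]
          omega
      · rw [if_neg hlt, add_zero, strandMove_mul_gen_of_lt _ (by omega) (by omega)]
        have h1 := endLeft_lt f (J := J) (k := s.1) (l := s.1 + 1) l hlJ (by omega) (by omega)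
        have h2 := endLeft_lt f (J := J) (k := s.1 + 1) (l := (f ⟨J, hJn'⟩).1) r (by omega)
          (by omega) (by omega)
        omega
  rw [permBraid_eq_upTo, permBraid_eq_upTo, after n r.2 le_rfl, endLeft_self f (by omega), gen_val]

/-- `IsReducedWord w f`: the word `w` is a reduced word of the permutation `f`, that is, each of
its letters makes two strands cross that have not crossed before. -/
inductive IsReducedWord : List (Fin (n - 1)) → Equiv.Perm (Fin n) → Prop
  | nil : IsReducedWord [] 1
  | snoc {w f} (s : Fin (n - 1)) : IsReducedWord w f → f.symm (leftPos s) < f.symm (rightPos s) →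
      IsReducedWord (w ++ [s]) (swapEnds s f)

lemma crossedFromLeft_one (j : Fin n) : crossedFromLeft 1 j = 0 := by
  rw [crossedFromLeft, Finset.card_eq_zero, Finset.filter_eq_empty_iff]
  intro i _ h
  exact absurd h.1 (not_lt.2 h.2.le)

lemma permBraid_one : permBraid (1 : Equiv.Perm (Fin n)) = 1 := by
  rw [permBraid_eq_upTo, permBraidUpTo]
  apply List.prod_eq_one
  intro x hx
  obtain ⟨j, -, rfl⟩ := List.mem_map.1 hx
  split_ifs
  · rw [crossedFromLeft_one, Nat.sub_zero, strandMove_self]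
  · rfl

lemma eq_one_of_no_descent (f : Equiv.Perm (Fin n))
    (h : ∀ s : Fin (n - 1), f (leftPos s) < f (rightPos s)) : f = 1 := by
  obtain _ | n := n
  · exact Subsingleton.elim _ _
  · have : StrictMono f := Fin.strictMono_iff_lt_succ.2 fun s => h s
    ext i
    have := congrArg (fun g : Fin (n + 1) ≃o Fin (n + 1) => g i)
      (Subsingleton.elim (this.orderIsoOfSurjective f f.surjective) (OrderIso.refl _))
    exact congrArg Fin.val this

/-- Induction on the number of inversions, `∑ j, crossedFromLeft f j`: undoing a crossing of two
strands with neighbouring ends lowers it by one, and without such a crossing `f = 1`. -/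
lemma exists_isReducedWord (f : Equiv.Perm (Fin n)) :
    ∃ w, IsReducedWord w f ∧ ofWord w = permBraid f := by
  induction hN : ∑ j, crossedFromLeft f j using Nat.strong_induction_on generalizing f with
  | _ N ih =>
  by_cases hd : ∀ s : Fin (n - 1), f.symm (leftPos s) < f.symm (rightPos s)
  · have : f = 1 := by
      have := eq_one_of_no_descent f.symm hd
      exact inv_eq_one.1 this
    subst this
    exact ⟨[], IsReducedWord.nil, permBraid_one.symm⟩
  · push Not at hd
    obtain ⟨s, hs⟩ := hd
    have hs' : f.symm (rightPos s) < f.symm (leftPos s) :=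
      lt_of_le_of_ne hs fun e => leftPos_ne_rightPos s (f.symm.injective e).symm
    have ha : (swapEnds s f).symm (leftPos s) < (swapEnds s f).symm (rightPos s) := by
      rwa [swapEnds_symm_left, swapEnds_symm_right]
    have hc := crossedFromLeft_swapEnds s _ ha
    have hb := permBraid_swapEnds s _ ha
    rw [swapEnds_swapEnds] at hc hb
    obtain ⟨w, hw, hw'⟩ := ih (∑ j, crossedFromLeft (swapEnds s f) j) (by
      rw [← hN]
      simp only [hc, Finset.sum_add_distrib, Finset.sum_ite_eq', Finset.mem_univ, if_true]
      omega) _ rfl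
    refine ⟨w ++ [s], ?_, by rw [ofWord_append, hw', ofWord_singleton, hb]⟩
    have := hw.snoc s ha
    rwa [swapEnds_swapEnds] at this

lemma crossings_append (w : List (Fin (n - 1))) (s : Fin (n - 1)) (i j : Fin n) :
    crossings (w ++ [s]) i j = crossings w i j +
      crossings [s] (w.foldl (fun a s => Equiv.swap (leftPos s) (rightPos s) a) i)
        (w.foldl (fun a s => Equiv.swap (leftPos s) (rightPos s) a) j) := by
  induction w generalizing i j with
  | nil =>
    simp only [List.nil_append, List.foldl_nil, crossings, zero_add]
    rfl
  | cons t w ih =>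
    rw [List.cons_append, crossings, ih, List.foldl_cons, List.foldl_cons, ← add_assoc]
    rfl

lemma IsReducedWord.foldl_eq {w : List (Fin (n - 1))} {f : Equiv.Perm (Fin n)}
    (h : IsReducedWord w f) (i : Fin n) :
    w.foldl (fun a s => Equiv.swap (leftPos s) (rightPos s) a) i = f i := by
  induction h with
  | nil => rfl
  | snoc s h hs ih => rw [List.foldl_append, ih]; rfl

lemma IsReducedWord.crossings_eq {w : List (Fin (n - 1))} {f : Equiv.Perm (Fin n)}
    (h : IsReducedWord w f) {i j : Fin n} (hij : i < j) :
    crossings w i j = (if f j < f i then 1 else 0) ∧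
      crossings w j i = (if f j < f i then 1 else 0) := by
  induction h with
  | nil => simp [crossings, hij.not_gt]
  | @snoc w f s h hs ih =>
    have e1 : f i = leftPos s → i = f.symm (leftPos s) := fun e => by simp [← e]
    have e2 : f i = rightPos s → i = f.symm (rightPos s) := fun e => by simp [← e]
    have e3 : f j = leftPos s → j = f.symm (leftPos s) := fun e => by simp [← e]
    have e4 : f j = rightPos s → j = f.symm (rightPos s) := fun e => by simp [← e]
    have e5 : ¬ (f i = rightPos s ∧ f j = leftPos s) := fun e => by
      rw [← e2 e.1, ← e3 e.2] at hs
      exact absurd hs (not_lt.2 hij.le)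
    have e6 : (f i).1 ≠ (f j).1 := fun e => hij.ne (f.injective (Fin.ext e))
    rw [crossings_append, crossings_append, h.foldl_eq, h.foldl_eq, ih.1, ih.2]
    simp only [crossings, swapEnds_apply, Fin.lt_def, swap_val, add_zero]
    simp only [Fin.ext_iff, leftPos, rightPos] at e5 ⊢
    constructor <;> split_ifs <;> omega

lemma isPermutationBraid_permBraid (f : Equiv.Perm (Fin n)) : IsPermutationBraid (permBraid f) := by
  obtain ⟨w, hw, hw'⟩ := exists_isReducedWord f
  refine ⟨w, hw', fun i j hij => ?_⟩
  rcases lt_or_gt_of_ne hij with h | h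
  · rw [(hw.crossings_eq h).1]
    split_ifs <;> simp
  · rw [(hw.crossings_eq h).2]
    split_ifs <;> simp

lemma mem_finishingSet_permBraid {f : Equiv.Perm (Fin n)} {s : Fin (n - 1)}
    (h : f.symm (rightPos s) < f.symm (leftPos s)) : s ∈ finishingSet (permBraid f) := by
  refine ⟨permBraid (swapEnds s f), isPermutationBraid_permBraid _, ?_⟩
  have := permBraid_swapEnds s (swapEnds s f) (by
    rwa [swapEnds_symm_left, swapEnds_symm_right])
  rwa [swapEnds_swapEnds] at this

end Braid

/-! ### The Lawrence–Krammer representation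

A braid acts from the right on functions of pairs `i < j` of punctures. The parameter `q` of the
representation is specialised to `1 / 2`, the parameter `t` is kept, and the standard basis is
rescaled so that the coefficients do not depend on the pair. -/

namespace Braid

variable {n : ℕ}

/-- The action of the `s`-th Artin generator in the dual Lawrence–Krammer representation. -/
noncomputable def lkAct (t : ℝ) (s : ℕ) (φ : ℕ → ℕ → ℝ) (i j : ℕ) : ℝ :=
  if j ≤ i then φ i j
  else if i = s then
    if j = s + 1 then t / 4 * φ s (s + 1) else φ (s + 1) j - t / 4 * φ s (s + 1)
  else if i = s + 1 then (φ s j + φ (s + 1) j) / 2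
  else if j = s then (φ i s + φ i (s + 1)) / 2
  else if j = s + 1 then φ i s - t / 4 * φ s (s + 1)
  else if i < s ∧ s + 1 < j then φ i j + t / 4 * φ s (s + 1)
  else φ i j

/-- The inverse of `lkAct`, for `t ≠ 0`. -/
noncomputable def lkInv (t : ℝ) (s : ℕ) (φ : ℕ → ℕ → ℝ) (i j : ℕ) : ℝ :=
  if j ≤ i then φ i j
  else if i = s then
    if j = s + 1 then 4 / t * φ s (s + 1) else 2 * φ (s + 1) j - φ s j - φ s (s + 1)
  else if i = s + 1 then φ s j + φ s (s + 1)
  else if j = s then φ i (s + 1) + φ s (s + 1)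
  else if j = s + 1 then 2 * φ i s - φ i (s + 1) - φ s (s + 1)
  else if i < s ∧ s + 1 < j then φ i j - φ s (s + 1)
  else φ i j

section Values

variable (t : ℝ) {s i j : ℕ} (φ : ℕ → ℕ → ℝ)

lemma lkAct_of_le (h : j ≤ i) : lkAct t s φ i j = φ i j := if_pos h

lemma lkAct_self (hi : i = s) (hj : j = s + 1) : lkAct t s φ i j = t / 4 * φ s (s + 1) := by
  subst hi hj
  simp [lkAct]

lemma lkAct_left (hi : i = s) (hj : s + 1 < j) :
    lkAct t s φ i j = φ (s + 1) j - t / 4 * φ s (s + 1) := by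
  subst hi
  rw [lkAct, if_neg (by omega), if_pos rfl, if_neg (by omega)]

lemma lkAct_left_succ (hi : i = s + 1) (hj : s + 1 < j) :
    lkAct t s φ i j = (φ s j + φ (s + 1) j) / 2 := by
  subst hi
  rw [lkAct, if_neg (by omega), if_neg (by omega), if_pos rfl]

lemma lkAct_right (hi : i < s) (hj : j = s) :
    lkAct t s φ i j = (φ i s + φ i (s + 1)) / 2 := by
  subst hj
  rw [lkAct, if_neg (by omega), if_neg (by omega), if_neg (by omega), if_pos rfl]

lemma lkAct_right_succ (hi : i < s) (hj : j = s + 1) :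
    lkAct t s φ i j = φ i s - t / 4 * φ s (s + 1) := by
  subst hj
  rw [lkAct, if_neg (by omega), if_neg (by omega), if_neg (by omega), if_neg (by omega),
    if_pos rfl]

lemma lkAct_around (hi : i < s) (hj : s + 1 < j) :
    lkAct t s φ i j = φ i j + t / 4 * φ s (s + 1) := by
  rw [lkAct, if_neg (by omega), if_neg (by omega), if_neg (by omega), if_neg (by omega),
    if_neg (by omega), if_pos ⟨hi, hj⟩]

lemma lkAct_lt (hj : j < s) : lkAct t s φ i j = φ i j := by
  rw [lkAct]
  split_ifs <;> first | rfl | omega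

lemma lkAct_gt (hi : s + 1 < i) : lkAct t s φ i j = φ i j := by
  rw [lkAct]
  split_ifs <;> first | rfl | omega

end Values

lemma lkInv_lkAct {t : ℝ} (ht : t ≠ 0) (s : ℕ) (φ : ℕ → ℕ → ℝ) :
    lkInv t s (lkAct t s φ) = φ := by
  funext i j
  unfold lkInv
  split_ifs with h1 h2 h3 h4 h5 h6 h7
  · simp (disch := omega) only [lkAct_of_le]
  · subst h2 h3
    simp (disch := omega) only [lkAct_self]
    field_simp
  · subst h2
    simp (disch := omega) only [lkAct_self, lkAct_left, lkAct_left_succ]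
    ring
  · subst h4
    simp (disch := omega) only [lkAct_self, lkAct_left]
    ring
  · subst h5
    simp (disch := omega) only [lkAct_self, lkAct_right_succ]
    ring
  · subst h6
    simp (disch := omega) only [lkAct_self, lkAct_right, lkAct_right_succ]
    ring
  · obtain ⟨h7, h8⟩ := h7
    simp (disch := omega) only [lkAct_self, lkAct_around]
    ring
  · rcases lt_or_ge j s with h8 | h8
    · simp (disch := omega) only [lkAct_lt]
    · simp (disch := omega) only [lkAct_gt]

lemma lkAct_lkInv {t : ℝ} (ht : t ≠ 0) (s : ℕ) (φ : ℕ → ℕ → ℝ) :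
    lkAct t s (lkInv t s φ) = φ := by
  have e0 : lkInv t s φ s (s + 1) = 4 / t * φ s (s + 1) := by simp [lkInv]
  have e1 : ∀ j, s + 1 < j → lkInv t s φ s j = 2 * φ (s + 1) j - φ s j - φ s (s + 1) := by
    intro j hj
    rw [lkInv, if_neg (by omega), if_pos rfl, if_neg (by omega)]
  have e2 : ∀ j, s + 1 < j → lkInv t s φ (s + 1) j = φ s j + φ s (s + 1) := by
    intro j hj
    rw [lkInv, if_neg (by omega), if_neg (by omega), if_pos rfl]
  have e3 : ∀ i, i < s → lkInv t s φ i s = φ i (s + 1) + φ s (s + 1) := by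
    intro j hj
    rw [lkInv, if_neg (by omega), if_neg (by omega), if_neg (by omega), if_pos rfl]
  have e4 : ∀ i, i < s → lkInv t s φ i (s + 1) = 2 * φ i s - φ i (s + 1) - φ s (s + 1) := by
    intro j hj
    rw [lkInv, if_neg (by omega), if_neg (by omega), if_neg (by omega), if_neg (by omega),
      if_pos rfl]
  funext i j
  unfold lkAct
  split_ifs with h1 h2 h3 h4 h5 h6 h7
  · rw [lkInv, if_pos h1]
  · subst h2 h3
    rw [e0]
    field_simp
  · subst h2
    rw [e0, e2 _ (by omega)]
    field_simp
    ring
  · subst h4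
    rw [e1 _ (by omega), e2 _ (by omega)]
    ring
  · subst h5
    rw [e3 _ (by omega), e4 _ (by omega)]
    ring
  · subst h6
    rw [e0, e3 _ (by omega)]
    field_simp
    ring
  · obtain ⟨h7, h8⟩ := h7
    rw [e0, lkInv, if_neg h1, if_neg h2, if_neg h4, if_neg h5, if_neg h6, if_pos ⟨h7, h8⟩]
    field_simp
    ring
  · rw [lkInv, if_neg h1, if_neg h2, if_neg h4, if_neg h5, if_neg h6, if_neg h7]

lemma lkAct_comm (t : ℝ) {r s : ℕ} (h : r + 1 < s) (φ : ℕ → ℕ → ℝ) :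
    lkAct t s (lkAct t r φ) = lkAct t r (lkAct t s φ) := by
  funext i j
  rcases le_or_gt j i with hij | hij
  · simp (disch := omega) only [lkAct_of_le]
  rcases lt_trichotomy i r with hi | hi | hi
  · rcases lt_trichotomy j r with hj | hj | hj
    · simp (disch := omega) only [lkAct_lt]
    · subst hj
      simp (disch := omega) only [lkAct_lt, lkAct_right]
    rcases eq_or_lt_of_le (Nat.succ_le_of_lt hj) with hj | hj
    · rw [Nat.succ_eq_add_one] at hj
      subst hj
      simp (disch := omega) only [lkAct_lt, lkAct_right_succ]
    rcases lt_trichotomy j s with hj' | hj' | hj'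
    · simp (disch := omega) only [lkAct_lt, lkAct_around]
    · subst hj'
      simp (disch := omega) only [lkAct_lt, lkAct_around, lkAct_right]
      ring
    rcases eq_or_lt_of_le (Nat.succ_le_of_lt hj') with hj' | hj'
    · rw [Nat.succ_eq_add_one] at hj'
      subst hj'
      simp (disch := omega) only [lkAct_lt, lkAct_gt, lkAct_around, lkAct_right_succ]
      ring
    · simp (disch := omega) only [lkAct_lt, lkAct_gt, lkAct_around]
      ring
  · subst hi
    rcases eq_or_lt_of_le (Nat.succ_le_of_lt hij) with hj | hj
    · rw [Nat.succ_eq_add_one] at hj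
      subst hj
      simp (disch := omega) only [lkAct_lt, lkAct_self]
    rcases lt_trichotomy j s with hj' | hj' | hj'
    · simp (disch := omega) only [lkAct_lt, lkAct_left]
    · subst hj'
      simp (disch := omega) only [lkAct_lt, lkAct_left, lkAct_right]
      ring
    rcases eq_or_lt_of_le (Nat.succ_le_of_lt hj') with hj' | hj'
    · rw [Nat.succ_eq_add_one] at hj'
      subst hj'
      simp (disch := omega) only [lkAct_lt, lkAct_gt, lkAct_left, lkAct_right_succ]
      ring
    · simp (disch := omega) only [lkAct_lt, lkAct_gt, lkAct_left, lkAct_around]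
      ring
  rcases eq_or_lt_of_le (Nat.succ_le_of_lt hi) with hi | hi
  · rw [Nat.succ_eq_add_one] at hi
    subst hi
    rcases lt_trichotomy j s with hj' | hj' | hj'
    · simp (disch := omega) only [lkAct_lt, lkAct_left_succ]
    · subst hj'
      simp (disch := omega) only [lkAct_left_succ, lkAct_right]
      ring
    rcases eq_or_lt_of_le (Nat.succ_le_of_lt hj') with hj' | hj'
    · rw [Nat.succ_eq_add_one] at hj'
      subst hj'
      simp (disch := omega) only [lkAct_gt, lkAct_left_succ, lkAct_right_succ]
      ring
    · simp (disch := omega) only [lkAct_gt, lkAct_left_succ, lkAct_around]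
      ring
  rcases lt_trichotomy i s with hi' | hi' | hi'
  · rcases lt_trichotomy j s with hj' | hj' | hj'
    · simp (disch := omega) only [lkAct_lt, lkAct_gt]
    · subst hj'
      simp (disch := omega) only [lkAct_gt, lkAct_right]
    rcases eq_or_lt_of_le (Nat.succ_le_of_lt hj') with hj' | hj'
    · rw [Nat.succ_eq_add_one] at hj'
      subst hj'
      simp (disch := omega) only [lkAct_gt, lkAct_right_succ]
    · simp (disch := omega) only [lkAct_gt, lkAct_around]
  · subst hi'
    rcases eq_or_lt_of_le (Nat.succ_le_of_lt hij) with hj | hj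
    · rw [Nat.succ_eq_add_one] at hj
      subst hj
      simp (disch := omega) only [lkAct_gt, lkAct_self]
    · simp (disch := omega) only [lkAct_gt, lkAct_left]
  rcases eq_or_lt_of_le (Nat.succ_le_of_lt hi') with hi' | hi'
  · rw [Nat.succ_eq_add_one] at hi'
    subst hi'
    simp (disch := omega) only [lkAct_gt, lkAct_left_succ]
  · simp (disch := omega) only [lkAct_gt]

lemma lkAct_braid (t : ℝ) (s : ℕ) (φ : ℕ → ℕ → ℝ) :
    lkAct t s (lkAct t (s + 1) (lkAct t s φ)) =
      lkAct t (s + 1) (lkAct t s (lkAct t (s + 1) φ)) := by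
  funext i j
  rcases le_or_gt j i with hij | hij
  · simp (disch := omega) only [lkAct_of_le]
  have hi : i < s ∨ i = s ∨ i = s + 1 ∨ i = s + 2 ∨ s + 2 < i := by omega
  have hj : j < s ∨ j = s ∨ j = s + 1 ∨ j = s + 2 ∨ s + 2 < j := by omega
  rcases hi with hi | hi | hi | hi | hi <;> rcases hj with hj | hj | hj | hj | hj <;>
  first
  | omega
  | (simp (disch := omega) only [lkAct_lt, lkAct_gt, lkAct_self, lkAct_left, lkAct_left_succ,
      lkAct_right, lkAct_right_succ, lkAct_around]; done)
  | (simp (disch := omega) only [lkAct_lt, lkAct_gt, lkAct_self, lkAct_left, lkAct_left_succ,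
      lkAct_right, lkAct_right_succ, lkAct_around, hi, hj]; ring)

/-- The Lawrence–Krammer representation, for a nonzero parameter `t`. -/
noncomputable def lkPerm {t : ℝ} (ht : t ≠ 0) (s : ℕ) : Equiv.Perm (ℕ → ℕ → ℝ) where
  toFun := lkAct t s
  invFun := lkInv t s
  left_inv := lkInv_lkAct ht s
  right_inv := lkAct_lkInv ht s

/-- The Lawrence–Krammer representation of the braid group, for `t ≠ 0`. -/
noncomputable def lkRep (n : ℕ) {t : ℝ} (ht : t ≠ 0) :
    Braid n →* (Equiv.Perm (ℕ → ℕ → ℝ))ᵐᵒᵖ :=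
  PresentedGroup.toGroup (f := fun s : Fin (n - 1) => MulOpposite.op (lkPerm ht s.1)) (by
    rintro r ⟨i, j, ⟨h, rfl⟩ | ⟨h, rfl⟩⟩
    · rw [map_mul, map_inv, mul_inv_eq_one]
      simp only [map_mul, FreeGroup.lift_apply_of, ← MulOpposite.op_mul]
      congr 1
      ext1 φ
      exact lkAct_comm t h φ
    · rw [map_mul, map_inv, mul_inv_eq_one]
      simp only [map_mul, FreeGroup.lift_apply_of, ← MulOpposite.op_mul, ← h]
      congr 1
      ext1 φ
      exact lkAct_braid t i.1 φ)

/-- The action of a positive word. -/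
noncomputable def lkWord (t : ℝ) (w : List (Fin (n - 1))) (φ : ℕ → ℕ → ℝ) : ℕ → ℕ → ℝ :=
  w.foldl (fun ψ s => lkAct t s.1 ψ) φ

lemma lkWord_append (t : ℝ) (u v : List (Fin (n - 1))) (φ : ℕ → ℕ → ℝ) :
    lkWord t (u ++ v) φ = lkWord t v (lkWord t u φ) := List.foldl_append

lemma lkRep_ofWord {t : ℝ} (ht : t ≠ 0) (w : List (Fin (n - 1))) (φ : ℕ → ℕ → ℝ) :
    (lkRep n ht (ofWord w)).unop φ = lkWord t w φ := by
  induction w generalizing φ with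
  | nil => simp [ofWord_nil, lkWord]
  | cons s w ih =>
    rw [ofWord_cons, map_mul, MulOpposite.unop_mul, Equiv.Perm.mul_apply, ih]
    have : (lkRep n ht (σ s)).unop φ = lkAct t s.1 φ := by
      rw [lkRep, σ, PresentedGroup.toGroup.of]
      rfl
    rw [this]
    rfl

/-- At `t = 0` the generators are no longer invertible, so there is no representation of the group.
Equality of positive words in the group still passes to the action at `t = 0` as a limit, because
the matrix entries are polynomials in `t`. -/
lemma continuous_lkWord (w : List (Fin (n - 1))) (Φ : ℝ → ℕ → ℕ → ℝ)
    (hΦ : ∀ i j, Continuous fun t => Φ t i j) (i j : ℕ) :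
    Continuous fun t => lkWord t w (Φ t) i j := by
  induction w generalizing Φ i j with
  | nil => exact hΦ i j
  | cons s w ih =>
    refine ih (fun t => lkAct t s.1 (Φ t)) (fun i j => ?_) i j
    unfold lkAct
    split_ifs <;> fun_prop

/-- The action of positive words at `t = 0` respects equality in the braid group. -/
lemma lkWord_zero_congr {u v : List (Fin (n - 1))} (h : ofWord u = ofWord v) (φ : ℕ → ℕ → ℝ) :
    lkWord 0 u φ = lkWord 0 v φ := by
  funext i j
  have h1 := continuous_lkWord u (fun _ => φ) (fun i j => continuous_const) i j
  have h2 := continuous_lkWord v (fun _ => φ) (fun i j => continuous_const) i j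
  have h3 : Set.EqOn (fun t => lkWord t u φ i j) (fun t => lkWord t v φ i j) {(0 : ℝ)}ᶜ := by
    intro t ht
    have ht : t ≠ 0 := ht
    simp only
    rw [← lkRep_ofWord ht, ← lkRep_ofWord ht, h]
  exact congrFun (Continuous.ext_on (dense_compl_singleton (0 : ℝ)) h1 h2 h3) 0

end Braid

/-! ### Uniqueness of left weighted products -/

namespace Braid

variable {n : ℕ}

lemma lkAct_zero_nonneg {φ : ℕ → ℕ → ℝ} (h : ∀ i j, 0 ≤ φ i j) (s i j : ℕ) :
    0 ≤ lkAct 0 s φ i j := by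
  have h1 := h i j
  have h2 := h (s + 1) j
  have h3 := h s j
  have h4 := h i s
  have h5 := h i (s + 1)
  unfold lkAct
  split_ifs <;> linarith

lemma lkWord_zero_nonneg (w : List (Fin (n - 1))) {φ : ℕ → ℕ → ℝ} (h : ∀ i j, 0 ≤ φ i j)
    (i j : ℕ) : 0 ≤ lkWord 0 w φ i j := by
  induction w generalizing φ with
  | nil => exact h i j
  | cons s w ih => exact ih (lkAct_zero_nonneg h s.1)

/-- A letter `s < n - 1` computes the value at a pair below `n` from values at pairs below `n`;
whatever the function does elsewhere has no influence. -/
lemma lkWord_zero_eq_zero (w : List (Fin (n - 1))) {φ : ℕ → ℕ → ℝ}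
    (h : ∀ i j, i < j → j < n → φ i j = 0) (i j : ℕ) (hij : i < j) (hj : j < n) :
    lkWord 0 w φ i j = 0 := by
  induction w generalizing φ with
  | nil => exact h i j hij hj
  | cons s w ih =>
    refine ih fun i j hij hj => ?_
    have hs := s.2
    change lkAct 0 s.1 φ i j = 0
    unfold lkAct
    split_ifs
    · omega
    · simp
    · rw [h (s.1 + 1) j (by omega) hj]
      simp
    · rw [h s.1 j (by omega) hj, h (s.1 + 1) j (by omega) hj]
      simp
    · rw [h i s.1 (by omega) (by omega), h i (s.1 + 1) (by omega) (by omega)]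
      simp
    · rw [h i s.1 (by omega) (by omega)]
      simp
    · rw [h i j hij hj]
      simp
    · exact h i j hij hj

/-- A reduced word of `f` sends the pair `(i, j)` to combinations of the pairs `(a, b)` which
satisfy this condition, with positive coefficients at `t = 0`. -/
def Spreads (f : Equiv.Perm (Fin n)) (i j a b : Fin n) : Prop :=
  f.symm a ≤ i ∧ j ≤ f.symm b ∧ f i ≤ a ∧ b ≤ f j

/-- At `t = 0` a letter moves the left point of a pair along its strand or over to a strand crossing
it from the left, it moves the right point along its strand or over to one crossing it from the
right, and it produces nothing at `(s, s + 1)`. Accordingly, `Spreads` says that `a` is the end of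
`i` or of a strand crossing `i` from the left, and symmetrically for `b` and `j`. -/
lemma IsReducedWord.lkWord_zero_support {w : List (Fin (n - 1))} {f : Equiv.Perm (Fin n)}
    (hw : IsReducedWord w f) {φ : ℕ → ℕ → ℝ} {a b : Fin n} (hab : a < b)
    (h : lkWord 0 w φ a.1 b.1 ≠ 0) :
    ∃ i j : Fin n, i < j ∧ φ i.1 j.1 ≠ 0 ∧ Spreads f i j a b := by
  induction hw generalizing a b with
  | nil => exact ⟨a, b, hab, h, le_rfl, le_rfl, le_rfl, le_rfl⟩
  | @snoc w f s hw hs ih =>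
    rw [lkWord_append] at h
    change lkAct 0 s.1 (lkWord 0 w φ) a.1 b.1 ≠ 0 at h
    have hL : ∀ i : Fin n, (f i).1 = s.1 ↔ i.1 = (f.symm (leftPos s)).1 := fun i => by
      rw [← Fin.ext_iff, Equiv.eq_symm_apply, Fin.ext_iff]; rfl
    have hR : ∀ i : Fin n, (f i).1 = s.1 + 1 ↔ i.1 = (f.symm (rightPos s)).1 := fun i => by
      rw [← Fin.ext_iff, Equiv.eq_symm_apply, Fin.ext_iff]; rfl
    -- The alternatives list the pairs `(a', b')` from which the last letter can produce a value at
    -- `(a, b)`.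
    have key : ∀ a' b' : Fin n, a' < b' → lkWord 0 w φ a'.1 b'.1 ≠ 0 →
        (a.1 = s.1 ∧ b.1 ≠ s.1 + 1 ∧ a'.1 = s.1 + 1 ∧ b' = b ∨
          a.1 = s.1 + 1 ∧ (a'.1 = s.1 ∨ a'.1 = s.1 + 1) ∧ b' = b ∨
          b.1 = s.1 ∧ (b'.1 = s.1 ∨ b'.1 = s.1 + 1) ∧ a' = a ∨
          b.1 = s.1 + 1 ∧ a.1 ≠ s.1 ∧ b'.1 = s.1 ∧ a' = a ∨
          (a.1 ≠ s.1 ∧ a.1 ≠ s.1 + 1 ∧ b.1 ≠ s.1 ∧ b.1 ≠ s.1 + 1 ∧ a' = a ∧ b' = b)) →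
        ∃ i j : Fin n, i < j ∧ φ i.1 j.1 ≠ 0 ∧ Spreads (swapEnds s f) i j a b := by
      intro a' b' hab' h' hc
      obtain ⟨i, j, hij, hφ, c1, c2, c3, c4⟩ := ih hab' h'
      refine ⟨i, j, hij, hφ, ?_⟩
      have eL : ∀ x : Fin n, x.1 = s.1 → x = leftPos s := fun x e => Fin.ext e
      have eR : ∀ x : Fin n, x.1 = s.1 + 1 → x = rightPos s := fun x e => Fin.ext e
      have sw : ∀ x : Fin n, x.1 ≠ s.1 → x.1 ≠ s.1 + 1 →
          Equiv.swap (leftPos s) (rightPos s) x = x := fun x h1 h2 =>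
        Equiv.swap_apply_of_ne_of_ne (fun e => h1 (by rw [e]; rfl)) (fun e => h2 (by rw [e]; rfl))
      have hLi := hL i
      have hRi := hR i
      have hLj := hL j
      have hRj := hR j
      simp only [Spreads, swapEnds_symm, swapEnds_apply, Fin.le_def, swap_val, Fin.lt_def]
        at c1 c2 c3 c4 hs hij hab hab' ⊢
      rcases hc with ⟨h1, h2, h3, rfl⟩ | ⟨h1, h3 | h3, rfl⟩ | ⟨h1, h3 | h3, rfl⟩ |
        ⟨h1, h2, h3, rfl⟩ | ⟨h1, h2, h3, h4, rfl, rfl⟩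
      · rw [eL _ h1, Equiv.swap_apply_left, sw b' (by omega) (by omega)]
        rw [eR _ h3] at c1
        simp only [leftPos]
        refine ⟨c1, c2, ?_, ?_⟩ <;> split_ifs <;> omega
      · rw [eR _ h1, Equiv.swap_apply_right, sw b' (by omega) (by omega)]
        rw [eL _ h3] at c1
        simp only [rightPos]
        refine ⟨c1, c2, ?_, ?_⟩ <;> split_ifs <;> omega
      · rw [eR _ h1, Equiv.swap_apply_right, sw b' (by omega) (by omega)]
        rw [eR _ h3] at c1
        simp only [rightPos]
        refine ⟨by omega, c2, ?_, ?_⟩ <;> split_ifs <;> omega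
      · rw [eL _ h1, Equiv.swap_apply_left, sw a' (by omega) (by omega)]
        rw [eL _ h3] at c2
        simp only [leftPos]
        refine ⟨c1, by omega, ?_, ?_⟩ <;> split_ifs <;> omega
      · rw [eL _ h1, Equiv.swap_apply_left, sw a' (by omega) (by omega)]
        rw [eR _ h3] at c2
        simp only [leftPos]
        refine ⟨c1, c2, ?_, ?_⟩ <;> split_ifs <;> omega
      · rw [eR _ h1, Equiv.swap_apply_right, sw a' (by omega) (by omega)]
        rw [eL _ h3] at c2
        simp only [rightPos]
        refine ⟨c1, c2, ?_, ?_⟩ <;> split_ifs <;> omega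
      · rw [sw a' h1 h2, sw b' h3 h4]
        refine ⟨c1, c2, ?_, ?_⟩ <;> split_ifs <;> omega
    have hsn := s.2
    rw [Fin.lt_def] at hab
    rw [lkAct] at h
    simp only [zero_div, zero_mul, sub_zero, add_zero] at h
    split_ifs at h with h1 h2 h3 h4 h5 h6 h7
    · omega
    · exact absurd rfl h
    · exact key (rightPos s) b (Fin.lt_def.2 (by simp only [rightPos]; omega)) h
        (Or.inl ⟨h2, h3, rfl, rfl⟩)
    · rcases ne_or_eq (lkWord 0 w φ s.1 b.1) 0 with h' | h'
      · exact key (leftPos s) b (Fin.lt_def.2 (by simp only [leftPos]; omega)) h'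
          (Or.inr (Or.inl ⟨h4, Or.inl rfl, rfl⟩))
      · refine key (rightPos s) b (Fin.lt_def.2 (by simp only [rightPos]; omega)) ?_
          (Or.inr (Or.inl ⟨h4, Or.inr rfl, rfl⟩))
        intro h''
        simp only [rightPos] at h''
        exact h (by rw [h', h'']; simp)
    · rcases ne_or_eq (lkWord 0 w φ a.1 s.1) 0 with h' | h'
      · exact key a (leftPos s) (Fin.lt_def.2 (by simp only [leftPos]; omega)) h'
          (Or.inr (Or.inr (Or.inl ⟨h5, Or.inl rfl, rfl⟩)))
      · refine key a (rightPos s) (Fin.lt_def.2 (by simp only [rightPos]; omega)) ?_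
          (Or.inr (Or.inr (Or.inl ⟨h5, Or.inr rfl, rfl⟩)))
        intro h''
        simp only [rightPos] at h''
        exact h (by rw [h', h'']; simp)
    · exact key a (leftPos s) (Fin.lt_def.2 (by simp only [leftPos]; omega)) h
        (Or.inr (Or.inr (Or.inr (Or.inl ⟨h6, h2, rfl, rfl⟩))))
    · exact key a b hab h (Or.inr (Or.inr (Or.inr (Or.inr ⟨h2, h4, h5, h6, rfl, rfl⟩))))
    · exact key a b hab h (Or.inr (Or.inr (Or.inr (Or.inr ⟨h2, h4, h5, h6, rfl, rfl⟩))))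

/-- The converse of `IsReducedWord.lkWord_zero_support` for nonnegative functions: every pair
allowed by `Spreads` is reached, and no contributions cancel. -/
lemma IsReducedWord.lkWord_zero_pos {w : List (Fin (n - 1))} {f : Equiv.Perm (Fin n)}
    (hw : IsReducedWord w f) {φ : ℕ → ℕ → ℝ} (hφ : ∀ i j, 0 ≤ φ i j) {i j a b : Fin n}
    (hij : 0 < φ i.1 j.1) (hlt : i < j) (hab : a < b) (h : Spreads f i j a b) :
    0 < lkWord 0 w φ a.1 b.1 := by
  induction hw generalizing a b with
  | nil =>
    obtain ⟨h1, h2, h3, h4⟩ := h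
    have e1 : i = a := le_antisymm h3 h1
    have e2 : j = b := le_antisymm h2 h4
    subst e1 e2
    exact hij
  | @snoc w f s hw hs ih =>
    have hL : ∀ i : Fin n, (f i).1 = s.1 ↔ i.1 = (f.symm (leftPos s)).1 := fun i => by
      rw [← Fin.ext_iff, Equiv.eq_symm_apply, Fin.ext_iff]; rfl
    have hR : ∀ i : Fin n, (f i).1 = s.1 + 1 ↔ i.1 = (f.symm (rightPos s)).1 := fun i => by
      rw [← Fin.ext_iff, Equiv.eq_symm_apply, Fin.ext_iff]; rfl
    have eL : ∀ x : Fin n, x.1 = s.1 → x = leftPos s := fun x e => Fin.ext e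
    have eR : ∀ x : Fin n, x.1 = s.1 + 1 → x = rightPos s := fun x e => Fin.ext e
    have sw : ∀ x : Fin n, x.1 ≠ s.1 → x.1 ≠ s.1 + 1 →
        Equiv.swap (leftPos s) (rightPos s) x = x := fun x h1 h2 =>
      Equiv.swap_apply_of_ne_of_ne (fun e => h1 (by rw [e]; rfl)) (fun e => h2 (by rw [e]; rfl))
    have hLi := hL i
    have hRi := hR i
    have hLj := hL j
    have hRj := hR j
    have hsn := s.2
    have nn := lkWord_zero_nonneg w hφ
    rw [lkWord_append]
    change 0 < lkAct 0 s.1 (lkWord 0 w φ) a.1 b.1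
    obtain ⟨c1, c2, c3, c4⟩ := h
    simp only [Spreads, swapEnds_symm, swapEnds_apply, Fin.le_def, swap_val, Fin.lt_def]
      at c1 c2 c3 c4 hs hab hlt ih
    rw [lkAct]
    simp only [zero_div, zero_mul, sub_zero, add_zero]
    split_ifs with h1 h2 h3 h4 h5 h6 h7
    · omega
    · rw [eL _ h2, Equiv.swap_apply_left] at c1
      rw [eR _ h3, Equiv.swap_apply_right] at c2
      omega
    · rw [eL _ h2, Equiv.swap_apply_left] at c1
      rw [sw b (by omega) (by omega)] at c2
      exact ih (a := rightPos s) (b := b) (by simp only [rightPos]; omega)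
        ⟨c1, c2, by simp only [rightPos]; split_ifs at c3 <;> omega, by split_ifs at c4 <;> omega⟩
    · rw [eR _ h4, Equiv.swap_apply_right] at c1
      rw [sw b (by omega) (by omega)] at c2
      -- The value is a mean of two nonnegative ones. Which of them is known to be positive depends
      -- on whether the strand `i` itself is at `s + 1` before the last letter.
      by_cases hi : (f i).1 = s.1 + 1
      · have := ih (a := rightPos s) (b := b) (by simp only [rightPos]; omega)
          ⟨by omega, c2, by simp only [rightPos]; omega, by split_ifs at c4 <;> omega⟩
        simp only [rightPos] at this
        linarith [nn s.1 b.1]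
      · have := ih (a := leftPos s) (b := b) (by simp only [leftPos]; omega)
          ⟨c1, c2, by simp only [leftPos]; split_ifs at c3 <;> omega,
            by split_ifs at c4 <;> omega⟩
        simp only [leftPos] at this
        linarith [nn (s.1 + 1) b.1]
    · rw [eL _ h5, Equiv.swap_apply_left] at c2
      rw [sw a (by omega) (by omega)] at c1
      by_cases hj : (f j).1 = s.1
      · have := ih (a := a) (b := leftPos s) (by simp only [leftPos]; omega)
          ⟨c1, by omega, by split_ifs at c3 <;> omega, by simp only [leftPos]; omega⟩
        simp only [leftPos] at this
        linarith [nn a.1 (s.1 + 1)]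
      · have := ih (a := a) (b := rightPos s) (by simp only [rightPos]; omega)
          ⟨c1, c2, by split_ifs at c3 <;> omega,
            by simp only [rightPos]; split_ifs at c4 <;> omega⟩
        simp only [rightPos] at this
        linarith [nn a.1 s.1]
    · rw [eR _ h6, Equiv.swap_apply_right] at c2
      rw [sw a (by omega) (by omega)] at c1
      exact ih (a := a) (b := leftPos s) (by simp only [leftPos]; omega)
        ⟨c1, c2, by split_ifs at c3 <;> omega, by simp only [leftPos]; split_ifs at c4 <;> omega⟩
    · rw [sw a (by omega) (by omega)] at c1
      rw [sw b (by omega) (by omega)] at c2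
      exact ih hab ⟨c1, c2, by split_ifs at c3 <;> omega, by split_ifs at c4 <;> omega⟩
    · rw [sw a (by omega) (by omega)] at c1
      rw [sw b (by omega) (by omega)] at c2
      exact ih hab ⟨c1, c2, by split_ifs at c3 <;> omega, by split_ifs at c4 <;> omega⟩

/-- Take the first end to the right of `f i` whose strand starts at `j` or further right. The strand
ending just before it cannot start at `j` or further right by this choice, nor strictly between `i`
and `j` by `hmin`. So it starts at `i` or further left. -/
lemma exists_spreads (f : Equiv.Perm (Fin n)) {i j : Fin n} (hf : f i < f j)
    (hmin : ∀ l, i < l → l < j → f l < f i ∨ f j < f l) :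
    ∃ m : Fin (n - 1), Spreads f i j (leftPos m) (rightPos m) := by
  have hex : ∃ v : ℕ, (f i).1 < v ∧ ∃ hv : v < n, j ≤ f.symm ⟨v, hv⟩ :=
    ⟨(f j).1, hf, (f j).2, by simp⟩
  obtain ⟨v, ⟨h1, hv, h2⟩, hle, hm⟩ : ∃ v : ℕ, ((f i).1 < v ∧ ∃ hv : v < n, j ≤ f.symm ⟨v, hv⟩) ∧
      v ≤ (f j).1 ∧ ∀ u < v, ¬ ((f i).1 < u ∧ ∃ hu : u < n, j ≤ f.symm ⟨u, hu⟩) := by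
    classical
    exact ⟨Nat.find hex, Nat.find_spec hex, Nat.find_min' hex ⟨hf, (f j).2, by simp⟩,
      fun u => Nat.find_min hex⟩
  obtain ⟨u, hu⟩ : ∃ u, v = u + 1 := ⟨v - 1, by omega⟩
  subst hu
  have hu : u < n - 1 := by omega
  refine ⟨⟨u, hu⟩, ?_, h2, Fin.le_def.2 (by simp only [leftPos]; omega), hle⟩
  have hl : (f (f.symm (leftPos (⟨u, hu⟩ : Fin (n - 1))))).1 = u := by simp [leftPos]
  set l := f.symm (leftPos (⟨u, hu⟩ : Fin (n - 1))) with hl'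
  by_contra hli
  push Not at hli
  have hlj : l < j := by
    by_contra hlj
    push Not at hlj
    refine hm u (by omega) ⟨?_, by omega, hlj⟩
    have : (f i).1 ≠ u := fun e => hli.ne (f.injective (Fin.ext (by rw [e, hl])))
    omega
  have := hmin l hli hlj
  simp only [Fin.lt_def] at this hli
  omega

/-- The left weightedness of two permutation braids, in terms of their permutations. -/
def LeftWeighted (f g : Equiv.Perm (Fin n)) : Prop :=
  ∀ s : Fin (n - 1), g (rightPos s) < g (leftPos s) → f.symm (rightPos s) < f.symm (leftPos s)

lemma leftPos_lt_rightPos (s : Fin (n - 1)) : leftPos s < rightPos s :=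
  Fin.lt_def.2 (by simp only [leftPos, rightPos]; omega)

/-- Mass at neighbours `s`, `s + 1` not crossed by the first factor reaches some neighbours `m`, `m
+ 1`. By `Spreads` the strands ending there start in increasing order, so they have not crossed, and
left weightedness shows that the next factor does not cross them either. -/
lemma exists_word_lkWord_pos (F : List (Equiv.Perm (Fin n))) (hF : F.IsChain LeftWeighted) :
    ∃ w : List (Fin (n - 1)), ofWord w = (F.map permBraid).prod ∧
      ∀ (φ : ℕ → ℕ → ℝ) (s : Fin (n - 1)), (∀ i j, 0 ≤ φ i j) →
        0 < φ (leftPos s).1 (rightPos s).1 → (∀ f ∈ F.head?, f (leftPos s) < f (rightPos s)) →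
        ∃ a b : Fin n, a < b ∧ 0 < lkWord 0 w φ a.1 b.1 := by
  induction F with
  | nil => exact ⟨[], rfl, fun φ s _ h _ => ⟨leftPos s, rightPos s, leftPos_lt_rightPos s, h⟩⟩
  | cons f F ih =>
    obtain ⟨w, hw, ihw⟩ := ih hF.tail
    obtain ⟨u, hu, hu'⟩ := exists_isReducedWord f
    refine ⟨u ++ w, by rw [ofWord_append, hw, hu', List.map_cons, List.prod_cons], ?_⟩
    intro φ s hφ hs hf
    have hf := hf f rfl
    obtain ⟨m, hm⟩ := exists_spreads f hf (fun l h1 h2 => by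
      simp only [Fin.lt_def, leftPos, rightPos] at h1 h2
      omega)
    have hpos := hu.lkWord_zero_pos hφ hs (leftPos_lt_rightPos s) (leftPos_lt_rightPos m) hm
    rw [lkWord_append]
    refine ihw _ m (lkWord_zero_nonneg u hφ) hpos fun g hg => ?_
    by_contra hlt
    have hlt : g (rightPos m) < g (leftPos m) := lt_of_le_of_ne (not_lt.1 hlt) fun e =>
      leftPos_ne_rightPos m (g.injective e).symm
    have := (List.isChain_cons.1 hF).1 g hg m hlt
    have h1 := hm.1
    have h2 := hm.2.1
    simp only [Fin.lt_def, Fin.le_def, leftPos, rightPos] at *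
    omega

/-- A unit mass at `(i, j)` is killed by `f'`, hence by the right-hand side. If `f` did not cross
`i` and `j`, it would survive on the left-hand side by `exists_word_lkWord_pos`. Induction on `j -
i` supplies the hypothesis of `exists_spreads`: for `l` between `i` and `j`, the inversion of `f'`
forces one at `(i, l)` or at `(l, j)`. -/
lemma inversion_of_mul_eq {f f' : Equiv.Perm (Fin n)} {F : List (Equiv.Perm (Fin n))}
    (hF : (f :: F).IsChain LeftWeighted) {w : List (Fin (n - 1))}
    (h : ((f :: F).map permBraid).prod = permBraid f' * ofWord w) {i j : Fin n} (hij : i < j)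
    (hinv : f' j < f' i) : f j < f i := by
  induction hd : j.1 - i.1 using Nat.strong_induction_on generalizing i j with
  | _ d ih =>
  by_contra hlt
  have hlt : f i < f j := lt_of_le_of_ne (not_lt.1 hlt) fun e => hij.ne (f.injective e)
  obtain ⟨m, hm⟩ := exists_spreads f hlt (fun l h1 h2 => by
    rcases lt_or_ge (f' l) (f' i) with h3 | h3
    · exact Or.inl (ih (l.1 - i.1) (by rw [Fin.lt_def] at *; omega) h1 h3 rfl)
    · exact Or.inr (ih (j.1 - l.1) (by rw [Fin.lt_def] at *; omega) h2
        (lt_of_lt_of_le hinv h3) rfl))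
  obtain ⟨v, hv, hpos⟩ := exists_word_lkWord_pos F hF.tail
  obtain ⟨u, hu, hu'⟩ := exists_isReducedWord f
  obtain ⟨u', hw, hw'⟩ := exists_isReducedWord f'
  set φ : ℕ → ℕ → ℝ := fun a b => if a = i.1 ∧ b = j.1 then 1 else 0 with hφ
  have hφ0 : ∀ a b, 0 ≤ φ a b := fun a b => by
    simp only [hφ]
    split_ifs <;> norm_num
  have hp := hu.lkWord_zero_pos hφ0 (i := i) (j := j) (by simp [hφ]) hij (leftPos_lt_rightPos m) hm
  obtain ⟨a, b, hab, hab'⟩ := hpos _ m (lkWord_zero_nonneg u hφ0) hp fun g hg => by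
    by_contra hlt
    have hlt : g (rightPos m) < g (leftPos m) := lt_of_le_of_ne (not_lt.1 hlt) fun e =>
      leftPos_ne_rightPos m (g.injective e).symm
    have := (List.isChain_cons.1 hF).1 g hg m hlt
    have h1 := hm.1
    have h2 := hm.2.1
    simp only [Fin.lt_def, Fin.le_def, leftPos, rightPos] at *
    omega
  have e : ofWord (u ++ v) = ofWord (u' ++ w) := by
    rw [ofWord_append, ofWord_append, hu', hv, hw', ← h, List.map_cons, List.prod_cons]
  rw [← lkWord_append, lkWord_zero_congr e, lkWord_append] at hab'
  refine hab'.ne' (lkWord_zero_eq_zero w ?_ a.1 b.1 hab b.2)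
  intro x y hxy hy
  by_contra hne
  obtain ⟨i', j', -, h1, -, -, h2, h3⟩ := hw.lkWord_zero_support
    (a := ⟨x, by omega⟩) (b := ⟨y, hy⟩) hxy hne
  simp only [hφ, ne_eq, ite_eq_right_iff, one_ne_zero, imp_false, not_not, Fin.val_inj] at h1
  obtain ⟨rfl, rfl⟩ := h1
  simp only [Fin.le_def, Fin.lt_def] at *
  omega

lemma perm_ext_of_inversions {f g : Equiv.Perm (Fin n)}
    (h : ∀ i j, i < j → (f j < f i ↔ g j < g i)) : f = g := by
  have : g * f⁻¹ = 1 := eq_one_of_no_descent _ fun s => by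
    have h1 := leftPos_lt_rightPos s
    have e1 : f (f.symm (leftPos s)) = leftPos s := by simp
    have e2 : f (f.symm (rightPos s)) = rightPos s := by simp
    change g (f.symm (leftPos s)) < g (f.symm (rightPos s))
    set x := f.symm (leftPos s)
    set y := f.symm (rightPos s)
    rw [← e1, ← e2] at h1
    rcases lt_trichotomy x y with hxy | hxy | hxy
    · have := (not_congr (h x y hxy)).1 h1.not_gt
      exact lt_of_le_of_ne (not_lt.1 this) fun e => hxy.ne (g.injective e)
    · rw [hxy] at h1
      exact absurd h1 (lt_irrefl _)
    · exact (h y x hxy).1 h1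
  exact (mul_inv_eq_one.1 this).symm

lemma exists_word_prod (F : List (Equiv.Perm (Fin n))) :
    ∃ w : List (Fin (n - 1)), ofWord w = (F.map permBraid).prod := by
  induction F with
  | nil => exact ⟨[], rfl⟩
  | cons f F ih =>
    obtain ⟨w, hw⟩ := ih
    exact ⟨permWord f ++ w, by rw [ofWord_append, hw, List.map_cons, List.prod_cons]; rfl⟩

/-- A left weighted product of permutation braids determines its factors. -/
theorem leftWeighted_unique {F G : List (Equiv.Perm (Fin n))} (hF : F.IsChain LeftWeighted)
    (hG : G.IsChain LeftWeighted) (hlen : F.length = G.length)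
    (h : (F.map permBraid).prod = (G.map permBraid).prod) : F = G := by
  induction F generalizing G with
  | nil => exact (List.length_eq_zero_iff.1 hlen.symm).symm
  | cons f F ih =>
    obtain _ | ⟨g, G⟩ := G
    · simp at hlen
    obtain ⟨u, hu⟩ := exists_word_prod F
    obtain ⟨v, hv⟩ := exists_word_prod G
    -- Each side is its own first factor times a positive word, so each first factor inverts all
    -- pairs that the other one inverts.
    have hfg : f = g := perm_ext_of_inversions fun i j hij =>
      ⟨fun hi => inversion_of_mul_eq hG (f' := f) (w := u) (by
          rw [← h, hu, List.map_cons, List.prod_cons]) hij hi,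
        fun hi => inversion_of_mul_eq hF (f' := g) (w := v) (by
          rw [h, hv, List.map_cons, List.prod_cons]) hij hi⟩
    subst hfg
    rw [List.map_cons, List.map_cons, List.prod_cons, List.prod_cons] at h
    rw [ih (G := G) hF.tail hG.tail (by simpa using hlen) (mul_left_cancel h)]

lemma permBraid_injective : Function.Injective (permBraid : Equiv.Perm (Fin n) → Braid n) := by
  intro f g h
  have := leftWeighted_unique (F := [f]) (G := [g]) (List.isChain_singleton _)
    (List.isChain_singleton _) rfl (by simpa using h)
  simpa using this

/-- The generator `σ s` is the permutation braid of a transposition and the rest is a positive word,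
so `inversion_of_mul_eq` applies to the one-factor product. -/
lemma descent_of_mem_startingSet {f : Equiv.Perm (Fin n)} {s : Fin (n - 1)}
    (h : s ∈ startingSet (permBraid f)) : f (rightPos s) < f (leftPos s) := by
  obtain ⟨β, ⟨w, rfl, -⟩, h⟩ := h
  have hσ : permBraid (swapEnds s 1) = σ s := by
    rw [permBraid_swapEnds s 1 (leftPos_lt_rightPos s), permBraid_one, one_mul]
  refine inversion_of_mul_eq (F := []) (f' := swapEnds s 1) (w := w) (List.isChain_singleton _)
    (by simpa [hσ] using h) (leftPos_lt_rightPos s) ?_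
  simpa [swapEnds] using leftPos_lt_rightPos s

end Braid

/-! ### Tight words

A path in the punctured plane that crosses the axis of the punctures is recorded by the word of
its crossings: the letter `(y, true)` is a crossing of the `y`-th gap downwards, `(y, false)` is a
crossing upwards. The path that runs from the upper to the lower half plane and separates the
punctures into two classes, given by `c : ℤ → Bool` (`false` for those on its left), and which
crosses the axis monotonically from the left to the right, crosses the gap `y` between `y` and
`y + 1` if `c y ≠ c (y + 1)`. Rotating the plane by `π` exchanges the two directions. -/

namespace GapWord

/-- Rotation of a letter by `π`. -/
def flip (a : ℤ × Bool) : ℤ × Bool := (-1 - a.1, !a.2)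

/-- Rotation of a colouring by `π`. -/
def flipColor (c : ℤ → Bool) (k : ℤ) : Bool := !c (-k)

lemma flip_flip (a : ℤ × Bool) : flip (flip a) = a := by
  ext <;> simp [flip]

/-- At the middle letter, the winding number of the path has a local minimum. -/
def IsMin (z y w : ℤ × Bool) : Prop :=
  (y.2 = true ∧ z.1 < y.1 ∧ y.1 < w.1) ∨ (y.2 = false ∧ y.1 < z.1 ∧ w.1 < y.1)

instance (z y w : ℤ × Bool) : Decidable (IsMin z y w) := by
  unfold IsMin
  infer_instance

/-- The number of triples of consecutive letters satisfying `R`. -/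
def countTriples (R : ℤ × Bool → ℤ × Bool → ℤ × Bool → Prop) [∀ z y w, Decidable (R z y w)] :
    List (ℤ × Bool) → ℕ
  | z :: y :: w :: l => (if R z y w then 1 else 0) + countTriples R (y :: w :: l)
  | _ => 0

/-- The number of local minima of the winding number. -/
abbrev numMin : List (ℤ × Bool) → ℕ := countTriples IsMin

/-- All local minima of the winding number lie in `A`. -/
def MinIn (A : Set ℤ) : List (ℤ × Bool) → Prop
  | z :: y :: w :: l => (IsMin z y w → y.1 ∈ A) ∧ MinIn A (y :: w :: l)
  | _ => True

/-- Consecutive letters have opposite directions and lie in different gaps. -/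
def Alternating (l : List (ℤ × Bool)) : Prop := l.IsChain fun a b => a.1 ≠ b.1 ∧ a.2 ≠ b.2

lemma isMin_flip (z y w : ℤ × Bool) : IsMin (flip z) (flip y) (flip w) ↔ IsMin z y w := by
  unfold IsMin flip
  rcases y with ⟨y, _ | _⟩ <;> simp

lemma numMin_map_flip (l : List (ℤ × Bool)) : numMin (l.map flip) = numMin l := by
  induction l with
  | nil => rfl
  | cons z l ih =>
    rcases l with _ | ⟨y, _ | ⟨w, l⟩⟩
    · rfl
    · rfl
    · simp only [List.map_cons, numMin, countTriples, isMin_flip] at ih ⊢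
      rw [ih]

lemma minIn_map_flip (A : Set ℤ) (l : List (ℤ × Bool)) :
    MinIn A (l.map flip) ↔ MinIn {y | -1 - y ∈ A} l := by
  induction l with
  | nil => rfl
  | cons z l ih =>
    rcases l with _ | ⟨y, _ | ⟨w, l⟩⟩
    · rfl
    · rfl
    · simp only [List.map_cons, MinIn, isMin_flip] at ih ⊢
      rw [ih]
      rfl

lemma alternating_map_flip (l : List (ℤ × Bool)) : Alternating (l.map flip) ↔ Alternating l := by
  unfold Alternating
  rw [List.isChain_map]
  simp [flip]

lemma countTriples_cons_ge (R : ℤ × Bool → ℤ × Bool → ℤ × Bool → Prop)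
    [∀ z y w, Decidable (R z y w)] (z : ℤ × Bool) (l : List (ℤ × Bool)) :
    countTriples R l ≤ countTriples R (z :: l) := by
  rcases l with _ | ⟨y, _ | ⟨w, l⟩⟩
  · exact le_rfl
  · exact le_rfl
  · exact Nat.le_add_left _ _

lemma countTriples_cons_le (R : ℤ × Bool → ℤ × Bool → ℤ × Bool → Prop)
    [∀ z y w, Decidable (R z y w)] (z : ℤ × Bool) (l : List (ℤ × Bool)) :
    countTriples R (z :: l) ≤ countTriples R l + 1 := by
  rcases l with _ | ⟨y, _ | ⟨w, l⟩⟩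
  · exact Nat.le_add_left _ _
  · exact Nat.le_add_left _ _
  · rw [countTriples]
    split_ifs <;> omega

/-- The rotation by `π` on words up to free reduction. -/
def flipHom : FreeGroup ℤ →* FreeGroup ℤ := FreeGroup.lift fun y => (FreeGroup.of (-1 - y))⁻¹

lemma mk_cons (a : ℤ × Bool) (l : List (ℤ × Bool)) :
    FreeGroup.mk (a :: l) = FreeGroup.mk [a] * FreeGroup.mk l := by
  rw [FreeGroup.mul_mk]; rfl

lemma flipHom_mk (l : List (ℤ × Bool)) :
    flipHom (FreeGroup.mk l) = FreeGroup.mk (l.map flip) := by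
  induction l with
  | nil => exact map_one flipHom
  | cons a l ih =>
    rw [mk_cons, map_mul, ih, List.map_cons, mk_cons (flip a)]
    congr 1
    rcases a with ⟨y, _ | _⟩ <;> simp [flipHom, flip, FreeGroup.of, FreeGroup.inv_mk,
      FreeGroup.invRev]

lemma flipHom_flipHom (x : FreeGroup ℤ) : flipHom (flipHom x) = x := by
  obtain ⟨l, rfl⟩ := Quot.exists_rep x
  change flipHom (flipHom (FreeGroup.mk l)) = FreeGroup.mk l
  rw [flipHom_mk, flipHom_mk, List.map_map]
  congr 1
  rw [show flip ∘ flip = id from funext flip_flip, List.map_id]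

/-- The crossings of `m` consecutive gaps, beginning with `y`. -/
def run (c : ℤ → Bool) (y : ℤ) : ℕ → List (ℤ × Bool)
  | 0 => []
  | m + 1 => (if c y = c (y + 1) then [] else [(y, c (y + 1))]) ++ run c (y + 1) m

/-- The crossings of the gaps `y, …, e - 1`. -/
def runTo (c : ℤ → Bool) (y e : ℤ) : List (ℤ × Bool) := run c y (e - y).toNat

lemma runTo_self (c : ℤ → Bool) (y : ℤ) : runTo c y y = [] := by simp [runTo, run]

lemma runTo_succ (c : ℤ → Bool) {y e : ℤ} (h : y < e) : runTo c y e =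
    (if c y = c (y + 1) then [] else [(y, c (y + 1))]) ++ runTo c (y + 1) e := by
  have h1 : (e - y).toNat = (e - (y + 1)).toNat + 1 := by omega
  rw [runTo, h1, run, runTo]

lemma runTo_append (c : ℤ → Bool) {y x e : ℤ} (h1 : y ≤ x) (h2 : x ≤ e) :
    runTo c y e = runTo c y x ++ runTo c x e := by
  obtain ⟨m, rfl⟩ := Int.le.dest h1
  clear h1
  induction m generalizing y with
  | zero => simp [runTo_self]
  | succ m ih =>
    have e1 : y + ((m + 1 : ℕ) : ℤ) = y + 1 + (m : ℤ) := by push_cast; ring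
    rw [e1] at h2 ⊢
    rw [runTo_succ c (show y < e by omega), runTo_succ c (show y < y + 1 + (m : ℤ) by omega), ih h2,
      List.append_assoc]

lemma runTo_congr {c d : ℤ → Bool} {y e : ℤ} (h : ∀ k, y ≤ k → k ≤ e → c k = d k) :
    runTo c y e = runTo d y e := by
  rcases lt_or_ge e y with hy | hy
  · have : (e - y).toNat = 0 := by omega
    simp [runTo, this, run]
  obtain ⟨m, rfl⟩ := Int.le.dest hy
  clear hy
  induction m generalizing y with
  | zero => simp [runTo_self]
  | succ m ih =>
    have e1 : y + ((m + 1 : ℕ) : ℤ) = y + 1 + (m : ℤ) := by push_cast; ring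
    rw [e1] at h ⊢
    rw [runTo_succ c (by omega), runTo_succ d (by omega), h y (by omega) (by omega),
      h (y + 1) (by omega) (by omega), ih fun k hk hk' => h k (by omega) hk']

lemma mk_append (u v : List (ℤ × Bool)) :
    FreeGroup.mk (u ++ v) = FreeGroup.mk u * FreeGroup.mk v := FreeGroup.mul_mk.symm

/-- The same stretch of path seen after rotation is traversed backwards, so the second factor is the
inverse of the first. All cancellations between neighbouring paths come from this. -/
lemma mk_runTo_mul_flip (c : ℤ → Bool) {y e : ℤ} (h : y ≤ e) :
    FreeGroup.mk (runTo c y e) *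
      FreeGroup.mk ((runTo (flipColor c) (-e) (-y)).map flip) = 1 := by
  obtain ⟨m, rfl⟩ := Int.le.dest h
  clear h
  induction m generalizing y with
  | zero => simp [runTo_self, FreeGroup.one_eq_mk]
  | succ m ih =>
    have e1 : y + ((m + 1 : ℕ) : ℤ) = y + 1 + (m : ℤ) := by push_cast; ring
    rw [e1, runTo_succ c (by omega), runTo_append (flipColor c) (x := -(y + 1)) (by omega)
      (by omega), List.map_append, mk_append, mk_append]
    have e2 : runTo (flipColor c) (-(y + 1)) (-y) =
        if c y = c (y + 1) then [] else [(-(y + 1), !c y)] := by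
      have e3 : -(y + 1) + 1 = -y := by ring
      rw [runTo_succ _ (by omega), e3, runTo_self, List.append_nil]
      simp only [flipColor, neg_neg]
      rcases c y <;> rcases c (y + 1) <;> simp
    have e4 := ih (y := y + 1)
    rw [mul_assoc, ← mul_assoc (FreeGroup.mk (runTo c (y + 1) _)), e4, one_mul, e2]
    rcases hy : c y <;> rcases hy' : c (y + 1) <;>
      simp only [flip, FreeGroup.one_eq_mk, if_true, if_false, List.map_nil, List.map_cons,
        FreeGroup.mul_mk, List.append_nil, List.cons_append, List.nil_append, Bool.not_true,
        Bool.not_false, neg_add_rev, Bool.false_eq_true, Bool.true_eq_false]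
    · rw [← FreeGroup.one_eq_mk]
      have : (FreeGroup.of y) * (FreeGroup.of y)⁻¹ = (1 : FreeGroup ℤ) := mul_inv_cancel _
      simpa [FreeGroup.of, FreeGroup.inv_mk, FreeGroup.invRev, FreeGroup.mul_mk] using this
    · rw [← FreeGroup.one_eq_mk]
      have : (FreeGroup.of y)⁻¹ * (FreeGroup.of y) = (1 : FreeGroup ℤ) := inv_mul_cancel _
      simpa [FreeGroup.of, FreeGroup.inv_mk, FreeGroup.invRev, FreeGroup.mul_mk] using this

/-- The words with all local minima in `A` and at least `k` of them. -/
structure Tight (A : Set ℤ) (k : ℕ) (l : List (ℤ × Bool)) : Prop where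
  alternating : Alternating l
  minIn : MinIn A l
  le_numMin : k ≤ numMin l

lemma tight_map_flip (A : Set ℤ) (k : ℕ) (l : List (ℤ × Bool)) :
    Tight A k (l.map flip) ↔ Tight {y | -1 - y ∈ A} k l := by
  constructor
  · rintro ⟨h1, h2, h3⟩
    exact ⟨(alternating_map_flip l).1 h1, (minIn_map_flip A l).1 h2, numMin_map_flip l ▸ h3⟩
  · rintro ⟨h1, h2, h3⟩
    exact ⟨(alternating_map_flip l).2 h1, (minIn_map_flip A l).2 h2, (numMin_map_flip l).symm ▸ h3⟩

lemma Tight.tail {A : Set ℤ} {k : ℕ} {a : ℤ × Bool} {l : List (ℤ × Bool)} (h : Tight A k (a :: l)) :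
    ∃ k', Tight A k' l ∧ k ≤ k' + 1 := by
  refine ⟨numMin l, ⟨h.alternating.tail, ?_, le_rfl⟩, h.le_numMin.trans (countTriples_cons_le _ _ _)⟩
  have := h.minIn
  rcases l with _ | ⟨y, _ | ⟨w, l⟩⟩
  · trivial
  · trivial
  · exact this.2

lemma Tight.cons {A : Set ℤ} {k : ℕ} {z y : ℤ × Bool} {l : List (ℤ × Bool)}
    (h : Tight A k (y :: l)) (hzy : z.1 ≠ y.1 ∧ z.2 ≠ y.2)
    (hm : ∀ w ∈ l.head?, IsMin z y w → y.1 ∈ A) : Tight A k (z :: y :: l) := by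
  refine ⟨List.IsChain.cons_cons hzy h.alternating, ?_,
    h.le_numMin.trans (countTriples_cons_ge _ _ _)⟩
  rcases l with _ | ⟨w, l⟩
  · trivial
  · exact ⟨hm w rfl, h.minIn⟩

section Run

variable {A : Set ℤ} {c : ℤ → Bool} {e : ℤ} {O : List (ℤ × Bool)} {k : ℕ}

lemma head_run (hO : c (e - 1) = c e → ∀ h ∈ O.head?, e - 1 ≤ h.1) (m : ℕ) :
    ∀ h ∈ (run c (e - 1 - m) (m + 1) ++ O).head?, e - 1 - m ≤ h.1 := by
  induction m with
  | zero =>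
    intro h hh
    simp only [run, Nat.cast_zero, sub_zero, sub_add_cancel, List.append_nil] at hh ⊢
    split_ifs at hh with hc
    · exact hO hc h hh
    · simp only [List.cons_append, List.head?_cons, Option.mem_def, Option.some.injEq] at hh
      rw [← hh]
  | succ m ih =>
    have e1 : e - 1 - ((m + 1 : ℕ) : ℤ) + 1 = e - 1 - m := by push_cast; ring
    intro h hh
    rw [run, e1] at hh
    split_ifs at hh with hc
    · have := ih h hh
      push_cast
      omega
    · simp only [List.cons_append, List.head?_cons, Option.mem_def, Option.some.injEq] at hh
      rw [← hh]

lemma run_ne_nil (hO : c (e - 1) = c e → c e = true → O ≠ []) (m : ℕ)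
    (hc : c (e - 1 - m) = true) : run c (e - 1 - m) (m + 1) ++ O ≠ [] := by
  induction m with
  | zero =>
    simp only [run, Nat.cast_zero, sub_zero, sub_add_cancel, List.append_nil] at hc ⊢
    split_ifs with h
    · exact hO h (h ▸ hc)
    · simp
  | succ m ih =>
    have e1 : e - 1 - ((m + 1 : ℕ) : ℤ) + 1 = e - 1 - m := by push_cast; ring
    rw [run, e1]
    split_ifs with h
    · exact ih (h ▸ hc)
    · simp

/-- A monotone path runs from left to right, so only its downward crossings can be minima, and by
`hA` these lie in `A`. The letter `z` in `hE` stands for the last crossing before `O`: it is the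
crossing of the gap `e - 1` if there is one, and lies further left otherwise. -/
lemma tight_run (hA : ∀ y, c y = false → c (y + 1) = true → y ∈ A)
    (hE : ∀ z : ℤ × Bool, z.2 = c e → z.1 < e → (c (e - 1) ≠ c e → z.1 = e - 1) →
      (c (e - 1) = c e → z.1 < e - 1) → Tight A k (z :: O)) (m : ℕ) (z : ℤ × Bool)
    (hz : z.2 = c (e - 1 - m)) (hz' : z.1 < e - 1 - m) :
    Tight A k (z :: (run c (e - 1 - m) (m + 1) ++ O)) := by
  have step : ∀ (y : ℤ) (l : List (ℤ × Bool)) (z : ℤ × Bool), z.2 = c y → z.1 < y →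
      c y ≠ c (y + 1) → Tight A k ((y, c (y + 1)) :: l) → Tight A k (z :: (y, c (y + 1)) :: l) := by
    intro y l z h1 h2 h3 h4
    refine h4.cons ⟨h2.ne, h1 ▸ h3⟩ ?_
    rintro w - (⟨h5, -, -⟩ | ⟨-, h5, -⟩)
    · refine hA y ?_ h5
      simp only at h5
      rw [h5] at h3
      simpa using h3
    · simp only at h5
      omega
  induction m generalizing z with
  | zero =>
    simp only [run, Nat.cast_zero, sub_zero, sub_add_cancel, List.append_nil] at hz hz' ⊢
    split_ifs with hc
    · exact hE z (hc ▸ hz) (by omega) (fun h => absurd hc h) fun _ => hz'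
    · have := step (e - 1) O z hz hz'
      rw [sub_add_cancel] at this
      exact this hc (hE _ rfl (by simp) (fun _ => rfl) fun h => absurd h hc)
  | succ m ih =>
    have e1 : e - 1 - ((m + 1 : ℕ) : ℤ) + 1 = e - 1 - m := by push_cast; ring
    rw [run, e1]
    split_ifs with hc
    · exact ih z (hc ▸ hz) (by push_cast at hz'; omega)
    · have := step (e - 1 - ((m + 1 : ℕ) : ℤ)) (run c (e - 1 - m) (m + 1) ++ O) z hz hz'
      rw [e1] at this
      exact this hc (ih _ rfl (by push_cast; omega))

/-- A downward crossing before the gap `e - 1` has its predecessor on the left and its successor on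
the right, so it is a minimum in addition to those counted in `O`. -/
lemma tight_run_succ (hA : ∀ y, c y = false → c (y + 1) = true → y ∈ A)
    (hE : ∀ z : ℤ × Bool, z.2 = c e → z.1 < e → (c (e - 1) ≠ c e → z.1 = e - 1) →
      (c (e - 1) = c e → z.1 < e - 1) → Tight A k (z :: O))
    (hO : c (e - 1) = c e → ∀ h ∈ O.head?, e - 1 ≤ h.1)
    (hO' : c (e - 1) = c e → c e = true → O ≠ []) (m : ℕ) (z : ℤ × Bool)
    (hz : z.2 = c (e - 1 - m)) (hz' : z.1 < e - 1 - m)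
    (hw : ∃ y, e - 1 - m ≤ y ∧ y < e - 1 ∧ c y = false ∧ c (y + 1) = true) :
    k + 1 ≤ numMin (z :: (run c (e - 1 - m) (m + 1) ++ O)) := by
  induction m generalizing z with
  | zero =>
    obtain ⟨y, h1, h2, -⟩ := hw
    push_cast at h1
    omega
  | succ m ih =>
    have e1 : e - 1 - ((m + 1 : ℕ) : ℤ) + 1 = e - 1 - m := by push_cast; ring
    obtain ⟨y, h1, h2, h3, h4⟩ := hw
    rw [run, e1]
    have next : y ≠ e - 1 - ((m + 1 : ℕ) : ℤ) →
        ∃ y, e - 1 - m ≤ y ∧ y < e - 1 ∧ c y = false ∧ c (y + 1) = true := fun h =>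
      ⟨y, by push_cast at h h1; omega, h2, h3, h4⟩
    split_ifs with hc
    · refine ih z (hc ▸ hz) (by push_cast at hz'; omega) (next ?_)
      rintro rfl
      rw [e1] at h4
      rw [h3, h4] at hc
      exact absurd hc (by simp)
    · by_cases hy : y = e - 1 - ((m + 1 : ℕ) : ℤ)
      · subst hy
        rw [e1] at h4
        have ht := tight_run hA hE m (e - 1 - ((m + 1 : ℕ) : ℤ), c (e - 1 - m)) rfl
          (by push_cast; omega)
        have hh := head_run hO m
        have hn := run_ne_nil hO' m h4
        rw [List.append_assoc, List.singleton_append]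
        obtain ⟨w, l, hl⟩ := List.exists_cons_of_ne_nil hn
        rw [hl] at ht hh ⊢
        have hw := hh w rfl
        have hm : IsMin z (e - 1 - ((m + 1 : ℕ) : ℤ), c (e - 1 - m)) w :=
          Or.inl ⟨h4, hz', by push_cast; omega⟩
        rw [numMin, countTriples, if_pos hm]
        have := ht.le_numMin
        rw [numMin] at this
        omega
      · exact (ih _ rfl (by push_cast; omega) (next hy)).trans (countTriples_cons_ge _ _ _)

end Run

end GapWord

/-! ### Free reduction of products of monotone paths. -/

namespace GapWord

/-- All sufficiently far points are coloured as the ends of the axis. -/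
def IsColoring (M : ℤ) (c : ℤ → Bool) : Prop :=
  ∀ k, (k ≤ -M → c k = false) ∧ (M ≤ k → c k = true)

/-- The last point where the colourings of consecutive letters differ; each colouring is given
from the point of view of its letter. -/
def Junction (c d : ℤ → Bool) (Q : ℤ) : Prop :=
  c Q ≠ flipColor d Q ∧ ∀ k, Q < k → c k = flipColor d k

lemma Junction.lt {M Q : ℤ} {c d : ℤ → Bool} (h : Junction c d Q) (hc : IsColoring M c)
    (hd : IsColoring M d) : -M < Q ∧ Q < M := by
  constructor
  · by_contra hQ
    refine h.1 ?_
    rw [flipColor, (hc Q).1 (by omega), (hd (-Q)).2 (by omega)]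
    rfl
  · by_contra hQ
    refine h.1 ?_
    rw [flipColor, (hc Q).2 (by omega), (hd (-Q)).1 (by omega)]
    rfl

/-- A product of monotone paths, beginning downwards, given by their colourings. Every colouring is
given from the point of view of its letter, that is, the plane is rotated after each letter. The
number `lo` is the first point where the colouring of the leading letter differs from the one of
the letter before it. The last parameter is a lower bound for the number of local minima that
survive after free reduction.

In `step` no crossings cancel besides those common to neighbouring paths. In `single` only one
crossing of the leading path survives, and in `skip` the middle path cancels completely. -/
inductive Path (M : ℤ) : Set ℤ → Set ℤ → ℤ → (ℤ → Bool) → List (ℤ → Bool) → ℕ → Prop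
  | last {A G lo c} : IsColoring M c → (∀ y, c y = false → c (y + 1) = true → y ∈ A) →
      (∀ y, c y ≠ c (y + 1) → y ∈ G) → lo < M →
      Path M A G lo c [] 0
  | step {A G lo c d l k Q} (δ : ℕ) : IsColoring M c → IsColoring M d →
      (∀ y, c y = false → c (y + 1) = true → y ∈ A) → (∀ y, c y ≠ c (y + 1) → y ∈ G) →
      Junction c d Q → lo ≤ Q →
      (δ = 0 ∨ δ = 1 ∧ ∃ y, lo ≤ y ∧ y < Q ∧ c y = false ∧ c (y + 1) = true) →
      Path M {y | -1 - y ∈ A} {y | -1 - y ∈ G} (-Q) d l k → Path M A G lo c (d :: l) (k + δ)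
  | single {A G c d l k Q} : IsColoring M c → IsColoring M d →
      (∀ y, c y = false → c (y + 1) = true → y ∈ A) → (∀ y, c y ≠ c (y + 1) → y ∈ G) →
      Junction c d Q → c Q = false →
      c (Q + 1) = true →
      Path M {y | -1 - y ∈ A} {y | -1 - y ∈ G} (-Q) d l k → Path M A G (Q + 1) c (d :: l) k
  | skip {A G lo c d e l k Q Q'} (δ : ℕ) : IsColoring M c → IsColoring M d → IsColoring M e →
      (∀ y, c y = false → c (y + 1) = true → y ∈ A) → (∀ y, c y ≠ c (y + 1) → y ∈ G) →
      Junction c d Q → Junction d e Q' →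
      lo ≤ Q → Q + Q' < -1 → e (-Q') = false →
      (δ = 0 ∨ δ = 1 ∧ ∃ y, lo ≤ y ∧ y < Q ∧ c y = false ∧ c (y + 1) = true) →
      Path M A G (-Q') e l k → Path M A G lo c (d :: e :: l) (k + δ)

/-- The contribution of the paths after the leading one. -/
def tailValue (M : ℤ) : List (ℤ → Bool) → FreeGroup ℤ
  | [] => 1
  | d :: l => flipHom (FreeGroup.mk (runTo d (-M) M) * tailValue M l)

/-- The result of free reduction, after the crossing of the gap `lo - 1`. -/
structure Reduced (A : Set ℤ) (lo : ℤ) (c : ℤ → Bool) (k : ℕ) (O : List (ℤ × Bool)) : Prop where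
  le_head : ∀ h ∈ O.head?, lo - 1 ≤ h.1
  head_eq : c (lo - 1) ≠ c lo → ∀ h ∈ O.head?, h.1 = lo - 1
  ne_nil : c (lo - 1) ≠ c lo → O ≠ []
  tight : ∀ z : ℤ × Bool, z.2 = c (lo - 1) → (c (lo - 1) = c lo → z.1 ≤ lo - 1) →
    (c (lo - 1) ≠ c lo → z.1 ≠ lo - 1) → Tight A k (z :: O)

/-- From the gap `lo` on, the crossings are covered by `tight_run` and `tight_run_succ`. The gap `lo
- 1` is treated apart, because the letter before its crossing may lie on either side of it. -/
lemma reduced_run {A : Set ℤ} {c : ℤ → Bool} {e lo : ℤ} {O : List (ℤ × Bool)} {k δ : ℕ}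
    (hA : ∀ y, c y = false → c (y + 1) = true → y ∈ A)
    (hE : ∀ z : ℤ × Bool, z.2 = c e → z.1 < e → (c (e - 1) ≠ c e → z.1 = e - 1) →
      (c (e - 1) = c e → z.1 < e - 1) → Tight A k (z :: O))
    (hO : c (e - 1) = c e → ∀ h ∈ O.head?, e - 1 ≤ h.1)
    (hδ : δ = 0 ∨ δ = 1 ∧ (c (e - 1) = c e → c e = true → O ≠ []) ∧
      ∃ y, lo ≤ y ∧ y < e - 1 ∧ c y = false ∧ c (y + 1) = true)
    (hlo : lo ≤ e - 1) : Reduced A lo c (k + δ) (runTo c (lo - 1) e ++ O) := by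
  obtain ⟨m, hm⟩ : ∃ m : ℕ, lo = e - 1 - m := ⟨(e - 1 - lo).toNat, by omega⟩
  have e1 : runTo c lo e = run c (e - 1 - m) (m + 1) := by
    rw [runTo, hm]
    congr 1
    omega
  have hX : ∀ z : ℤ × Bool, z.2 = c lo → z.1 < lo → Tight A (k + δ) (z :: (runTo c lo e ++ O)) := by
    intro z h1 h2
    rw [e1]
    subst hm
    have ht := tight_run hA hE m z h1 h2
    rcases hδ with rfl | ⟨rfl, h3, h4⟩
    · exact ht
    · exact ⟨ht.alternating, ht.minIn, tight_run_succ hA hE hO h3 m z h1 h2 h4⟩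
  have hh : ∀ h ∈ (runTo c lo e ++ O).head?, lo ≤ h.1 := by
    rw [e1, hm]
    exact head_run hO m
  have e2 : runTo c (lo - 1) e ++ O = (if c (lo - 1) = c lo then [] else [(lo - 1, c lo)]) ++
      (runTo c lo e ++ O) := by
    rw [runTo_succ c (show lo - 1 < e by omega), sub_add_cancel, List.append_assoc]
  rw [e2]
  split_ifs with hc
  · refine ⟨fun h hh' => ?_, fun h => absurd hc h, fun h => absurd hc h, fun z h1 h2 _ => ?_⟩
    · have := hh h hh'
      omega
    · exact hX z (hc ▸ h1) (by have := h2 hc; omega)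
  · refine ⟨fun h hh' => ?_, fun _ h hh' => ?_, fun _ => by simp, fun z h1 _ h3 => ?_⟩
    · simp only [List.cons_append, List.head?_cons, Option.mem_def, Option.some.injEq] at hh'
      rw [← hh']
    · simp only [List.cons_append, List.head?_cons, Option.mem_def, Option.some.injEq] at hh'
      rw [← hh']
    · refine (hX (lo - 1, c lo) rfl (by simp)).cons ⟨h3 hc, h1 ▸ hc⟩ ?_
      rintro w hw (⟨h5, -, -⟩ | ⟨-, -, h5⟩)
      · refine hA (lo - 1) ?_ (by simpa using h5)
        simp only at h5
        rw [h5] at hc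
        simpa using hc
      · have := hh w hw
        simp only at h5
        omega

lemma flip_mem_head {O : List (ℤ × Bool)} {h : ℤ × Bool} (hh : h ∈ (O.map flip).head?) :
    flip h ∈ O.head? := by
  rcases O with _ | ⟨a, O⟩
  · simp at hh
  · simp only [List.map_cons, List.head?_cons, Option.mem_def, Option.some.injEq] at hh ⊢
    rw [← hh, flip_flip]

lemma mem_runTo {c : ℤ → Bool} {y e : ℤ} {a : ℤ × Bool} (h : a ∈ runTo c y e) :
    c a.1 ≠ c (a.1 + 1) := by
  rw [runTo] at h
  generalize (e - y).toNat = m at h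
  induction m generalizing y with
  | zero => simp [run] at h
  | succ m ih =>
    rw [run, List.mem_append] at h
    rcases h with h | h
    · split_ifs at h with hc
      · simp at h
      · rw [List.mem_singleton.1 h]
        exact hc
    · exact ih h

/-- Beyond `Q` the two colourings agree up to rotation, so the end of the path of `c` and the
beginning of the path of `d` are mutually inverse and cancel. -/
lemma mk_runTo_tailValue_step {M Q lo : ℤ} {c d : ℤ → Bool} {l : List (ℤ → Bool)}
    (hc : IsColoring M c) (hd : IsColoring M d) (hJ : Junction c d Q) (hlo : lo ≤ Q + 1) :
    FreeGroup.mk (runTo c (lo - 1) M) * tailValue M (d :: l) =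
      FreeGroup.mk (runTo c (lo - 1) (Q + 1)) *
        flipHom (FreeGroup.mk (runTo d (-Q - 1) M) * tailValue M l) := by
  have hQ := hJ.lt hc hd
  have e1 := mk_runTo_mul_flip c (show Q + 1 ≤ M by omega)
  have e2 : runTo (flipColor c) (-M) (-(Q + 1)) = runTo d (-M) (-Q - 1) := by
    rw [neg_add']
    apply runTo_congr
    intro k _ hk
    rw [flipColor, hJ.2 (-k) (by omega), flipColor]
    simp
  rw [e2] at e1
  rw [tailValue, runTo_append c (x := Q + 1) (by omega) (by omega),
    runTo_append d (x := -Q - 1) (by omega) (by omega), mk_append, mk_append, map_mul, map_mul,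
    map_mul, flipHom_mk, mul_assoc (FreeGroup.mk _), mul_assoc (FreeGroup.mk _),
    ← mul_assoc (FreeGroup.mk (runTo c (Q + 1) M)), e1, one_mul]

/-- Seen from `c`, the path of `d` coincides with that of `c` to the right of `Q` and with that of
`e` to the left of `-Q'`. As `-Q' > Q + 1`, these stretches cover it: it cancels completely, and the
path of `c` is continued by that of `e` from the gap `-Q' - 1` on. -/
lemma mk_runTo_tailValue_skip {M Q Q' lo : ℤ} {c d e : ℤ → Bool} {l : List (ℤ → Bool)}
    (hc : IsColoring M c) (hd : IsColoring M d) (he : IsColoring M e) (hJ : Junction c d Q)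
    (hJ' : Junction d e Q') (hlo : lo ≤ Q) (hQ : Q + Q' < -1) :
    FreeGroup.mk (runTo c (lo - 1) M) * tailValue M (d :: e :: l) =
      FreeGroup.mk (runTo c (lo - 1) (-Q' - 1)) *
        (FreeGroup.mk (runTo e (-Q' - 1) M) * tailValue M l) := by
  have hQ1 := hJ.lt hc hd
  have hQ2 := hJ'.lt hd he
  have e1 := mk_runTo_mul_flip c (show -Q' - 1 ≤ M by omega)
  have e2 : runTo (flipColor c) (-M) (-(-Q' - 1)) = runTo d (-M) (-(-Q' - 1)) := by
    apply runTo_congr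
    intro k _ hk
    rw [flipColor, hJ.2 (-k) (by omega), flipColor]
    simp
  have e3 := mk_runTo_mul_flip d (show -(-Q' - 1) ≤ M by omega)
  have e4 : runTo (flipColor d) (-M) (- -(-Q' - 1)) = runTo e (-M) (-Q' - 1) := by
    rw [neg_neg]
    apply runTo_congr
    intro k _ hk
    rw [flipColor, hJ'.2 (-k) (by omega), flipColor]
    simp
  rw [e4] at e3
  rw [e2] at e1
  have e5 : flipHom (FreeGroup.mk (runTo d (-(-Q' - 1)) M)) *
      FreeGroup.mk (runTo e (-M) (-Q' - 1)) = 1 := by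
    have := congrArg flipHom e3
    rw [map_mul, map_one, ← flipHom_mk, flipHom_flipHom] at this
    exact this
  rw [tailValue, tailValue, map_mul, flipHom_flipHom,
    runTo_append c (x := -Q' - 1) (by omega) (by omega),
    runTo_append d (x := -(-Q' - 1)) (by omega) (by omega),
    runTo_append e (y := -M) (x := -Q' - 1) (by omega) (by omega), mk_append, mk_append, mk_append,
    map_mul, flipHom_mk]
  simp only [mul_assoc]
  congr 1
  rw [← mul_assoc (FreeGroup.mk (runTo c (-Q' - 1) M)), e1, one_mul, ← mul_assoc (flipHom _), e5,
    one_mul]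

/-- Free reduction of a product of monotone paths. -/
theorem Path.exists_reduced {M : ℤ} {A G : Set ℤ} {lo : ℤ} {c : ℤ → Bool} {l : List (ℤ → Bool)}
    {k : ℕ} (h : Path M A G lo c l k) :
    ∃ O, FreeGroup.mk (runTo c (lo - 1) M) * tailValue M l = FreeGroup.mk O ∧
      Reduced A lo c k O ∧ ∀ a ∈ O, a.1 ∈ G := by
  induction h with
  | @last A G lo c hc hA hG hlo =>
    refine ⟨runTo c (lo - 1) M ++ [], by rw [List.append_nil, tailValue, mul_one], ?_,
      fun a ha => hG _ (mem_runTo (by simpa using ha))⟩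
    exact reduced_run (k := 0) (δ := 0) hA
      (fun z _ _ _ _ => ⟨List.isChain_singleton _, trivial, Nat.zero_le _⟩) (fun _ h hh => by
        simp at hh) (Or.inl rfl) (by omega)
  | @step A G lo c d l k Q δ hc hd hA hG hJ hlo hδ hp ih =>
    obtain ⟨O, hO, hr, hmem⟩ := ih
    refine ⟨runTo c (lo - 1) (Q + 1) ++ O.map flip, ?_, ?_, ?_⟩
    rotate_left 2
    · intro a ha
      rcases List.mem_append.1 ha with ha | ha
      · exact hG _ (mem_runTo ha)
      · obtain ⟨b, hb, rfl⟩ := List.mem_map.1 ha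
        exact hmem b hb
    · rw [mk_runTo_tailValue_step hc hd hJ (by omega), hO, flipHom_mk, mk_append]
    have j1 : c (Q + 1) = !d (-Q - 1) := by
      have := hJ.2 (Q + 1) (by omega)
      rwa [flipColor, neg_add'] at this
    have j2 : c Q = d (-Q) := by
      have := hJ.1
      rw [flipColor] at this
      rcases h1 : c Q <;> rcases h2 : d (-Q) <;> simp_all
    -- The colourings agree at `Q + 1` and differ at `Q`, so exactly one of the two paths crosses
    -- the gap `Q`. This decides on which side of `Q` the next letter lies.
    have j3 : c Q = c (Q + 1) → d (-Q - 1) ≠ d (-Q) := fun h => by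
      rw [← j2, h, j1]
      simp
    have j4 : c Q ≠ c (Q + 1) → d (-Q - 1) = d (-Q) := fun h => by
      rw [← j2]
      rw [j1] at h
      rcases h1 : c Q <;> rcases h2 : d (-Q - 1) <;> simp_all
    apply reduced_run hA
    · intro z h1 h2 h3 h4
      rw [add_sub_cancel_right] at h3 h4
      have := hr.tight (flip z) (by simp [flip, h1, j1])
        (fun h => by
          have : c Q ≠ c (Q + 1) := fun h' => j3 h' h
          have := h3 this
          simp only [flip]
          omega)
        (fun h => by
          have : c Q = c (Q + 1) := by
            by_contra h'
            exact h (j4 h')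
          have := h4 this
          simp only [flip]
          omega)
      rw [← flip_flip z, ← List.map_cons, tight_map_flip]
      exact this
    · intro h1 a ha
      rw [add_sub_cancel_right] at h1 ⊢
      have := hr.head_eq (j3 h1) _ (flip_mem_head ha)
      simp only [flip] at this
      omega
    · rw [add_sub_cancel_right]
      refine hδ.imp_right fun h => ⟨h.1, fun h1 _ => ?_, h.2⟩
      simpa using hr.ne_nil (j3 h1)
    · omega
  | @single A G c d l k Q hc hd hA hG hJ hc1 hc2 hp ih =>
    obtain ⟨O, hO, hr, hmem⟩ := ih
    have j1 : d (-Q - 1) = false := by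
      have := hJ.2 (Q + 1) (by omega)
      rw [flipColor, neg_add', hc2] at this
      simpa using this
    have j2 : d (-Q) = false := by
      have := hJ.1
      rw [flipColor, hc1] at this
      simpa using this
    have e1 : runTo c Q (Q + 1) = [(Q, true)] := by
      rw [runTo_succ c (by omega), runTo_self, hc1, hc2]
      rfl
    refine ⟨(Q, true) :: O.map flip, ?_, ?_, ?_⟩
    rotate_left 2
    · intro a ha
      rcases List.mem_cons.1 ha with rfl | ha
      · exact hG _ (by rw [hc1, hc2]; simp)
      · obtain ⟨b, hb, rfl⟩ := List.mem_map.1 ha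
        exact hmem b hb
    · rw [mk_runTo_tailValue_step hc hd hJ (by omega), hO, flipHom_mk, ← mk_append,
        add_sub_cancel_right, e1]
      rfl
    have ht : Tight A k ((Q, true) :: O.map flip) := by
      have := hr.tight (flip (Q, true)) (by simp [flip, j1]) (fun _ => by simp only [flip]; omega)
        (fun h => absurd (j1.trans j2.symm) h)
      rw [← flip_flip (Q, true), ← List.map_cons, tight_map_flip]
      exact this
    rw [← add_sub_cancel_right Q 1] at ht
    refine ⟨?_, ?_, fun _ => by simp, ?_⟩
    · intro h hh
      simp only [List.head?_cons, Option.mem_def, Option.some.injEq] at hh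
      rw [← hh]
      simp
    · intro _ h hh
      simp only [List.head?_cons, Option.mem_def, Option.some.injEq] at hh
      rw [← hh]
      simp
    · intro z h1 h2 h3
      rw [add_sub_cancel_right] at h1 h2 h3 ht
      refine ht.cons ⟨h3 (by rw [hc1, hc2]; simp), by rw [h1, hc1]; simp⟩ ?_
      intro w _ _
      exact hA Q hc1 hc2
  | @skip A G lo c d e l k Q Q' δ hc hd he hA hG hJ hJ' hlo hQ hf hδ hp ih =>
    obtain ⟨O, hO, hr, hmem⟩ := ih
    refine ⟨runTo c (lo - 1) (-Q' - 1) ++ O, ?_, ?_, ?_⟩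
    rotate_left 2
    · intro a ha
      rcases List.mem_append.1 ha with ha | ha
      · exact hG _ (mem_runTo ha)
      · exact hmem a ha
    · rw [mk_runTo_tailValue_skip hc hd he hJ hJ' hlo hQ, hO, mk_append]
    -- At `-Q' - 1` both pairs of neighbouring colourings agree, so `c` and `e` fit together there.
    have j1 : c (-Q' - 1) = e (-Q' - 1) := by
      rw [hJ.2 _ (by omega), flipColor, hJ'.2 _ (by omega), flipColor, neg_neg, Bool.not_not]
    apply reduced_run hA
    · intro z h1 h2 h3 h4
      exact hr.tight z (h1.trans j1) (fun _ => by omega) (fun _ => by omega)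
    · intro _ a ha
      have := hr.le_head a ha
      omega
    · refine hδ.imp_right fun h => ⟨h.1, fun _ h2 => ?_, ?_⟩
      · apply hr.ne_nil
        rw [← j1, h2, hf]
        simp
      · obtain ⟨y, h1, h2, h3⟩ := h.2
        exact ⟨y, h1, by omega, h3⟩
    · omega

end GapWord

/-! ### The action of permutation braids on words -/

namespace GapWord

open Braid

variable {n : ℕ}

/-- The colouring, by positions in the end, of the strands of `g` into those that start on the left
and on the right of the gap `t`. The strand ending at the position `i` is at the point `i + 1`. -/
def baseColor (g : Equiv.Perm (Fin n)) (t k : ℤ) : Bool :=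
  if h : 0 < k ∧ k ≤ n then decide (t ≤ ((g.symm ⟨(k - 1).toNat, by omega⟩ : Fin n) : ℕ))
  else decide (0 < k)

/-- The colouring given by a letter, from the point of view of the letter. -/
def color (g : Equiv.Perm (Fin n)) (a : ℤ × Bool) : ℤ → Bool :=
  if a.2 then baseColor g a.1 else flipColor (baseColor g a.1)

/-- The end of a strand, from the point of view of a letter. -/
def strandPoint (g : Equiv.Perm (Fin n)) (b : Bool) (l : Fin n) : ℤ :=
  if b then ((g l).1 : ℤ) + 1 else -(((g l).1 : ℤ) + 1)

lemma flipColor_flipColor (c : ℤ → Bool) : flipColor (flipColor c) = c := by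
  funext k
  simp [flipColor]

lemma baseColor_strandPoint (g : Equiv.Perm (Fin n)) (t : ℤ) (l : Fin n) :
    baseColor g t (((g l).1 : ℤ) + 1) = decide (t ≤ l.1) := by
  have h := (g l).2
  rw [baseColor, dif_pos (by omega)]
  have : (⟨(((g l).1 : ℤ) + 1 - 1).toNat, by omega⟩ : Fin n) = g l := Fin.ext (by simp)
  rw [this, Equiv.symm_apply_apply]

lemma baseColor_of_ne (g : Equiv.Perm (Fin n)) (t k : ℤ) (h : ∀ l, k ≠ ((g l).1 : ℤ) + 1) :
    baseColor g t k = decide (0 < k) := by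
  rw [baseColor, dif_neg]
  rintro ⟨h1, h2⟩
  apply h (g.symm ⟨(k - 1).toNat, by omega⟩)
  rw [Equiv.apply_symm_apply]
  simp only
  omega

lemma flipColor_color (g : Equiv.Perm (Fin n)) (t : ℤ) (b : Bool) :
    flipColor (color g (t, !b)) = color g (t, b) := by
  rcases b <;> simp [color, flipColor_flipColor]

lemma strandPoint_not (g : Equiv.Perm (Fin n)) (b : Bool) (l : Fin n) :
    strandPoint g (!b) l = -strandPoint g b l := by
  rcases b <;> simp [strandPoint]

lemma color_strandPoint (g : Equiv.Perm (Fin n)) (t : ℤ) (b : Bool) (l : Fin n) :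
    color g (t, b) (strandPoint g b l) = if b then decide (t ≤ l.1) else decide ((l.1 : ℤ) < t) := by
  rcases b
  · simp only [color, strandPoint, Bool.false_eq_true, if_false, flipColor, neg_neg,
      baseColor_strandPoint]
    rw [← decide_not]
    simp
  · simp only [color, strandPoint, if_true, baseColor_strandPoint]

lemma isColoring_color (g : Equiv.Perm (Fin n)) (a : ℤ × Bool) :
    IsColoring (n + 1) (color g a) := by
  have h : ∀ k : ℤ, (k ≤ 0 → baseColor g a.1 k = false) ∧
      ((n : ℤ) + 1 ≤ k → baseColor g a.1 k = true) := by
    intro k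
    constructor
    · intro hk
      rw [baseColor, dif_neg (by omega)]
      simpa using hk
    · intro hk
      rw [baseColor, dif_neg (by omega)]
      simp only [decide_eq_true_eq]
      omega
  intro k
  unfold color
  split_ifs
  · exact ⟨fun hk => (h k).1 (by omega), fun hk => (h k).2 hk⟩
  · constructor
    · intro hk
      rw [flipColor, (h (-k)).2 (by omega)]
      rfl
    · intro hk
      rw [flipColor, (h (-k)).1 (by omega)]
      rfl

/-- A strand that starts between two gaps. -/
def Between (u t : ℤ) (l : Fin n) : Prop := (u ≤ l.1 ∧ (l.1 : ℤ) < t) ∨ (t ≤ l.1 ∧ (l.1 : ℤ) < u)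

/-- Compared in the same frame, the colourings of the gaps `u` and `t` differ exactly at the ends of
the strands starting between them. The junction is the last of these ends. -/
lemma exists_junction (g : Equiv.Perm (Fin n)) (b : Bool) {u t : ℤ} (hut : u ≠ t)
    (hu : 0 ≤ u ∧ u ≤ n) (ht : 0 ≤ t ∧ t ≤ n) :
    ∃ l0 : Fin n, Between u t l0 ∧
      Junction (color g (u, b)) (color g (t, !b)) (strandPoint g b l0) ∧
      ∀ l, Between u t l → strandPoint g b l ≤ strandPoint g b l0 := by
  classical
  have hne : (Finset.univ.filter fun l : Fin n => Between u t l).Nonempty := by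
    rcases lt_or_gt_of_ne hut with h | h
    · refine ⟨⟨u.toNat, by omega⟩, Finset.mem_filter.2 ⟨Finset.mem_univ _, Or.inl ?_⟩⟩
      simp only
      omega
    · refine ⟨⟨t.toNat, by omega⟩, Finset.mem_filter.2 ⟨Finset.mem_univ _, Or.inr ?_⟩⟩
      simp only
      omega
  obtain ⟨l0, h0, hmax⟩ := Finset.exists_max_image _ (strandPoint g b) hne
  simp only [Finset.mem_filter, Finset.mem_univ, true_and] at h0 hmax
  refine ⟨l0, h0, ⟨?_, ?_⟩, hmax⟩
  · rw [flipColor_color, color_strandPoint, color_strandPoint]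
    unfold Between at h0
    split_ifs
    · intro e
      rw [decide_eq_decide] at e
      omega
    · intro e
      rw [decide_eq_decide] at e
      omega
  · intro k hk
    rw [flipColor_color]
    by_cases hex : ∃ l, k = strandPoint g b l
    · obtain ⟨l, rfl⟩ := hex
      have hl : ¬ Between u t l := fun h => absurd (hmax l h) (not_le.2 hk)
      unfold Between at hl
      rw [color_strandPoint, color_strandPoint]
      split_ifs
      · rw [decide_eq_decide]
        omega
      · rw [decide_eq_decide]
        omega
    · push Not at hex
      rcases b
      · simp only [color, Bool.false_eq_true, if_false, flipColor]
        have : ∀ l, -k ≠ ((g l).1 : ℤ) + 1 := fun l e => hex l (by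
          simp only [strandPoint, Bool.false_eq_true, if_false]
          omega)
        rw [baseColor_of_ne g u _ this, baseColor_of_ne g t _ this]
      · simp only [color, if_true]
        rw [baseColor_of_ne g u _ (by simpa [strandPoint] using hex),
          baseColor_of_ne g t _ (by simpa [strandPoint] using hex)]

lemma Junction.unique {c d : ℤ → Bool} {Q Q' : ℤ} (h : Junction c d Q) (h' : Junction c d Q') :
    Q = Q' := by
  rcases lt_trichotomy Q Q' with hlt | heq | hlt
  · exact absurd (h.2 _ hlt) h'.1
  · exact heq
  · exact absurd (h'.2 _ hlt) h.1

/-- A set of gaps, from the point of view of a letter. -/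
def frameSet (b : Bool) (A : Set ℤ) : Set ℤ := if b then A else {y | -1 - y ∈ A}

lemma flip_frameSet (b : Bool) (A : Set ℤ) : {y | -1 - y ∈ frameSet b A} = frameSet (!b) A := by
  rcases b <;> simp [frameSet]

/-- The gaps at which the strands ending at both sides do not cross. -/
def endAscents (g : Equiv.Perm (Fin n)) : Set ℤ :=
  {y | ∀ s : Fin (n - 1), y = s.1 + 1 → g.symm (leftPos s) < g.symm (rightPos s)}

/-- The gaps at which the strands starting at both sides do not cross. -/
def startAscents (g : Equiv.Perm (Fin n)) : Set ℤ :=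
  {y | ∀ s : Fin (n - 1), y = s.1 + 1 → g (leftPos s) < g (rightPos s)}

/-- The strand ending on the left of the rise starts to the left of the gap `t` and the one on its
right starts to the right of `t`, so the two do not cross. This confines the minima of the image to
`endAscents`. -/
lemma baseColor_rise (g : Equiv.Perm (Fin n)) (t y : ℤ) (h1 : baseColor g t y = false)
    (h2 : baseColor g t (y + 1) = true) : y ∈ endAscents g := by
  rintro s rfl
  have e1 := baseColor_strandPoint g t (g.symm (leftPos s))
  have e2 := baseColor_strandPoint g t (g.symm (rightPos s))
  rw [Equiv.apply_symm_apply] at e1 e2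
  have e3 : (((rightPos s).1 : ℕ) : ℤ) + 1 = s.1 + 1 + 1 := by simp [rightPos]
  rw [e3, h2] at e2
  have e4 : (((leftPos s).1 : ℕ) : ℤ) + 1 = s.1 + 1 := by simp [leftPos]
  rw [e4, h1] at e1
  have e1 := of_decide_eq_false e1.symm
  have e2 := of_decide_eq_true e2.symm
  rw [Fin.lt_def]
  omega

lemma baseColor_gap (g : Equiv.Perm (Fin n)) (t y : ℤ)
    (h : baseColor g t y ≠ baseColor g t (y + 1)) : 0 ≤ y ∧ y ≤ n := by
  by_contra hy
  apply h
  rw [baseColor, dif_neg (by omega), baseColor, dif_neg (by omega), decide_eq_decide]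
  omega

lemma color_rise (g : Equiv.Perm (Fin n)) (a : ℤ × Bool) (y : ℤ) (h1 : color g a y = false)
    (h2 : color g a (y + 1) = true) : y ∈ frameSet a.2 (endAscents g) := by
  unfold color at h1 h2
  unfold frameSet
  split_ifs at h1 h2 ⊢
  · exact baseColor_rise g a.1 y h1 h2
  · rw [flipColor] at h1 h2
    refine baseColor_rise g a.1 (-1 - y) ?_ ?_
    · rw [show -1 - y = -(y + 1) by ring]
      simpa using h2
    · rw [show -1 - y + 1 = -y by ring]
      simpa using h1

lemma color_gap (g : Equiv.Perm (Fin n)) (a : ℤ × Bool) (y : ℤ)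
    (h : color g a y ≠ color g a (y + 1)) : y ∈ frameSet a.2 {y : ℤ | 0 ≤ y ∧ y ≤ n} := by
  unfold color at h
  unfold frameSet
  split_ifs at h ⊢
  · exact baseColor_gap g a.1 y h
  · rw [flipColor, flipColor] at h
    refine baseColor_gap g a.1 (-1 - y) fun e => h ?_
    rw [show -1 - y = -(y + 1) by ring, show -(y + 1) + 1 = -y by ring] at e
    rw [e]

lemma exists_rise {c : ℤ → Bool} {x y : ℤ} (hxy : x < y) (hx : c x = false) (hy : c y = true) :
    ∃ k, x ≤ k ∧ k < y ∧ c k = false ∧ c (k + 1) = true := by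
  obtain ⟨m, rfl⟩ := Int.le.dest hxy.le
  induction m with
  | zero => simp at hxy
  | succ m ih =>
    rcases hm : c (x + m) with _ | _
    · refine ⟨x + m, by omega, by push_cast; omega, hm, ?_⟩
      rw [← hy]
      congr 1
      push_cast
      ring
    · have hm0 : m ≠ 0 := by
        rintro rfl
        simp [hx] at hm
      obtain ⟨k, h1, h2, h3⟩ := ih (by omega) hm
      exact ⟨k, h1, by push_cast; omega, h3⟩

/-- At the middle letter, the winding number of the path has a local maximum. -/
def IsMax (z y w : ℤ × Bool) : Prop :=
  (y.2 = true ∧ y.1 < z.1 ∧ w.1 < y.1) ∨ (y.2 = false ∧ z.1 < y.1 ∧ y.1 < w.1)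

/-- The point `-Q` is the first end among the strands between `u` and `t`, and `Q'` the last among
those between `t` and `v`. At a minimum the strands next to `t` on its two sides lie between the
respective gaps, and as they do not cross there is a rise between their ends. At a maximum the order
of `-Q` and `Q'` is not determined, but the colours there are. -/
lemma normal_or_isMax (g : Equiv.Perm (Fin n)) {u t v : ℤ} {b : Bool} (hut : u ≠ t) (htv : t ≠ v)
    (hu : 0 ≤ u ∧ u ≤ n) (ht : 0 ≤ t ∧ t ≤ n) (hv : 0 ≤ v ∧ v ≤ n)
    (hmin : IsMin (u, !b) (t, b) (v, !b) → t ∈ startAscents g) {Q Q' : ℤ}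
    (hQ : Junction (color g (u, !b)) (color g (t, b)) Q)
    (hQ' : Junction (color g (t, b)) (color g (v, !b)) Q') :
    (-Q ≤ Q' ∨ IsMax (u, !b) (t, b) (v, !b)) ∧
      (IsMin (u, !b) (t, b) (v, !b) → ∃ y, -Q ≤ y ∧ y < Q' ∧ color g (t, b) y = false ∧
        color g (t, b) (y + 1) = true) ∧
      (IsMax (u, !b) (t, b) (v, !b) → color g (t, b) Q' = false ∧ color g (t, b) (-Q) = true ∧
        color g (v, !b) (-Q') = false) := by
  obtain ⟨l1, h1, hJ1, hm1⟩ := exists_junction g (!b) hut hu ht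
  rw [Bool.not_not] at hJ1
  obtain ⟨l2, h2, hJ2, hm2⟩ := exists_junction g b htv ht hv
  obtain rfl := hQ.unique hJ1
  obtain rfl := hQ'.unique hJ2
  have e1 : -strandPoint g (!b) l1 = strandPoint g b l1 := by rw [strandPoint_not, neg_neg]
  have e2 : -strandPoint g b l2 = strandPoint g (!b) l2 := (strandPoint_not g b l2).symm
  have hm1' : ∀ l, Between u t l → strandPoint g b l1 ≤ strandPoint g b l := fun l hl => by
    have := hm1 l hl
    rw [strandPoint_not, strandPoint_not] at this
    omega
  rw [e1, e2, color_strandPoint, color_strandPoint, color_strandPoint]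
  have hmid : IsMin (u, !b) (t, b) (v, !b) → ∃ y, strandPoint g b l1 ≤ y ∧ y < strandPoint g b l2 ∧
      color g (t, b) y = false ∧ color g (t, b) (y + 1) = true := by
    intro h
    have hs := hmin h
    have ht' : 0 < t ∧ t < n := by
      unfold IsMin at h
      simp only at h
      omega
    obtain ⟨s, hs'⟩ : ∃ s : Fin (n - 1), t = s.1 + 1 := ⟨⟨(t - 1).toNat, by omega⟩, by simp; omega⟩
    have hlt := Fin.lt_def.1 (hs s hs')
    have el : (((leftPos s).1 : ℕ) : ℤ) = s.1 := rfl
    have er : (((rightPos s).1 : ℕ) : ℤ) = s.1 + 1 := by simp [rightPos]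
    have cl := color_strandPoint g t b (leftPos s)
    have cr := color_strandPoint g t b (rightPos s)
    rw [el] at cl
    rw [er] at cr
    rcases h with ⟨hb, h3, h4⟩ | ⟨hb, h3, h4⟩ <;> simp only at hb h3 h4 <;> subst hb
    · have a1 := hm1' (leftPos s) (Or.inl (by omega))
      have a2 := hm2 (rightPos s) (Or.inl (by omega))
      obtain ⟨y, b1, b2, b3⟩ := exists_rise (c := color g (t, true))
        (x := strandPoint g true (leftPos s)) (y := strandPoint g true (rightPos s))
        (by simp only [strandPoint, if_true]; omega) (by rw [cl]; simp; omega)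
        (by rw [cr]; simp; omega)
      exact ⟨y, by omega, by omega, b3⟩
    · have a1 := hm1' (rightPos s) (Or.inr (by omega))
      have a2 := hm2 (leftPos s) (Or.inr (by omega))
      obtain ⟨y, b1, b2, b3⟩ := exists_rise (c := color g (t, false))
        (x := strandPoint g false (rightPos s)) (y := strandPoint g false (leftPos s))
        (by simp only [strandPoint, Bool.false_eq_true, if_false]; omega) (by rw [cr]; simp; omega)
        (by rw [cl]; simp; omega)
      exact ⟨y, by omega, by omega, b3⟩
  refine ⟨?_, hmid, ?_⟩
  · by_cases hM : IsMax (u, !b) (t, b) (v, !b)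
    · exact Or.inr hM
    by_cases hN : IsMin (u, !b) (t, b) (v, !b)
    · obtain ⟨y, b1, b2, -⟩ := hmid hN
      exact Or.inl (by omega)
    left
    -- Otherwise `u` and `v` lie on the same side of `t`, and the strand next to `t` on that side
    -- belongs to both sets of strands.
    have hside : (t < u ∧ t < v) ∨ (u < t ∧ v < t) := by
      unfold IsMax at hM
      unfold IsMin at hN
      simp only at hM hN
      rcases b <;> simp only [true_and, false_and, Bool.false_eq_true, Bool.true_eq_false, false_or,
        or_false] at hM hN <;> omega
    rcases hside with ⟨h3, h4⟩ | ⟨h3, h4⟩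
    · have a1 := hm1' ⟨t.toNat, by omega⟩ (Or.inr (by simp only; omega))
      have a2 := hm2 ⟨t.toNat, by omega⟩ (Or.inl (by simp only; omega))
      exact a1.trans a2
    · have a1 := hm1' ⟨(t - 1).toNat, by omega⟩ (Or.inl (by simp only; omega))
      have a2 := hm2 ⟨(t - 1).toNat, by omega⟩ (Or.inr (by simp only; omega))
      exact a1.trans a2
  · unfold Between at h1 h2
    rintro (⟨hb, h3, h4⟩ | ⟨hb, h3, h4⟩) <;> simp only at hb h3 h4 <;> subst hb
    · simp
      omega
    · simp
      omega

end GapWord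

/-! ### The image of an alternating word under one permutation braid. -/

namespace GapWord

open Braid

variable {n : ℕ}

/-- A relation on triples of consecutive letters which implies that the path given by the middle
letter passes from the left to the right between its junctions with its neighbours. -/
def RiseRelation (g : Equiv.Perm (Fin n)) (R : ℤ × Bool → ℤ × Bool → ℤ × Bool → Prop) : Prop :=
  ∀ (u t v : ℤ) (b : Bool), u ≠ t → t ≠ v → (0 ≤ u ∧ u ≤ n) → (0 ≤ t ∧ t ≤ n) → (0 ≤ v ∧ v ≤ n) →
    (IsMin (u, !b) (t, b) (v, !b) → t ∈ startAscents g) → R (u, !b) (t, b) (v, !b) →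
    ∀ Q Q', Junction (color g (u, !b)) (color g (t, b)) Q →
      Junction (color g (t, b)) (color g (v, !b)) Q' →
      ∃ y, -Q ≤ y ∧ y < Q' ∧ color g (t, b) y = false ∧ color g (t, b) (y + 1) = true

lemma riseRelation_isMin (g : Equiv.Perm (Fin n)) : RiseRelation g IsMin :=
  fun _ _ _ _ hut htv hu ht hv hmin hR _ _ hQ hQ' =>
    (normal_or_isMax g hut htv hu ht hv hmin hQ hQ').2.1 hR

/-- If the junctions of the second letter are in order, its path survives and `step` applies.
Otherwise that letter is a maximum, and its path keeps one crossing or none. Two consecutive letters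
are never both maxima, so the letter after it can be treated as normal. The number `δ` carries a
rise of the leading path that an earlier triple has guaranteed. -/
lemma exists_path (g : Equiv.Perm (Fin n)) (R : ℤ × Bool → ℤ × Bool → ℤ × Bool → Prop)
    [∀ z y w, Decidable (R z y w)] (hR : RiseRelation g R) (m : ℕ) :
    ∀ (x : ℤ × Bool) (W : List (ℤ × Bool)), W.length ≤ m → Alternating (x :: W) →
    (∀ a ∈ x :: W, 0 ≤ a.1 ∧ a.1 ≤ n) → MinIn (startAscents g) (x :: W) →
    ∀ (lo : ℤ) (δ : ℕ), lo < n + 1 →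
    (∀ y ∈ W.head?, ∀ Q, Junction (color g x) (color g y) Q → lo ≤ Q) →
    (δ = 0 ∨ δ = 1 ∧ ∃ y ∈ W.head?, ∃ Q, Junction (color g x) (color g y) Q ∧
      ∃ r, lo ≤ r ∧ r < Q ∧ color g x r = false ∧ color g x (r + 1) = true) →
    ∃ k, Path (n + 1) (frameSet x.2 (endAscents g)) (frameSet x.2 {y : ℤ | 0 ≤ y ∧ y ≤ n}) lo
      (color g x) (W.map (color g)) k ∧ countTriples R (x :: W) + δ ≤ k := by
  induction m using Nat.strong_induction_on with
  | _ m ih =>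
  intro x W hm hW hr hA lo δ hlo hnorm hδ
  -- continuing after the letter `p`
  have next : ∀ (p z : ℤ × Bool) (V : List (ℤ × Bool)) (Q : ℤ), V.length < m →
      Alternating (p :: z :: V) → (∀ a ∈ p :: z :: V, 0 ≤ a.1 ∧ a.1 ≤ n) →
      MinIn (startAscents g) (p :: z :: V) → Junction (color g p) (color g z) Q →
      (∀ y ∈ V.head?, ∀ Q', Junction (color g z) (color g y) Q' → -Q ≤ Q') →
      ∃ k, Path (n + 1) (frameSet z.2 (endAscents g)) (frameSet z.2 {y : ℤ | 0 ≤ y ∧ y ≤ n}) (-Q)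
        (color g z) (V.map (color g)) k ∧ countTriples R (p :: z :: V) ≤ k := by
    intro p z V Q hV halt hrange hmin hJ hn
    have hQ := hJ.lt (isColoring_color g p) (isColoring_color g z)
    rcases V with _ | ⟨v, V⟩
    · obtain ⟨k, h1, h2⟩ := ih _ hV z [] le_rfl (by simp [Alternating])
        (fun a ha => hrange a (List.mem_cons_of_mem _ ha)) trivial (-Q) 0 (by omega) hn (Or.inl rfl)
      exact ⟨k, h1, by simp [countTriples]⟩
    · have h' : Alternating (z :: v :: V) := (List.isChain_cons_cons.1 halt).2
      have a1 := (List.isChain_cons_cons.1 halt).1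
      have a2 := (List.isChain_cons_cons.1 h').1
      obtain ⟨u, b⟩ := p
      obtain ⟨t, b'⟩ := z
      obtain ⟨w, b''⟩ := v
      obtain rfl : b = !b' := Bool.eq_not_of_ne a1.2
      obtain rfl : b'' = !b' := Bool.eq_not_of_ne a2.2.symm
      have ru := hrange (u, !b') (by simp)
      have rt := hrange (t, b') (by simp)
      have rw' := hrange (w, !b') (by simp)
      obtain ⟨l0, -, hJ', -⟩ := exists_junction g b' a2.1 rt rw'
      obtain ⟨k, h1, h2⟩ := ih _ hV (t, b') ((w, !b') :: V) le_rfl h'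
        (fun a ha => hrange a (List.mem_cons_of_mem _ ha)) hmin.2 (-Q)
        (if R (u, !b') (t, b') (w, !b') then 1 else 0) (by omega) hn (by
          split_ifs with hh
          · exact Or.inr ⟨rfl, (w, !b'), by simp, _, hJ',
              hR u t w b' a1.1 a2.1 ru rt rw' hmin.1 hh _ _ hJ hJ'⟩
          · exact Or.inl rfl)
      refine ⟨k, h1, ?_⟩
      rw [countTriples, add_comm]
      exact h2
  have hc := isColoring_color g
  have hrise := color_rise g
  have hgap := color_gap g
  rcases W with _ | ⟨y, W⟩
  · rcases hδ with rfl | ⟨-, y, hy, -⟩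
    · exact ⟨0, Path.last (hc x) (hrise x) (hgap x) hlo, le_rfl⟩
    · simp at hy
  have hW' : Alternating (y :: W) := (List.isChain_cons_cons.1 hW).2
  have a1 := (List.isChain_cons_cons.1 hW).1
  obtain ⟨u, b⟩ := x
  obtain ⟨t, b'⟩ := y
  obtain rfl : b = !b' := Bool.eq_not_of_ne a1.2
  have ru := hr (u, !b') (by simp)
  have rt := hr (t, b') (by simp)
  obtain ⟨Q, hJ⟩ : ∃ Q, Junction (color g (u, !b')) (color g (t, b')) Q := by
    obtain ⟨l0, -, hJ, -⟩ := exists_junction g (!b') a1.1 ru rt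
    rw [Bool.not_not] at hJ
    exact ⟨_, hJ⟩
  have hloQ : lo ≤ Q := hnorm _ (by simp) Q hJ
  have hδ' : δ = 0 ∨ δ = 1 ∧ ∃ r, lo ≤ r ∧ r < Q ∧ color g (u, !b') r = false ∧
      color g (u, !b') (r + 1) = true := by
    refine hδ.imp_right fun ⟨h1, y, hy, Q1, hQ1, h2⟩ => ⟨h1, ?_⟩
    obtain rfl : (t, b') = y := by simpa using hy
    rwa [hQ1.unique hJ] at h2
  by_cases hn : ∀ y ∈ W.head?, ∀ Q', Junction (color g (t, b')) (color g y) Q' → -Q ≤ Q'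
  · obtain ⟨k, h1, h2⟩ := next (u, !b') (t, b') W Q (by simpa using hm) hW hr hA hJ hn
    refine ⟨k + δ, Path.step δ (hc _) (hc _) (hrise _) (hgap _) hJ hloQ hδ' ?_, by omega⟩
    rw [flip_frameSet, flip_frameSet, Bool.not_not]
    exact h1
  rcases W with _ | ⟨w, W⟩
  · simp at hn
  have a2 := (List.isChain_cons_cons.1 hW').1
  obtain ⟨v, b''⟩ := w
  obtain rfl : b'' = !b' := Bool.eq_not_of_ne a2.2.symm
  simp only [List.head?_cons, Option.mem_def, Option.some.injEq, forall_eq'] at hn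
  push Not at hn
  obtain ⟨Q', hJ', hlt⟩ := hn
  have rv := hr (v, !b') (by simp)
  have key := normal_or_isMax g a1.1 a2.1 ru rt rv hA.1 hJ hJ'
  have hmax := key.1.resolve_left (not_le.2 hlt)
  obtain ⟨e1, e2, e3⟩ := key.2.2 hmax
  -- A triple counted by `R` has a rise, which would put the junctions in order; so nothing is lost
  -- by skipping a letter.
  have hnR : ¬ R (u, !b') (t, b') (v, !b') := by
    intro h
    obtain ⟨r, h1, h2, -⟩ := hR u t v b' a1.1 a2.1 ru rt rv hA.1 h _ _ hJ hJ'
    omega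
  have hn' : ∀ y ∈ W.head?, ∀ Q'', Junction (color g (v, !b')) (color g y) Q'' → -Q' ≤ Q'' := by
    rcases W with _ | ⟨⟨z, d⟩, W⟩
    · simp
    simp only [List.head?_cons, Option.mem_def, Option.some.injEq, forall_eq']
    intro Q'' hJ''
    have a3 := (List.isChain_cons_cons.1 (List.isChain_cons_cons.1 hW').2).1
    obtain rfl : d = b' := by
      have := a3.2
      revert this
      cases b' <;> cases d <;> simp
    have h := (normal_or_isMax g (b := !d) a2.1 a3.1 rt rv (hr (z, d) (by simp))
      (by simpa using hA.2.1) (by simpa using hJ') (by simpa using hJ'')).1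
    refine h.resolve_right fun h => ?_
    unfold IsMax at h hmax
    simp only at h hmax
    rcases d <;> simp at h hmax <;> omega
  obtain ⟨k, h1, h2⟩ := next (t, b') (v, !b') W Q' (by simp at hm; omega) hW'
    (fun a ha => hr a (List.mem_cons_of_mem _ ha)) hA.2 hJ' hn'
  have hcount : countTriples R ((u, !b') :: (t, b') :: (v, !b') :: W) =
      countTriples R ((t, b') :: (v, !b') :: W) := by
    rw [countTriples, if_neg hnR, zero_add]
  -- Here `Q + Q' ≤ -1`. In the case of equality the middle path keeps just the crossing of the gap
  -- `Q'`; below it, nothing is left of that path.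
  by_cases hQ : Q + Q' = -1
  · refine ⟨k + δ, Path.step δ (hc _) (hc _) (hrise _) (hgap _) hJ hloQ hδ' ?_, ?_⟩
    · rw [flip_frameSet, flip_frameSet, Bool.not_not, show -Q = Q' + 1 by omega]
      refine Path.single (hc _) (hc _) (hrise _) (hgap _) hJ' e1 ?_ ?_
      · rw [← show -Q = Q' + 1 by omega]
        exact e2
      · rw [flip_frameSet, flip_frameSet]
        exact h1
    · rw [hcount]
      omega
  · refine ⟨k + δ, Path.skip δ (hc _) (hc _) (hc _) (hrise _) (hgap _) hJ hJ' hloQ (by omega) e3 hδ'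
      h1, ?_⟩
    rw [hcount]
    omega

/-- The action of the permutation braid of `g` on words in gaps. -/
def permHom (g : Equiv.Perm (Fin n)) : FreeGroup ℤ →* FreeGroup ℤ :=
  FreeGroup.lift fun t => FreeGroup.mk (runTo (baseColor g t) (-(n + 1)) (n + 1))

/-- The point of view of a letter. -/
def frameHom (b : Bool) : FreeGroup ℤ →* FreeGroup ℤ := if b then MonoidHom.id _ else flipHom

lemma flipHom_frameHom (b : Bool) (x : FreeGroup ℤ) : flipHom (frameHom b x) = frameHom (!b) x := by
  rcases b <;> simp [frameHom, flipHom_flipHom]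

lemma mk_runTo_color (g : Equiv.Perm (Fin n)) (x : ℤ × Bool) :
    FreeGroup.mk (runTo (color g x) (-(n + 1)) (n + 1)) =
      frameHom x.2 (permHom g (FreeGroup.mk [x])) := by
  obtain ⟨t, b⟩ := x
  have h : permHom g (FreeGroup.mk [(t, true)]) =
      FreeGroup.mk (runTo (baseColor g t) (-(n + 1)) (n + 1)) := by
    simp [permHom]
  rcases b
  · have e : (FreeGroup.mk [(t, false)] : FreeGroup ℤ) = (FreeGroup.mk [(t, true)])⁻¹ := by
      simp [FreeGroup.inv_mk, FreeGroup.invRev]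
    have h2 := mk_runTo_mul_flip (baseColor g t) (y := -((n : ℤ) + 1)) (e := n + 1) (by omega)
    rw [← flipHom_mk, neg_neg] at h2
    rw [e, map_inv, h, eq_inv_of_mul_eq_one_left h2, inv_inv]
    simp [frameHom, color, flipHom_flipHom]
  · simp [frameHom, color, h]

lemma mk_runTo_mul_tailValue (g : Equiv.Perm (Fin n)) (x : ℤ × Bool) (W : List (ℤ × Bool))
    (hW : Alternating (x :: W)) :
    FreeGroup.mk (runTo (color g x) (-(n + 1)) (n + 1)) * tailValue (n + 1) (W.map (color g)) =
      frameHom x.2 (permHom g (FreeGroup.mk (x :: W))) := by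
  induction W generalizing x with
  | nil => simp only [List.map_nil, tailValue, mul_one, mk_runTo_color]
  | cons y W ih =>
    have hW' := List.isChain_cons_cons.1 hW
    have e : y.2 = !x.2 := by
      have := hW'.1.2
      revert this
      cases x.2 <;> cases y.2 <;> simp
    rw [List.map_cons, tailValue, ih y hW'.2, flipHom_frameHom, e, Bool.not_not, mk_runTo_color,
      mk_cons x (y :: W), map_mul, map_mul]

theorem exists_image (g : Equiv.Perm (Fin n)) (R : ℤ × Bool → ℤ × Bool → ℤ × Bool → Prop)
    [∀ z y w, Decidable (R z y w)] (hR : RiseRelation g R) (W : List (ℤ × Bool))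
    (hW : Alternating W) (hr : ∀ a ∈ W, 0 ≤ a.1 ∧ a.1 ≤ n) (hA : MinIn (startAscents g) W) :
    ∃ O, permHom g (FreeGroup.mk W) = FreeGroup.mk O ∧ Alternating O ∧
      (∀ a ∈ O, 0 ≤ a.1 ∧ a.1 ≤ n) ∧ MinIn (endAscents g) O ∧ countTriples R W ≤ numMin O + 1 := by
  rcases W with _ | ⟨x, W⟩
  · exact ⟨[], map_one _, by simp [Alternating], by simp, trivial, by simp [countTriples]⟩
  obtain ⟨k, hP, hk⟩ := exists_path g R hR W.length x W le_rfl hW hr hA (-n) 0 (by omega)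
    (fun y _ Q hQ => by
      have := hQ.lt (isColoring_color g x) (isColoring_color g y)
      omega) (Or.inl rfl)
  obtain ⟨O, hO, hred, hG⟩ := hP.exists_reduced
  rw [show -(n : ℤ) - 1 = -(n + 1) by ring, mk_runTo_mul_tailValue g x W hW] at hO
  -- The artificial letter in front, beyond all gaps in use, makes `Reduced.tight` applicable.
  -- Dropping it again costs at most one minimum, whence the `+ 1` in the statement.
  obtain ⟨k', hT, hk'⟩ := (hred.tight (-n - 2, false) (by
      rw [(isColoring_color g x (-n - 1)).1 (by omega)]) (by simp) (by simp)).tail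
  rcases hx : x.2 with _ | _
  · rw [hx] at hO hG hT
    have hT' := (tight_map_flip (endAscents g) k' O).2 hT
    refine ⟨O.map flip, ?_, hT'.alternating, ?_, hT'.minIn, by have := hT'.le_numMin; omega⟩
    · rw [← flipHom_mk, ← hO]
      simp [frameHom, flipHom_flipHom]
    · intro a ha
      obtain ⟨a', ha', rfl⟩ := List.mem_map.1 ha
      exact hG a' ha'
  · rw [hx] at hO hG hT
    exact ⟨O, by simpa [frameHom] using hO, hT.alternating, hG, hT.minIn, by have := hT.le_numMin; omega⟩

end GapWord

/-! ### Local minima under left weighted products. -/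

namespace GapWord

open Braid

variable {n : ℕ}

/-- The action of a product of permutation braids, the first one acting first. -/
def permHomProd : List (Equiv.Perm (Fin n)) → FreeGroup ℤ →* FreeGroup ℤ
  | [] => MonoidHom.id _
  | f :: F => (permHomProd F).comp (permHom f)

lemma MinIn.mono {A B : Set ℤ} (hAB : A ⊆ B) : ∀ {l : List (ℤ × Bool)}, MinIn A l → MinIn B l
  | _ :: _ :: _ :: _, h => ⟨fun hm => hAB (h.1 hm), MinIn.mono hAB h.2⟩
  | [_, _], _ => trivial
  | [_], _ => trivial
  | [], _ => trivial

lemma endAscents_subset {f g : Equiv.Perm (Fin n)} (h : LeftWeighted f g) :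
    endAscents f ⊆ startAscents g := by
  intro y hy s hs
  by_contra hlt
  have h1 := hy s hs
  have hne : g (leftPos s) ≠ g (rightPos s) := fun e => leftPos_ne_rightPos s (g.injective e)
  have h2 := h s (lt_of_le_of_ne (not_lt.1 hlt) hne.symm)
  exact lt_asymm h1 h2

/-- The minima of the image under a factor lie in its `endAscents`, which by left weightedness are
`startAscents` of the next factor. So `exists_image` can be iterated, losing one minimum per factor.
-/
lemma exists_image_prod (F : List (Equiv.Perm (Fin n))) (hF : F.IsChain LeftWeighted)
    (W : List (ℤ × Bool)) (hW : Alternating W) (hr : ∀ a ∈ W, 0 ≤ a.1 ∧ a.1 ≤ n)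
    (hA : ∀ f ∈ F.head?, MinIn (startAscents f) W) :
    ∃ O, permHomProd F (FreeGroup.mk W) = FreeGroup.mk O ∧ Alternating O ∧
      numMin W ≤ numMin O + F.length := by
  induction F generalizing W with
  | nil => exact ⟨W, rfl, hW, le_rfl⟩
  | cons f F ih =>
    obtain ⟨O, h1, h2, h3, h4, h5⟩ := exists_image f IsMin (riseRelation_isMin f) W hW hr (hA f rfl)
    obtain ⟨O', h6, h7, h8⟩ := ih hF.tail O h2 h3 (by
      rcases F with _ | ⟨f', F⟩
      · simp
      · simp only [List.head?_cons, Option.mem_def, Option.some.injEq, forall_eq']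
        exact h4.mono (endAscents_subset (List.isChain_cons_cons.1 hF).1))
    refine ⟨O', ?_, h7, ?_⟩
    · rw [permHomProd, MonoidHom.comp_apply, h1, h6]
    · have h5' : numMin W ≤ numMin O + 1 := h5
      rw [List.length_cons]
      omega

/-- The word `(x y)^N`. -/
def altWord (x y : ℤ × Bool) : ℕ → List (ℤ × Bool)
  | 0 => []
  | N + 1 => x :: y :: altWord x y N

lemma mk_altWord (x y : ℤ × Bool) (N : ℕ) :
    FreeGroup.mk (altWord x y N) = FreeGroup.mk [x, y] ^ N := by
  induction N with
  | zero => rfl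
  | succ N ih => rw [altWord, pow_succ', ← ih, ← mk_append]; rfl

lemma alternating_altWord {x y : ℤ × Bool} (h : x.1 ≠ y.1 ∧ x.2 ≠ y.2) (N : ℕ) :
    Alternating (altWord x y N) := by
  induction N with
  | zero => simp [altWord, Alternating]
  | succ N ih =>
    rcases N with _ | N
    · simpa [altWord, Alternating] using h
    · exact List.IsChain.cons_cons h (List.IsChain.cons_cons ⟨h.1.symm, h.2.symm⟩ ih)

lemma mem_altWord {x y a : ℤ × Bool} {N : ℕ} (h : a ∈ altWord x y N) : a = x ∨ a = y := by
  induction N with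
  | zero => simp [altWord] at h
  | succ N ih =>
    simp only [altWord, List.mem_cons] at h
    tauto

lemma not_isMin_self (x y : ℤ × Bool) : ¬ IsMin x y x := by
  unfold IsMin
  omega

lemma minIn_altWord (A : Set ℤ) (x y : ℤ × Bool) (N : ℕ) : MinIn A (altWord x y N) := by
  induction N with
  | zero => trivial
  | succ N ih =>
    rcases N with _ | N
    · trivial
    · exact ⟨fun h => absurd h (not_isMin_self _ _), fun h => absurd h (not_isMin_self _ _), ih⟩

lemma numMin_altWord (x y : ℤ × Bool) (N : ℕ) : numMin (altWord x y N) = 0 := by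
  induction N with
  | zero => rfl
  | succ N ih =>
    rcases N with _ | N
    · rfl
    · have : numMin (altWord x y (N + 1 + 1)) = (if IsMin x y x then 1 else 0) +
          ((if IsMin y x y then 1 else 0) + numMin (altWord x y (N + 1))) := rfl
      rw [this, if_neg (not_isMin_self _ _), if_neg (not_isMin_self _ _), ih]

lemma le_countTriples_altWord {R : ℤ × Bool → ℤ × Bool → ℤ × Bool → Prop}
    [∀ z y w, Decidable (R z y w)] {x y : ℤ × Bool} (h : R x y x ∨ R y x y) (N : ℕ) :
    N ≤ countTriples R (altWord x y N) + 1 := by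
  induction N with
  | zero => omega
  | succ N ih =>
    rcases N with _ | N
    · simp
    · have : countTriples R (altWord x y (N + 1 + 1)) = (if R x y x then 1 else 0) +
          ((if R y x y then 1 else 0) + countTriples R (altWord x y (N + 1))) := rfl
      rw [this]
      rcases h with h | h
      · rw [if_pos h]
        omega
      · rw [if_pos h]
        omega

/-- In a triple `u, t, u` both junctions are extreme ends of the same set of strands, those between
`u` and `t`. So the ends of `x1` and `x2` lie within the surviving stretch, and the colours at `l`
and `x2` force a rise there. -/
lemma riseRelation_of_between (g : Equiv.Perm (Fin n)) {u t : ℤ} {b : Bool} {l x1 x2 : Fin n}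
    (h1 : Between u t x1) (h2 : Between u t x2) (h3 : strandPoint g b x1 ≤ strandPoint g b l)
    (h4 : strandPoint g b l < strandPoint g b x2) (h5 : color g (t, b) (strandPoint g b l) = false)
    (h6 : color g (t, b) (strandPoint g b x2) = true) :
    RiseRelation g fun z y w => z.1 = u ∧ y = (t, b) ∧ w.1 = u := by
  rintro u' t' v' b' hut htv hu ht hv - ⟨e1, e2, e3⟩ Q Q' hQ hQ'
  simp only at e1 e3
  subst e1 e3
  obtain ⟨rfl, rfl⟩ := Prod.mk.injEq .. ▸ e2
  obtain ⟨l1, -, hJ1, hm1⟩ := exists_junction g (!b') hut hu ht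
  rw [Bool.not_not] at hJ1
  obtain ⟨l2, -, hJ2, hm2⟩ := exists_junction g b' htv ht hv
  obtain rfl := hQ.unique hJ1
  obtain rfl := hQ'.unique hJ2
  have a1 := hm1 x1 h1
  have a2 := hm2 x2 (Or.symm h2)
  rw [strandPoint_not] at a1
  obtain ⟨r, b1, b2, b3⟩ := exists_rise h4 h5 h6
  exact ⟨r, by omega, by omega, b3⟩

/-- The strands that start in an interval are not adjacent in the end. -/
def Separates (g : Equiv.Perm (Fin n)) (c e : ℤ) : Prop :=
  ∃ l x1 x2 : Fin n, ¬ (c ≤ l.1 ∧ (l.1 : ℤ) < e) ∧ (c ≤ x1.1 ∧ (x1.1 : ℤ) < e) ∧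
    (c ≤ x2.1 ∧ (x2.1 : ℤ) < e) ∧ g x1 < g l ∧ g l < g x2

/-- The foreign strand `l` starts to the left of `c` or to the right of `e`. In the first case the
triples around `c` get a rise, in the second case those around `e`, where the order of `x1` and `x2`
is reversed by the rotation. -/
lemma exists_riseRelation {g : Equiv.Perm (Fin n)} {c e : ℤ} (h : Separates g c e) :
    ∃ R : ℤ × Bool → ℤ × Bool → ℤ × Bool → Prop, RiseRelation g R ∧
      (R (c, true) (e, false) (c, true) ∨ R (e, false) (c, true) (e, false)) := by
  obtain ⟨l, x1, x2, hl, h1, h2, h3, h4⟩ := h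
  rw [Fin.lt_def] at h3 h4
  by_cases hlc : (l.1 : ℤ) < c
  · refine ⟨_, riseRelation_of_between g (u := e) (t := c) (b := true) (l := l) (x1 := x1) (x2 := x2)
      (Or.inr h1) (Or.inr h2) ?_ ?_ ?_ ?_, Or.inr ⟨rfl, rfl, rfl⟩⟩
    · simp only [strandPoint, if_true]
      omega
    · simp only [strandPoint, if_true]
      omega
    · rw [color_strandPoint]
      simpa using hlc
    · rw [color_strandPoint]
      simpa using h2.1
  · refine ⟨_, riseRelation_of_between g (u := c) (t := e) (b := false) (l := l) (x1 := x2)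
      (x2 := x1) (Or.inl h2) (Or.inl h1) ?_ ?_ ?_ ?_, Or.inl ⟨rfl, rfl, rfl⟩⟩
    · simp only [strandPoint, Bool.false_eq_true, if_false]
      omega
    · simp only [strandPoint, Bool.false_eq_true, if_false]
      omega
    · rw [color_strandPoint]
      simp only [Bool.false_eq_true, if_false, decide_eq_false_iff_not]
      omega
    · rw [color_strandPoint]
      simpa using h1.2

/-- The word `(c e⁻¹)^N` has no minima, but at least `N - 1` triples whose middle path contains a
rise, which `f` turns into minima. The loss is one for `f` and one for each factor of `F`. -/
theorem exists_image_pow (f : Equiv.Perm (Fin n)) (F : List (Equiv.Perm (Fin n)))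
    (hF : (f :: F).IsChain LeftWeighted) {c e : ℤ} (hce : c < e) (hc : 0 ≤ c) (he : e ≤ n)
    (h : Separates f c e) (N : ℕ) :
    ∃ O, permHomProd (f :: F) ((FreeGroup.of c * (FreeGroup.of e)⁻¹) ^ N) = FreeGroup.mk O ∧
      Alternating O ∧ N ≤ numMin O + F.length + 2 := by
  classical
  obtain ⟨R, hR, hR'⟩ := exists_riseRelation h
  have hW := alternating_altWord (x := (c, true)) (y := (e, false)) ⟨hce.ne, by simp⟩ N
  obtain ⟨O, h1, h2, h3, h4, h5⟩ := exists_image f R hR _ hW (by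
    intro a ha
    rcases mem_altWord ha with rfl | rfl <;> simp only <;> omega) (minIn_altWord _ _ _ N)
  obtain ⟨O', h6, h7, h8⟩ := exists_image_prod F hF.tail O h2 h3 (by
      rcases F with _ | ⟨f', F⟩
      · simp
      · simp only [List.head?_cons, Option.mem_def, Option.some.injEq, forall_eq']
        exact h4.mono (endAscents_subset (List.isChain_cons_cons.1 hF).1))
  have h9 := le_countTriples_altWord hR' N
  refine ⟨O', ?_, h7, by omega⟩
  rw [← h6, ← h1, permHomProd, MonoidHom.comp_apply, mk_altWord]
  rfl

/-! ### Local minima and free reduction -/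

lemma Alternating.isReduced {l : List (ℤ × Bool)} (h : Alternating l) : FreeGroup.IsReduced l :=
  List.IsChain.imp (fun _ _ hab e => absurd e hab.1) h

lemma countTriples_append (R : ℤ × Bool → ℤ × Bool → ℤ × Bool → Prop)
    [∀ z y w, Decidable (R z y w)] (z y w : ℤ × Bool) : ∀ l : List (ℤ × Bool),
    countTriples R (l ++ [z, y, w]) = countTriples R (l ++ [z, y]) + if R z y w then 1 else 0
  | [] => by simp [countTriples]
  | [a] => by simp [countTriples]
  | [a, b] => by simp [countTriples, add_assoc]
  | a :: b :: c :: l => by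
    have := countTriples_append R z y w (b :: c :: l)
    simp only [List.cons_append, countTriples] at this ⊢
    rw [this, add_assoc]

lemma numMin_invRev : ∀ l : List (ℤ × Bool), numMin (FreeGroup.invRev l) = numMin l
  | z :: y :: w :: l => by
    have ih := numMin_invRev (y :: w :: l)
    have e : IsMin (w.1, !w.2) (y.1, !y.2) (z.1, !z.2) ↔ IsMin z y w := by
      unfold IsMin
      rcases y with ⟨y, _ | _⟩ <;> simp [and_comm]
    simp only [FreeGroup.invRev, List.map_cons, List.reverse_cons, List.append_assoc,
      List.cons_append, List.nil_append, numMin] at ih ⊢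
    rw [countTriples_append, ih]
    simp only [e, countTriples]
    ring
  | [_, _] => rfl
  | [_] => rfl
  | [] => rfl

lemma numMin_toWord_inv (x : FreeGroup ℤ) : numMin x⁻¹.toWord = numMin x.toWord := by
  rw [FreeGroup.toWord_inv, numMin_invRev]

/-- A letter multiplied from the left is put in front of the reduced word or cancels its first
letter, which creates at most one triple. -/
lemma numMin_toWord_mk_mul (L : List (ℤ × Bool)) (x : FreeGroup ℤ) :
    numMin (FreeGroup.mk L * x).toWord ≤ numMin x.toWord + L.length := by
  induction L with
  | nil =>
    rw [← FreeGroup.one_eq_mk, one_mul]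
    exact le_rfl
  | cons a L ih =>
    rw [mk_cons, mul_assoc]
    generalize FreeGroup.mk L * x = y at ih ⊢
    have e : (FreeGroup.mk [a] * y).toWord = FreeGroup.reduce (a :: y.toWord) := by
      conv_lhs => rw [← FreeGroup.mk_toWord (x := y), ← mk_append, FreeGroup.toWord_mk]
      rfl
    rw [e, FreeGroup.reduce.cons, FreeGroup.reduce_toWord, List.length_cons]
    generalize y.toWord = Y at ih ⊢
    rcases Y with _ | ⟨h, Y⟩
    · simp [numMin, countTriples]
    · simp only
      split_ifs
      · have := countTriples_cons_ge IsMin h Y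
        simp only [numMin] at ih ⊢
        omega
      · have := countTriples_cons_le IsMin a (h :: Y)
        simp only [numMin] at ih ⊢
        omega

lemma numMin_toWord_conj (w x : FreeGroup ℤ) :
    numMin (w * x * w⁻¹).toWord ≤ numMin x.toWord + 2 * w.toWord.length := by
  have h : ∀ y, numMin (w * y).toWord ≤ numMin y.toWord + w.toWord.length := fun y => by
    have := numMin_toWord_mk_mul w.toWord y
    rwa [FreeGroup.mk_toWord] at this
  have h1 := h (x * w⁻¹)
  have h2 := h x⁻¹
  rw [← numMin_toWord_inv (w * x⁻¹), numMin_toWord_inv x, mul_inv_rev, inv_inv] at h2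
  rw [mul_assoc]
  omega

lemma numMin_toWord_pow {c e : ℤ} (hce : c ≠ e) (N : ℕ) :
    numMin ((FreeGroup.of c * (FreeGroup.of e)⁻¹) ^ N).toWord = 0 := by
  have h : (FreeGroup.of c * (FreeGroup.of e)⁻¹) ^ N =
      FreeGroup.mk (altWord (c, true) (e, false) N) := by
    rw [mk_altWord]
    rfl
  rw [h, FreeGroup.toWord_mk,
    (alternating_altWord (x := (c, true)) (y := (e, false)) ⟨hce, by simp⟩ N).isReduced.reduce_eq,
    numMin_altWord]

/-- Compare `N`-th powers. On the left the number of minima is at least `N - |F| - 2`. On the right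
it is at most `2|w|`, as a power of `c' e'⁻¹` has none. The exponent used is the first one with a
contradiction. -/
theorem not_conj_of_separates (f : Equiv.Perm (Fin n)) (F : List (Equiv.Perm (Fin n)))
    (hF : (f :: F).IsChain LeftWeighted) {c e c' e' : ℤ} (hce : c < e) (hc : 0 ≤ c) (he : e ≤ n)
    (h : Separates f c e) (hce' : c' ≠ e') (w : FreeGroup ℤ) :
    permHomProd (f :: F) (FreeGroup.of c * (FreeGroup.of e)⁻¹) ≠
      w * (FreeGroup.of c' * (FreeGroup.of e')⁻¹) * w⁻¹ := by
  intro heq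
  obtain ⟨O, h1, h2, h3⟩ := exists_image_pow f F hF hce hc he h
    (2 * w.toWord.length + F.length + 3)
  rw [map_pow, heq, conj_pow] at h1
  have h4 := numMin_toWord_conj w ((FreeGroup.of c' * (FreeGroup.of e')⁻¹) ^
    (2 * w.toWord.length + F.length + 3))
  rw [h1, numMin_toWord_pow hce', FreeGroup.toWord_mk, h2.isReduced.reduce_eq] at h4
  omega

end GapWord

/-! ### From Artin's representation to words in gaps. -/

namespace GapWord

open Braid

variable {n : ℕ}

/-- The embedding of the fundamental group which records the gaps crossed by a loop: the loop
around the puncture `k` crosses the gaps on both sides of it. -/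
def gapHom (n : ℕ) : FreeGroup (Fin n) →* FreeGroup ℤ :=
  FreeGroup.lift fun k => FreeGroup.of (k.1 : ℤ) * (FreeGroup.of ((k.1 : ℤ) + 1))⁻¹

/-- The action of an Artin generator on words in gaps. -/
def twistHom (s : ℤ) : FreeGroup ℤ →* FreeGroup ℤ :=
  FreeGroup.lift fun t =>
    if t = s + 1 then FreeGroup.of s * (FreeGroup.of (s + 1))⁻¹ * FreeGroup.of (s + 2)
    else FreeGroup.of t

lemma twistHom_of_ne {s t : ℤ} (h : t ≠ s + 1) : twistHom s (FreeGroup.of t) = FreeGroup.of t := by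
  simp [twistHom, h]

lemma twistHom_of_self (s : ℤ) : twistHom s (FreeGroup.of (s + 1)) =
    FreeGroup.of s * (FreeGroup.of (s + 1))⁻¹ * FreeGroup.of (s + 2) := by
  simp [twistHom]

/-- Among the vertical paths only the one between the two exchanged punctures is moved, so
`twistHom` changes a single generator. The intertwining is checked on the loops around the
punctures. -/
lemma gapHom_artinAut (s : Fin (n - 1)) (x : FreeGroup (Fin n)) :
    gapHom n (artinAut s x) = twistHom s.1 (gapHom n x) := by
  have h : (gapHom n).comp (artinAut s).toMonoidHom = (twistHom s.1).comp (gapHom n) := by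
    ext k
    have el : (((leftPos s).1 : ℕ) : ℤ) = s.1 := rfl
    have er : (((rightPos s).1 : ℕ) : ℤ) = s.1 + 1 := by simp [rightPos]
    simp only [MonoidHom.comp_apply, MulEquiv.coe_toMonoidHom, artinAut_of, artinFun]
    have h2 : (s.1 : ℤ) + 1 + 1 = s.1 + 2 := by ring
    split_ifs with h1 h3
    · subst h1
      simp only [gapHom, map_mul, map_inv, FreeGroup.lift_apply_of, el, er, twistHom_of_self, h2]
      rw [twistHom_of_ne (by omega)]
      group
    · subst h3
      simp only [gapHom, map_mul, map_inv, FreeGroup.lift_apply_of, el, er, twistHom_of_self, h2]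
      rw [twistHom_of_ne (by omega)]
      group
    · have h4 : k.1 ≠ s.1 := fun e => h1 (Fin.ext e)
      have h5 : k.1 ≠ s.1 + 1 := fun e => h3 (Fin.ext e)
      simp only [gapHom, map_mul, map_inv, FreeGroup.lift_apply_of]
      rw [twistHom_of_ne (by omega), twistHom_of_ne (by omega)]
  exact DFunLike.congr_fun h x

lemma twistHom_mk {s : ℤ} {l : List (ℤ × Bool)} (h : ∀ a ∈ l, a.1 ≠ s + 1) :
    twistHom s (FreeGroup.mk l) = FreeGroup.mk l := by
  induction l with
  | nil => exact map_one _
  | cons a l ih =>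
    rw [mk_cons, map_mul, ih fun b hb => h b (List.mem_cons_of_mem _ hb)]
    congr 1
    have h1 := h a (by simp)
    obtain ⟨t, _ | _⟩ := a
    · have : (FreeGroup.mk [(t, false)] : FreeGroup ℤ) = (FreeGroup.of t)⁻¹ := rfl
      rw [this, map_inv, twistHom_of_ne h1]
    · exact twistHom_of_ne h1

lemma mem_runTo_range {c : ℤ → Bool} {y e : ℤ} {a : ℤ × Bool} (h : a ∈ runTo c y e) :
    y ≤ a.1 ∧ a.1 < e := by
  have hm : ∀ m : ℕ, ∀ y, a ∈ run c y m → y ≤ a.1 ∧ a.1 < y + m := by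
    intro m
    induction m with
    | zero => intro y h; simp [run] at h
    | succ m ih =>
      intro y h
      rw [run, List.mem_append] at h
      push_cast
      rcases h with h | h
      · split_ifs at h with hc
        · simp at h
        · rw [List.mem_singleton.1 h]
          simp only
          omega
      · have := ih (y + 1) h
        omega
  have := hm _ y h
  rcases le_or_gt y e with he | he <;> omega

lemma runTo_three (c : ℤ → Bool) (s : ℤ) : runTo c s (s + 3) =
    (if c s = c (s + 1) then [] else [(s, c (s + 1))]) ++
    ((if c (s + 1) = c (s + 2) then [] else [(s + 1, c (s + 2))]) ++
    (if c (s + 2) = c (s + 3) then [] else [(s + 2, c (s + 3))])) := by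
  rw [runTo_succ c (by omega), runTo_succ c (by omega), runTo_succ c (by omega),
    show s + 1 + 1 + 1 = s + 3 by ring, runTo_self, show s + 1 + 1 = s + 2 by ring,
    List.append_nil]

/-- Only the gaps `s`, `s + 1` and `s + 2` are affected, which leaves the possible colours of four
points to be checked. The hypothesis `hc` excludes exchanging the points back: there the image would
not be the monotone path of `d`. -/
lemma twistHom_runTo {c d : ℤ → Bool} {s y e : ℤ} (hy : y ≤ s) (he : s + 3 ≤ e)
    (h1 : d (s + 1) = c (s + 2)) (h2 : d (s + 2) = c (s + 1))
    (hd : ∀ k, k ≠ s + 1 → k ≠ s + 2 → d k = c k) (hc : c (s + 1) = true → c (s + 2) = true) :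
    twistHom s (FreeGroup.mk (runTo c y e)) = FreeGroup.mk (runTo d y e) := by
  have e1 : runTo d y s = runTo c y s := runTo_congr fun k _ _ => hd k (by omega) (by omega)
  have e2 : runTo d (s + 3) e = runTo c (s + 3) e :=
    runTo_congr fun k _ _ => hd k (by omega) (by omega)
  have f1 := twistHom_mk (s := s) (l := runTo c y s) fun a ha => by
    have := mem_runTo_range ha
    omega
  have f2 := twistHom_mk (s := s) (l := runTo c (s + 3) e) fun a ha => by
    have := mem_runTo_range ha
    omega
  rw [runTo_append c hy (by omega : s ≤ e), runTo_append d hy (by omega : s ≤ e),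
    runTo_append c (by omega : s ≤ s + 3) he, runTo_append d (by omega : s ≤ s + 3) he,
    mk_append, mk_append, mk_append, mk_append, map_mul, map_mul, f1, f2, e1, e2]
  congr 2
  rw [runTo_three, runTo_three, h1, h2, hd s (by omega) (by omega), hd (s + 3) (by omega) (by omega)]
  have g0 := twistHom_of_ne (s := s) (t := s) (by omega)
  have g1 := twistHom_of_self s
  have g2 := twistHom_of_ne (s := s) (t := s + 2) (by omega)
  have hT : ∀ t : ℤ, (FreeGroup.mk [(t, true)] : FreeGroup ℤ) = FreeGroup.of t := fun _ => rfl
  have hF : ∀ t : ℤ, (FreeGroup.mk [(t, false)] : FreeGroup ℤ) = (FreeGroup.of t)⁻¹ := fun _ => rfl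
  have h0 : (FreeGroup.mk [] : FreeGroup ℤ) = 1 := rfl
  revert hc
  rcases c s <;> rcases c (s + 1) <;> rcases c (s + 2) <;> rcases c (s + 3) <;>
    simp only [mk_append, map_mul, map_inv, map_one, hT, hF, h0, g0, g1, g2, if_true, if_false,
      Bool.false_eq_true, Bool.true_eq_false, IsEmpty.forall_iff, forall_const, one_mul, mul_one] <;>
    group

lemma permHom_swapEnds (f : Equiv.Perm (Fin n)) (s : Fin (n - 1))
    (h : f.symm (leftPos s) < f.symm (rightPos s)) (x : FreeGroup ℤ) :
    permHom (swapEnds s f) x = twistHom s.1 (permHom f x) := by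
  have hh : permHom (swapEnds s f) = (twistHom s.1).comp (permHom f) := by
    ext t
    simp only [permHom, MonoidHom.comp_apply, FreeGroup.lift_apply_of]
    symm
    have hs := s.2
    have hl : ∀ g : Equiv.Perm (Fin n), baseColor g t (s.1 + 1) =
        decide (t ≤ (g.symm (leftPos s)).1) := fun g => by
      have := baseColor_strandPoint g t (g.symm (leftPos s))
      rwa [Equiv.apply_symm_apply] at this
    have hr : ∀ g : Equiv.Perm (Fin n), baseColor g t (s.1 + 2) =
        decide (t ≤ (g.symm (rightPos s)).1) := fun g => by
      have := baseColor_strandPoint g t (g.symm (rightPos s))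
      rw [Equiv.apply_symm_apply] at this
      rw [← this]
      congr 1
    rw [Fin.lt_def] at h
    refine twistHom_runTo (by omega) (by omega) ?_ ?_ ?_ ?_
    · rw [hl, hr, swapEnds_symm_left]
    · rw [hl, hr, swapEnds_symm_right]
    · intro k h1 h2
      unfold baseColor
      split_ifs with hk
      · have hq : Equiv.swap (leftPos s) (rightPos s) ⟨(k - 1).toNat, by omega⟩ =
            (⟨(k - 1).toNat, by omega⟩ : Fin n) := by
          apply Equiv.swap_apply_of_ne_of_ne <;> intro e <;> have := congrArg Fin.val e <;>
            simp [leftPos, rightPos] at this <;> omega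
        rw [swapEnds_symm, hq]
      · rfl
    · rw [hl, hr]
      simp only [decide_eq_true_eq]
      omega
  rw [hh, MonoidHom.comp_apply]

/-- The bounds are needed because `baseColor` has a fixed colour outside the points `1, …, n`. Loops
in the disk use only the gaps `0, …, n`. -/
lemma permHom_one {t : ℤ} (h0 : 0 ≤ t) (hn : t ≤ n) :
    permHom (1 : Equiv.Perm (Fin n)) (FreeGroup.of t) = FreeGroup.of t := by
  have hb : ∀ k, baseColor (1 : Equiv.Perm (Fin n)) t k = decide (t < k) := by
    intro k
    unfold baseColor
    split_ifs with hk
    · rw [decide_eq_decide]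
      change t ≤ (((k - 1).toNat : ℕ) : ℤ) ↔ _
      omega
    · rw [decide_eq_decide]
      omega
  rw [permHom, FreeGroup.lift_apply_of]
  have h1 : ∀ y e, (∀ k, y ≤ k → k < e → k ≠ t) →
      runTo (baseColor (1 : Equiv.Perm (Fin n)) t) y e = [] := by
    intro y e h
    refine List.eq_nil_iff_forall_not_mem.2 fun a ha => ?_
    have h2 := mem_runTo ha
    have h3 := mem_runTo_range ha
    have h4 := h a.1 h3.1 h3.2
    rw [hb, hb, Ne, decide_eq_decide] at h2
    omega
  rw [runTo_append _ (x := t) (by omega) (by omega), h1 _ _ (by intro k _ _; omega),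
    runTo_succ _ (by omega), h1 _ _ (by intro k _ _; omega), hb, hb]
  simp
  rfl

lemma permHom_one_gapHom (x : FreeGroup (Fin n)) :
    permHom (1 : Equiv.Perm (Fin n)) (gapHom n x) = gapHom n x := by
  have h : (permHom (1 : Equiv.Perm (Fin n))).comp (gapHom n) = gapHom n := by
    ext k
    have := k.2
    simp only [gapHom, MonoidHom.comp_apply, FreeGroup.lift_apply_of, map_mul, map_inv]
    rw [permHom_one (by omega) (by omega), permHom_one (by omega) (by omega)]
  exact DFunLike.congr_fun h x

lemma artinRep_mul (β γ : Braid n) (x : FreeGroup (Fin n)) :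
    (artinRep n (β * γ)).unop x = (artinRep n γ).unop ((artinRep n β).unop x) := by
  rw [map_mul, MulOpposite.unop_mul, MulAut.mul_apply]

lemma artinRep_σ (s : Fin (n - 1)) : (artinRep n (σ s)).unop = artinAut s := by
  rw [artinRep, σ, PresentedGroup.toGroup.of, MulOpposite.unop_op]

lemma gapHom_artinRep_permBraid (f : Equiv.Perm (Fin n)) (x : FreeGroup (Fin n)) :
    gapHom n ((artinRep n (permBraid f)).unop x) = permHom f (gapHom n x) := by
  obtain ⟨w, hw, h⟩ := exists_isReducedWord f
  clear h
  induction hw with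
  | nil =>
    rw [permBraid_one, map_one, permHom_one_gapHom]
    rfl
  | snoc s hw h ih =>
    rw [permBraid_swapEnds s _ h, artinRep_mul, artinRep_σ, gapHom_artinAut, ih,
      permHom_swapEnds _ s h]

lemma gapHom_artinRep_prod (F : List (Equiv.Perm (Fin n))) (x : FreeGroup (Fin n)) :
    gapHom n ((artinRep n (F.map permBraid).prod).unop x) = permHomProd F (gapHom n x) := by
  induction F generalizing x with
  | nil =>
    rw [List.map_nil, List.prod_nil, map_one]
    rfl
  | cons f F ih =>
    rw [List.map_cons, List.prod_cons, artinRep_mul, ih, gapHom_artinRep_permBraid, permHomProd,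
      MonoidHom.comp_apply]

/-- The product of the images of the loops telescopes: neighbouring loops share a gap. -/
lemma gapHom_curve (c e : Fin n) (hce : c ≤ e) :
    gapHom n (((List.finRange n).filter fun k => decide (c ≤ k ∧ k ≤ e)).map FreeGroup.of).prod =
      FreeGroup.of (c.1 : ℤ) * (FreeGroup.of ((e.1 : ℤ) + 1))⁻¹ := by
  let h : ℕ → FreeGroup ℤ := fun k =>
    if c.1 ≤ k ∧ k ≤ e.1 then FreeGroup.of (k : ℤ) * (FreeGroup.of ((k : ℤ) + 1))⁻¹ else 1
  have h1 : ∀ l : List (Fin n),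
      gapHom n ((l.filter fun k => decide (c ≤ k ∧ k ≤ e)).map FreeGroup.of).prod =
        ((l.map Fin.val).map h).prod := by
    intro l
    induction l with
    | nil => simp
    | cons k l ih =>
      rw [List.filter_cons]
      by_cases hk : c ≤ k ∧ k ≤ e
      · have hk' : c.1 ≤ k.1 ∧ k.1 ≤ e.1 := hk
        rw [if_pos (by simpa using hk), List.map_cons, List.prod_cons, map_mul, ih]
        simp only [List.map_cons, List.prod_cons, h, if_pos hk', gapHom, FreeGroup.lift_apply_of]
      · have hk' : ¬ (c.1 ≤ k.1 ∧ k.1 ≤ e.1) := hk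
        rw [if_neg (by simpa using hk), ih]
        simp only [List.map_cons, List.prod_cons, h, if_neg hk', one_mul]
  have h2 : ∀ m : ℕ, ((List.range m).map h).prod = if m ≤ c.1 then 1 else
      FreeGroup.of (c.1 : ℤ) * (FreeGroup.of ((min m (e.1 + 1) : ℕ) : ℤ))⁻¹ := by
    intro m
    induction m with
    | zero => simp
    | succ m ih =>
      have hce' : c.1 ≤ e.1 := hce
      rw [List.range_succ, List.map_append, List.prod_append, ih]
      simp only [List.map_cons, List.map_nil, List.prod_cons, List.prod_nil, mul_one, h]
      rcases lt_trichotomy m c.1 with hm | hm | hm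
      · rw [if_pos hm.le, if_neg (by omega), if_pos (by omega), one_mul]
      · rw [if_pos hm.le, if_pos (by omega), if_neg (by omega), one_mul, min_eq_left (by omega), hm]
        push_cast
        rfl
      · rw [if_neg (by omega), if_neg (show ¬ m + 1 ≤ c.1 by omega)]
        by_cases hme : m ≤ e.1
        · rw [if_pos (show c.1 ≤ m ∧ m ≤ e.1 by omega), min_eq_left (by omega), min_eq_left (by omega)]
          push_cast
          group
        · rw [if_neg (show ¬ (c.1 ≤ m ∧ m ≤ e.1) by omega), min_eq_right (by omega), min_eq_right (by omega), mul_one]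
  have hc := c.2
  have he := e.2
  rw [h1, List.map_coe_finRange_eq_range, h2, if_neg (by omega), min_eq_right (by omega)]
  push_cast
  rfl

/-- One circle of the family suffices: its image would be the curve of another standard circle, up
to conjugacy and orientation. Reversing the orientation exchanges `c'` and `e'`, which is why
`not_conj_of_separates` asks only that they differ. -/
theorem not_exists_isStandardReductionSystem (f : Equiv.Perm (Fin n))
    (F : List (Equiv.Perm (Fin n))) (hF : (f :: F).IsChain LeftWeighted)
    (hf : ∀ C : StandardCircle n, Separates f C.first.1 (C.last.1 + 1)) :
    ¬ ∃ 𝒞, IsStandardReductionSystem (((f :: F).map permBraid).prod) 𝒞 := by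
  rintro ⟨𝒞, h𝒞⟩
  obtain ⟨C, hC⟩ := h𝒞.nonempty
  have hmem := Set.mem_image_of_mem
    (fun C : StandardCircle n => actOnLoop (((f :: F).map permBraid).prod) C.curve) hC
  rw [h𝒞.preserved] at hmem
  obtain ⟨C', -, h⟩ := hmem
  have hlt : C.first.1 < C.last.1 := C.first_lt_last
  have hlt' : C'.first.1 < C'.last.1 := C'.first_lt_last
  have hlast := C.last.2
  have key := fun (c' e' : ℤ) => not_conj_of_separates f F hF (c := C.first.1) (e := C.last.1 + 1)
    (c' := c') (e' := e') (by omega) (by omega) (by omega) (hf C)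
  simp only [← gapHom_curve _ _ C.first_lt_last.le, ← gapHom_artinRep_prod] at key
  have h' := Quotient.exact h
  rcases h' with h' | h'
  · obtain ⟨w, hw⟩ := isConj_iff.1 h'
    have e := congrArg (gapHom n) hw
    rw [map_mul, map_mul, map_inv, gapHom_curve _ _ C'.first_lt_last.le] at e
    exact key _ _ (by omega) _ e.symm
  · obtain ⟨w, hw⟩ := isConj_iff.1 h'
    have e := congrArg (gapHom n) (congrArg (·⁻¹) hw)
    simp only [inv_inv] at e
    rw [conj_inv, map_mul, map_mul, map_inv (gapHom n) w, map_inv, gapHom_curve _ _ C'.first_lt_last.le,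
      mul_inv_rev, inv_inv] at e
    exact key _ _ (by omega) _ e.symm

end GapWord

/-! ### The permutations of binary rows -/

namespace BinaryBraid

open Braid GapWord

variable {p : ℕ}

/-- Rows that begin with `0` and end with `1`. -/
def IsAdmissible (a : Fin p → Fin 2) : Prop :=
  ∀ j : Fin p, (j.1 = 0 → a j = 0) ∧ (j.1 + 1 = p → a j = 1)

section Row

variable (a : Fin p → Fin 2)

lemma rowPerm_first (ha : IsAdmissible a) (hp : 2 ≤ p) {i : Fin (2 * p + 2)} (hi : i.1 = 0) :
    (rowPerm a i).1 = 2 := by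
  change (strandEnd a i).1 = 2
  rcases strandEnd_cases a i with ⟨h, e⟩ | ⟨h, e⟩ | ⟨j, h, -⟩ | ⟨j, h, -⟩ | ⟨j, h, -⟩ | ⟨j, h, -⟩
  any_goals omega
  rw [e]
  have h1 := nextZero_le a 0 ⟨0, by omega⟩ le_rfl ((ha _).1 rfl)
  simp only at h1
  rcases nextZero_mem a 0 with h2 | ⟨j, -, -, h2⟩ <;> omega

lemma rowPerm_last (ha : IsAdmissible a) (hp : 2 ≤ p) {i : Fin (2 * p + 2)} (hi : i.1 = 2 * p + 1) :
    (rowPerm a i).1 = 2 * p - 1 := by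
  change (strandEnd a i).1 = 2 * p - 1
  rcases strandEnd_cases a i with ⟨h, e⟩ | ⟨h, e⟩ | ⟨j, h, -⟩ | ⟨j, h, -⟩ | ⟨j, h, -⟩ | ⟨j, h, -⟩
  any_goals omega
  rw [e]
  have h1 := le_prevOne a p ⟨p - 1, by omega⟩ (by simp only; omega)
    ((ha _).2 (by simp only; omega))
  simp only at h1
  rcases prevOne_mem a p with h2 | ⟨j, -, -, h2⟩ <;> omega

lemma rowPerm_left (j : Fin p) {i : Fin (2 * p + 2)} (hi : i.1 = 2 * j.1 + 1) :
    (a j = 0 ∧ (rowPerm a i).1 = (nextZero a (j.1 + 1)).1) ∨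
      (a j = 1 ∧ (rowPerm a i).1 = 2 * j.1 + 2) := by
  change (a j = 0 ∧ (strandEnd a i).1 = _) ∨ (a j = 1 ∧ (strandEnd a i).1 = _)
  rcases strandEnd_cases a i with ⟨h, e⟩ | ⟨h, e⟩ | ⟨j', h, h', e⟩ | ⟨j', h, h', e⟩ |
    ⟨j', h, h', e⟩ | ⟨j', h, h', e⟩
  any_goals omega
  · obtain rfl : j' = j := Fin.ext (by omega)
    exact Or.inl ⟨h', by rw [e]⟩
  · obtain rfl : j' = j := Fin.ext (by omega)
    exact Or.inr ⟨h', e⟩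

lemma rowPerm_right (j : Fin p) {i : Fin (2 * p + 2)} (hi : i.1 = 2 * j.1 + 2) :
    (a j = 0 ∧ (rowPerm a i).1 = 2 * j.1 + 1) ∨
      (a j = 1 ∧ (rowPerm a i).1 = (prevOne a j.1).1) := by
  change (a j = 0 ∧ (strandEnd a i).1 = _) ∨ (a j = 1 ∧ (strandEnd a i).1 = _)
  rcases strandEnd_cases a i with ⟨h, e⟩ | ⟨h, e⟩ | ⟨j', h, h', e⟩ | ⟨j', h, h', e⟩ |
    ⟨j', h, h', e⟩ | ⟨j', h, h', e⟩
  any_goals omega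
  · obtain rfl : j' = j := Fin.ext (by omega)
    exact Or.inl ⟨h', e⟩
  · obtain rfl : j' = j := Fin.ext (by omega)
    exact Or.inr ⟨h', by rw [e]⟩

lemma lt_rowPerm_left (j : Fin p) {i : Fin (2 * p + 2)} (hi : i.1 = 2 * j.1 + 1) :
    2 * j.1 + 1 < (rowPerm a i).1 := by
  have h1 := nextZero_gt a j
  rcases rowPerm_left a j hi with ⟨-, h⟩ | ⟨-, h⟩ <;> omega

lemma rowPerm_right_lt (j : Fin p) {i : Fin (2 * p + 2)} (hi : i.1 = 2 * j.1 + 2) :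
    (rowPerm a i).1 < 2 * j.1 + 2 := by
  have h1 := prevOne_lt a j
  rcases rowPerm_right a j hi with ⟨-, h⟩ | ⟨-, h⟩ <;> omega

lemma lt_of_rowPerm_eq_right (j : Fin p) {i : Fin (2 * p + 2)} (h : (rowPerm a i).1 = 2 * j.1 + 2) :
    i.1 < 2 * j.1 + 2 := by
  change (strandEnd a i).1 = _ at h
  have h1 := prevOne_ne_right a
  rcases strandEnd_cases a i with ⟨h', e⟩ | ⟨h', e⟩ | ⟨j', h', -, e⟩ | ⟨j', h', -, e⟩ |
    ⟨j', h', -, e⟩ | ⟨j', h', -, e⟩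
  · omega
  · exact absurd (e ▸ h) (h1 _ _)
  · have := nextZero_gt a j'
    rw [e] at h
    omega
  · omega
  · omega
  · exact absurd (e ▸ h) (h1 _ _)

lemma gt_of_rowPerm_eq_left (j : Fin p) {i : Fin (2 * p + 2)} (h : (rowPerm a i).1 = 2 * j.1 + 1) :
    2 * j.1 + 1 < i.1 := by
  change (strandEnd a i).1 = _ at h
  have h1 := nextZero_ne_left a
  rcases strandEnd_cases a i with ⟨h', e⟩ | ⟨h', e⟩ | ⟨j', h', -, e⟩ | ⟨j', h', -, e⟩ |
    ⟨j', h', -, e⟩ | ⟨j', h', -, e⟩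
  · exact absurd (e ▸ h) (h1 _ _)
  · omega
  · exact absurd (e ▸ h) (h1 _ _)
  · omega
  · omega
  · have := prevOne_lt a j'
    rw [e] at h
    omega

end Row

/-- The strand `2j + 2` ends at `2j + 1` if `a j = 0` and further left if `a j = 1`. -/
lemma rowPerm_injective : Function.Injective (rowPerm : (Fin p → Fin 2) → _) := by
  intro a a' h
  funext j
  have h1 := rowPerm_right a j (i := ⟨2 * j.1 + 2, by omega⟩) rfl
  have h2 := rowPerm_right a' j (i := ⟨2 * j.1 + 2, by omega⟩) rfl
  have h3 := prevOne_lt a j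
  have h4 := prevOne_lt a' j
  rw [h] at h1
  rcases h1 with ⟨h1, e1⟩ | ⟨h1, e1⟩ <;> rcases h2 with ⟨h2, e2⟩ | ⟨h2, e2⟩ <;>
    first
    | exact h1.trans h2.symm
    | omega

/-- Between neighbouring pairs, and next to the outermost strands, there are no descents at the
start. Inside the `j`-th pair of ends, the strand ending at `2j + 1` always comes from the right and
the one ending at `2j + 2` from the left, so they cross. -/
lemma leftWeighted_rowPerm {a a' : Fin p → Fin 2} (ha' : IsAdmissible a') (hp : 2 ≤ p) :
    LeftWeighted (rowPerm a) (rowPerm a') := by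
  intro s hs
  rw [Fin.lt_def] at hs
  have hs2 := s.2
  have hl : (leftPos s).1 = s.1 := rfl
  have hr : (rightPos s).1 = s.1 + 1 := rfl
  -- a descent lies in a pair
  obtain ⟨j, hj⟩ : ∃ j : Fin p, s.1 = 2 * j.1 + 1 := by
    by_contra hne
    push Not at hne
    rcases Nat.even_or_odd' s.1 with ⟨m, hm | hm⟩
    · rcases Nat.eq_zero_or_pos m with rfl | h0
      · have e1 := rowPerm_first a' ha' hp (i := leftPos s) (by omega)
        have e2 := lt_rowPerm_left a' ⟨0, by omega⟩ (i := rightPos s) (by simp only; omega)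
        simp only at e2
        omega
      · have e1 := rowPerm_right_lt a' ⟨m - 1, by omega⟩ (i := leftPos s) (by simp only; omega)
        simp only at e1
        rcases Nat.lt_or_ge m p with h | h
        · have e2 := lt_rowPerm_left a' ⟨m, h⟩ (i := rightPos s) (by simp only; omega)
          simp only at e2
          omega
        · have e2 := rowPerm_last a' ha' hp (i := rightPos s) (by omega)
          omega
    · exact hne ⟨m, by omega⟩ hm
  have x1 : (rowPerm a ((rowPerm a).symm (leftPos s))).1 = 2 * j.1 + 1 := by
    rw [Equiv.apply_symm_apply, hl, hj]
  have x2 : (rowPerm a ((rowPerm a).symm (rightPos s))).1 = 2 * j.1 + 2 := by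
    rw [Equiv.apply_symm_apply, hr, hj]
  have y1 := gt_of_rowPerm_eq_left a j x1
  have y2 := lt_of_rowPerm_eq_right a j x2
  rw [Fin.lt_def]
  have hne : ((rowPerm a).symm (leftPos s)).1 ≠ ((rowPerm a).symm (rightPos s)).1 := fun e => by
    have := (rowPerm a).symm.injective (Fin.ext e)
    exact leftPos_ne_rightPos s this
  omega

/-- The strands starting in the interval from `c` to `d` enclose a further strand in the end. -/
def Encloses {n : ℕ} (g : Equiv.Perm (Fin n)) (c d : ℕ) : Prop :=
  ∃ l x1 x2 : Fin n, ¬ (c ≤ l.1 ∧ l.1 ≤ d) ∧ (c ≤ x1.1 ∧ x1.1 ≤ d) ∧ (c ≤ x2.1 ∧ x2.1 ≤ d) ∧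
    (g x1).1 < (g l).1 ∧ (g l).1 < (g x2).1

/-- If the interval contains no pair, it consists of `2m` and `2m + 1`, whose strands go apart.
Otherwise use a pair in it: one of its strands moves by one step and the other one jumps in the
opposite direction, so some strand ends between them. In the last pair of an interval starting at
`0` this strand can be chosen from the right of the interval, in the first pair of any other
interval from its left. -/
lemma encloses_rowPerm {a : Fin p → Fin 2} (ha : IsAdmissible a) (hp : 2 ≤ p) {c d : ℕ}
    (hcd : c < d) (hd : d ≤ 2 * p + 1) (hne : ¬ (c = 0 ∧ d = 2 * p + 1)) :
    Encloses (rowPerm a) c d := by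
  have hval : ∀ v : ℕ, v < 2 * p + 2 → ∃ l : Fin (2 * p + 2), (rowPerm a l).1 = v := fun v hv =>
    ⟨(rowPerm a).symm ⟨v, hv⟩, by rw [Equiv.apply_symm_apply]⟩
  have hfun : ∀ {l i : Fin (2 * p + 2)}, l.1 = i.1 → (rowPerm a l).1 = (rowPerm a i).1 :=
    fun h => by rw [Fin.ext h]
  by_cases hpair : ∃ j : ℕ, c ≤ 2 * j + 1 ∧ 2 * j + 2 ≤ d
  swap
  · have hd1 : d = c + 1 := by
      by_contra h
      exact hpair ⟨c / 2, by omega, by omega⟩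
    have hc2 : c % 2 = 0 := by
      by_contra h
      exact hpair ⟨c / 2, by omega, by omega⟩
    subst hd1
    obtain ⟨m, rfl⟩ : ∃ m, c = 2 * m := ⟨c / 2, by omega⟩
    let x1 : Fin (2 * p + 2) := ⟨2 * m, by omega⟩
    let x2 : Fin (2 * p + 2) := ⟨2 * m + 1, by omega⟩
    have hmem : ∀ l : Fin (2 * p + 2), (rowPerm a l).1 ≠ (rowPerm a x1).1 →
        (rowPerm a l).1 ≠ (rowPerm a x2).1 → ¬ (2 * m ≤ l.1 ∧ l.1 ≤ 2 * m + 1) := by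
      intro l h1 h2 h3
      rcases (show l.1 = 2 * m ∨ l.1 = 2 * m + 1 by omega) with h | h
      · exact h1 (hfun h)
      · exact h2 (hfun h)
    have main : ∀ v, v < 2 * p + 2 → (rowPerm a x1).1 < v → v < (rowPerm a x2).1 →
        Encloses (rowPerm a) (2 * m) (2 * m + 1) := by
      intro v hv h1 h2
      obtain ⟨l, hl⟩ := hval v hv
      exact ⟨l, x1, x2, hmem l (by omega) (by omega), ⟨le_rfl, by simp [x1]⟩,
        ⟨by simp [x2], le_rfl⟩, by omega, by omega⟩
    rcases Nat.eq_zero_or_pos m with hm | hm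
    · have e1 := rowPerm_first a ha hp (i := x1) (by simp only [x1]; omega)
      have e2 := rowPerm_left a ⟨0, by omega⟩ (i := x2) (by simp only [x2]; omega)
      have e3 := (ha ⟨0, by omega⟩).1 rfl
      rw [e3] at e2
      have e4 : 3 < (nextZero a (0 + 1)).1 := by
        rcases nextZero_mem a (0 + 1) with h | ⟨j', h, -, h'⟩ <;> omega
      refine main 3 (by omega) (by omega) ?_
      rcases e2 with ⟨-, e2⟩ | ⟨e2, -⟩
      · simp only at e2
        omega
      · simp at e2
    · have e1 := rowPerm_right a ⟨m - 1, by omega⟩ (i := x1) (by simp only [x1]; omega)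
      have e1' := rowPerm_right_lt a ⟨m - 1, by omega⟩ (i := x1) (by simp only [x1]; omega)
      simp only at e1 e1'
      rcases Nat.lt_or_ge m p with h | h
      · have e2 := lt_rowPerm_left a ⟨m, h⟩ (i := x2) (by simp only [x2])
        simp only at e2
        exact main (2 * m) (by omega) (by omega) (by omega)
      · have e2 := rowPerm_last a ha hp (i := x2) (by simp only [x2]; omega)
        have e3 := (ha ⟨m - 1, by omega⟩).2 (by simp only; omega)
        rw [e3] at e1
        rcases e1 with ⟨e1, -⟩ | ⟨-, e1⟩
        · simp at e1
        · refine main (2 * p - 2) (by omega) ?_ (by omega)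
          rcases prevOne_mem a (m - 1) with h' | ⟨j', h', -, h''⟩ <;> omega
  rcases Nat.eq_zero_or_pos c with hc | hc
  · -- the last pair in the interval
    obtain ⟨j, hj⟩ : ∃ j : Fin p, d = 2 * j.1 + 2 ∨ d = 2 * j.1 + 3 :=
      ⟨⟨d / 2 - 1, by omega⟩, by simp only; omega⟩
    have hjp := j.2
    let x : Fin (2 * p + 2) := ⟨2 * j.1 + 1, by omega⟩
    let y : Fin (2 * p + 2) := ⟨2 * j.1 + 2, by omega⟩
    have ex := rowPerm_left a j (i := x) rfl
    have ey := rowPerm_right a j (i := y) rfl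
    have hx : c ≤ x.1 ∧ x.1 ≤ d := by simp only [x]; omega
    have hy : c ≤ y.1 ∧ y.1 ≤ d := by simp only [y]; omega
    rcases ex with ⟨e0, ex⟩ | ⟨e0, ex⟩
    · replace ey : (rowPerm a y).1 = 2 * j.1 + 1 := by
        rcases ey with ⟨-, ey⟩ | ⟨e1, -⟩
        · exact ey
        · omega
      rcases nextZero_mem a (j.1 + 1) with h | ⟨j', h, h0, h'⟩
      · have hj1 : j.1 + 1 ≠ p := fun e => by
          have := (ha j).2 e
          omega
        have el := rowPerm_last a ha hp (i := ⟨2 * p + 1, by omega⟩) rfl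
        exact ⟨⟨2 * p + 1, by omega⟩, y, x, by simp only; omega, hy, hx, by omega, by omega⟩
      · have el := rowPerm_right a j' (i := ⟨2 * j'.1 + 2, by omega⟩) rfl
        refine ⟨⟨2 * j'.1 + 2, by omega⟩, y, x, by simp only; omega, hy, hx, ?_, ?_⟩ <;>
        rcases el with ⟨-, el⟩ | ⟨e1, -⟩ <;> omega
    · replace ey : (rowPerm a y).1 < 2 * j.1 + 1 := by
        have := prevOne_lt a j
        rcases ey with ⟨e1, -⟩ | ⟨-, ey⟩ <;> omega
      obtain ⟨l, hl⟩ := hval (2 * j.1 + 1) (by omega)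
      have h1 := gt_of_rowPerm_eq_left a j hl
      have h2 : l.1 ≠ y.1 := fun e => by
        have := hfun e
        omega
      have h3 : d = 2 * j.1 + 3 → l.1 ≠ d := fun hd' e => by
        have := lt_rowPerm_left a ⟨j.1 + 1, by omega⟩ (i := l) (by simp only; omega)
        simp only at this
        omega
      simp only [y] at h2
      exact ⟨l, y, x, by omega, hy, hx, by omega, by omega⟩
  · -- the first pair in the interval
    obtain ⟨i, hi1, hi2⟩ := hpair
    obtain ⟨j, hj⟩ : ∃ j : Fin p, c = 2 * j.1 ∨ c = 2 * j.1 + 1 :=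
      ⟨⟨c / 2, by omega⟩, by simp only; omega⟩
    have hjp := j.2
    let x : Fin (2 * p + 2) := ⟨2 * j.1 + 1, by omega⟩
    let y : Fin (2 * p + 2) := ⟨2 * j.1 + 2, by omega⟩
    have ex := rowPerm_left a j (i := x) rfl
    have ey := rowPerm_right a j (i := y) rfl
    have hx : c ≤ x.1 ∧ x.1 ≤ d := by simp only [x]; omega
    have hy : c ≤ y.1 ∧ y.1 ≤ d := by simp only [y]; omega
    rcases ex with ⟨e0, ex⟩ | ⟨e0, ex⟩
    · have hn := nextZero_gt a j
      replace ey : (rowPerm a y).1 = 2 * j.1 + 1 := by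
        rcases ey with ⟨-, ey⟩ | ⟨e1, -⟩
        · exact ey
        · omega
      obtain ⟨l, hl⟩ := hval (2 * j.1 + 2) (by omega)
      have h1 := lt_of_rowPerm_eq_right a j hl
      have h2 : l.1 ≠ x.1 := fun e => by
        have := hfun e
        omega
      have h3 : c = 2 * j.1 → l.1 ≠ c := fun hc' e => by
        have := rowPerm_right_lt a ⟨j.1 - 1, by omega⟩ (i := l) (by simp only; omega)
        simp only at this
        omega
      simp only [x] at h2
      exact ⟨l, y, x, by omega, hy, hx, by omega, by omega⟩
    · replace ey : (rowPerm a y).1 = (prevOne a j.1).1 := by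
        rcases ey with ⟨e1, -⟩ | ⟨-, ey⟩
        · omega
        · exact ey
      rcases prevOne_mem a j.1 with h | ⟨j', h, h0, h'⟩
      · have hj1 : j.1 ≠ 0 := fun e => by
          have := (ha j).1 e
          omega
        have el := rowPerm_first a ha hp (i := ⟨0, by omega⟩) rfl
        exact ⟨⟨0, by omega⟩, y, x, by simp only; omega, hy, hx, by omega, by omega⟩
      · have el := rowPerm_left a j' (i := ⟨2 * j'.1 + 1, by omega⟩) rfl
        refine ⟨⟨2 * j'.1 + 1, by omega⟩, y, x, by simp only; omega, hy, hx, ?_, ?_⟩ <;>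
        rcases el with ⟨e1, -⟩ | ⟨-, el⟩ <;> omega

end BinaryBraid

/-! ### The additional vertical strand. -/

namespace BinaryBraid

open Braid GapWord

section InsertFixed

variable {n : ℕ} (q : Fin (n + 1)) (f : Equiv.Perm (Fin n))

lemma insertFixed_self : insertFixed q f q = q := by
  simp [insertFixed]

lemma insertFixed_succAbove (i : Fin n) : insertFixed q f (q.succAbove i) = q.succAbove (f i) := by
  simp [insertFixed]

lemma insertFixed_symm_self : (insertFixed q f).symm q = q := by
  rw [Equiv.symm_apply_eq, insertFixed_self]

lemma insertFixed_symm_succAbove (i : Fin n) :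
    (insertFixed q f).symm (q.succAbove i) = q.succAbove (f.symm i) := by
  rw [Equiv.symm_apply_eq, insertFixed_succAbove, Equiv.apply_symm_apply]

lemma insertFixed_injective : Function.Injective (insertFixed q : Equiv.Perm (Fin n) → _) := by
  intro f g h
  ext i
  have := congrArg (fun e => e (q.succAbove i)) h
  simp only [insertFixed_succAbove] at this
  rw [Fin.succAbove_right_injective this]

lemma succAbove_val (i : Fin n) :
    (i.1 < q.1 ∧ (q.succAbove i).1 = i.1) ∨ (q.1 ≤ i.1 ∧ (q.succAbove i).1 = i.1 + 1) := by
  rcases Nat.lt_or_ge i.1 q.1 with h | h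
  · exact Or.inl ⟨h, by rw [Fin.succAbove_of_castSucc_lt _ _ (by simpa [Fin.lt_def] using h)]; rfl⟩
  · exact Or.inr ⟨h, by rw [Fin.succAbove_of_le_castSucc _ _ (by simpa [Fin.le_def] using h)]; rfl⟩

end InsertFixed

variable {p : ℕ}

/-- The permutation of `α(a, b)`. -/
noncomputable def rowPermOdd (a : Fin p → Fin 2) (b : Fin (p + 1)) : Equiv.Perm (Fin (2 * p + 3)) :=
  insertFixed (⟨2 * b.1 + 1, by omega⟩ : Fin (2 * p + 2 + 1)) (rowPerm a)

/-- Away from the vertical strand this is the even case. Its neighbours at the start move away from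
it unless one of them is the first or the last strand. In these two cases the strand ending next to
the vertical one, at the first or the last position, does not start there and has to come from the
other side. -/
lemma leftWeighted_rowPermOdd {a a' : Fin p → Fin 2} (ha : IsAdmissible a) (ha' : IsAdmissible a')
    (hp : 2 ≤ p) (b : Fin (p + 1)) : LeftWeighted (rowPermOdd a b) (rowPermOdd a' b) := by
  intro s hs
  have hb := b.2
  have hs2 := s.2
  unfold rowPermOdd at hs ⊢
  generalize hq : (⟨2 * b.1 + 1, by omega⟩ : Fin (2 * p + 2 + 1)) = q at hs ⊢
  have hqv : q.1 = 2 * b.1 + 1 := by rw [← hq]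
  have hl : (leftPos s).1 = s.1 := rfl
  have hr : (rightPos s).1 = s.1 + 1 := rfl
  by_cases h1 : leftPos s = q
  · have h2 : rightPos s ≠ q := fun e => leftPos_ne_rightPos s (h1.trans e.symm)
    obtain ⟨k, hk⟩ := Fin.exists_succAbove_eq h2
    have kv := succAbove_val q k
    rw [hk] at kv
    have h1v := congrArg Fin.val h1
    rw [← hk, h1, insertFixed_self, insertFixed_succAbove, Fin.lt_def] at hs
    rw [← hk, h1, insertFixed_symm_self, insertFixed_symm_succAbove, Fin.lt_def]
    have v1 := succAbove_val q (rowPerm a' k)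
    have v2 := succAbove_val q ((rowPerm a).symm k)
    rcases Nat.lt_or_ge b.1 p with hbp | hbp
    · have := lt_rowPerm_left a' ⟨b.1, hbp⟩ (i := k) (by simp only; omega)
      simp only at this
      omega
    · have hne : ((rowPerm a).symm k).1 ≠ k.1 := fun e => by
        have e1 := rowPerm_last a ha hp (i := k) (by omega)
        have e2 := congrArg Fin.val (congrArg (rowPerm a) (Fin.ext e))
        rw [Equiv.apply_symm_apply] at e2
        omega
      have := ((rowPerm a).symm k).2
      omega
  by_cases h2 : rightPos s = q
  · obtain ⟨i, hi⟩ := Fin.exists_succAbove_eq h1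
    have iv := succAbove_val q i
    rw [hi] at iv
    have h2v := congrArg Fin.val h2
    rw [← hi, h2, insertFixed_self, insertFixed_succAbove, Fin.lt_def] at hs
    rw [← hi, h2, insertFixed_symm_self, insertFixed_symm_succAbove, Fin.lt_def]
    have v1 := succAbove_val q (rowPerm a' i)
    have v2 := succAbove_val q ((rowPerm a).symm i)
    rcases Nat.eq_zero_or_pos b.1 with hb0 | hb0
    · have hne : ((rowPerm a).symm i).1 ≠ i.1 := fun e => by
        have e1 := rowPerm_first a ha hp (i := i) (by omega)
        have e2 := congrArg Fin.val (congrArg (rowPerm a) (Fin.ext e))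
        rw [Equiv.apply_symm_apply] at e2
        omega
      omega
    · have := rowPerm_right_lt a' ⟨b.1 - 1, by omega⟩ (i := i) (by simp only; omega)
      simp only at this
      omega
  obtain ⟨i, hi⟩ := Fin.exists_succAbove_eq h1
  obtain ⟨k, hk⟩ := Fin.exists_succAbove_eq h2
  have iv := succAbove_val q i
  have kv := succAbove_val q k
  rw [hi] at iv
  rw [hk] at kv
  have hi2 := i.2
  have hk2 := k.2
  let s' : Fin (2 * p + 2 - 1) := ⟨i.1, by omega⟩
  have hil : leftPos s' = i := rfl
  have hkr : rightPos s' = k := Fin.ext (by simp only [rightPos, s']; omega)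
  rw [← hi, ← hk, insertFixed_succAbove, insertFixed_succAbove, Fin.succAbove_lt_succAbove_iff] at hs
  rw [← hi, ← hk, insertFixed_symm_succAbove, insertFixed_symm_succAbove,
    Fin.succAbove_lt_succAbove_iff]
  have := leftWeighted_rowPerm (a := a) ha' hp s'
  rw [hil, hkr] at this
  exact this hs

/-- An interval with at least two of the old strands inherits an enclosed strand. An interval
consisting of the vertical strand and one neighbour encloses a strand because the neighbour moves
away or crosses it, leaving a position between them. -/
lemma encloses_rowPermOdd {a : Fin p → Fin 2} (ha : IsAdmissible a) (hp : 2 ≤ p) (b : Fin (p + 1))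
    {c d : ℕ} (hcd : c < d) (hd : d ≤ 2 * p + 2) (hne : ¬ (c = 0 ∧ d = 2 * p + 2)) :
    Encloses (rowPermOdd a b) c d := by
  have hb := b.2
  unfold rowPermOdd
  generalize hq : (⟨2 * b.1 + 1, by omega⟩ : Fin (2 * p + 2 + 1)) = q
  have hqv : q.1 = 2 * b.1 + 1 := by rw [← hq]
  have hval : ∀ v : ℕ, v < 2 * p + 2 → ∃ l : Fin (2 * p + 2), (rowPerm a l).1 = v := fun v hv =>
    ⟨(rowPerm a).symm ⟨v, hv⟩, by rw [Equiv.apply_symm_apply]⟩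
  have hfun : ∀ {l i : Fin (2 * p + 2)}, l.1 = i.1 → (rowPerm a l).1 = (rowPerm a i).1 :=
    fun h => by rw [Fin.ext h]
  have hsucc := succAbove_val q
  by_cases hsmall : c + 1 = d ∧ (c = q.1 ∨ d = q.1)
  · obtain ⟨hcd1, h | h⟩ := hsmall
    · let x : Fin (2 * p + 2) := ⟨2 * b.1 + 1, by omega⟩
      have hx : x.1 = 2 * b.1 + 1 := rfl
      have hx' := hsucc x
      rcases Nat.lt_or_ge b.1 p with hbp | hbp
      · obtain ⟨l, hl⟩ := hval (2 * b.1 + 1) (by omega)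
        have e1 := lt_rowPerm_left a ⟨b.1, hbp⟩ (i := x) rfl
        have h1 : l.1 ≠ x.1 := fun e => by
          have := hfun e
          simp only at e1
          omega
        refine ⟨q.succAbove l, q, q.succAbove x, ?_, by omega, by omega, ?_, ?_⟩
        · have := hsucc l
          omega
        · rw [insertFixed_self, insertFixed_succAbove]
          have := hsucc (rowPerm a l)
          omega
        · rw [insertFixed_succAbove, insertFixed_succAbove]
          have := hsucc (rowPerm a l)
          have := hsucc (rowPerm a x)
          simp only at e1
          omega
      · obtain ⟨l, hl⟩ := hval (2 * p) (by omega)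
        have e1 := rowPerm_last a ha hp (i := x) (by omega)
        have h1 : l.1 ≠ x.1 := fun e => by
          have := hfun e
          omega
        refine ⟨q.succAbove l, q.succAbove x, q, ?_, by omega, by omega, ?_, ?_⟩
        · have := hsucc l
          omega
        · rw [insertFixed_succAbove, insertFixed_succAbove]
          have := hsucc (rowPerm a l)
          have := hsucc (rowPerm a x)
          omega
        · rw [insertFixed_self, insertFixed_succAbove]
          have := hsucc (rowPerm a l)
          omega
    · let x : Fin (2 * p + 2) := ⟨2 * b.1, by omega⟩
      have hx : x.1 = 2 * b.1 := rfl
      have hx' := hsucc x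
      rcases Nat.eq_zero_or_pos b.1 with hb0 | hb0
      · obtain ⟨l, hl⟩ := hval 1 (by omega)
        have e1 := rowPerm_first a ha hp (i := x) (by omega)
        have h1 : l.1 ≠ x.1 := fun e => by
          have := hfun e
          omega
        refine ⟨q.succAbove l, q, q.succAbove x, ?_, by omega, by omega, ?_, ?_⟩
        · have := hsucc l
          omega
        · rw [insertFixed_self, insertFixed_succAbove]
          have := hsucc (rowPerm a l)
          omega
        · rw [insertFixed_succAbove, insertFixed_succAbove]
          have := hsucc (rowPerm a l)
          have := hsucc (rowPerm a x)
          omega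
      · obtain ⟨l, hl⟩ := hval (2 * b.1) (by omega)
        have e1 := rowPerm_right_lt a ⟨b.1 - 1, by omega⟩ (i := x) (by simp only; omega)
        simp only at e1
        have h1 : l.1 ≠ x.1 := fun e => by
          have := hfun e
          omega
        refine ⟨q.succAbove l, q.succAbove x, q, ?_, by omega, by omega, ?_, ?_⟩
        · have := hsucc l
          omega
        · rw [insertFixed_succAbove, insertFixed_succAbove]
          have := hsucc (rowPerm a l)
          have := hsucc (rowPerm a x)
          omega
        · rw [insertFixed_self, insertFixed_succAbove]
          have := hsucc (rowPerm a l)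
          omega
  · have ⟨c', hc'⟩ : ∃ c' : ℕ, (c ≤ q.1 ∧ c' = c) ∨ (q.1 < c ∧ c' + 1 = c) := by
      rcases Nat.lt_or_ge q.1 c with h | h
      · exact ⟨c - 1, Or.inr ⟨h, by omega⟩⟩
      · exact ⟨c, Or.inl ⟨h, rfl⟩⟩
    have ⟨d', hd'⟩ : ∃ d' : ℕ, (d < q.1 ∧ d' = d) ∨ (q.1 ≤ d ∧ d' + 1 = d) := by
      rcases Nat.lt_or_ge d q.1 with h | h
      · exact ⟨d, Or.inl ⟨h, rfl⟩⟩
      · exact ⟨d - 1, Or.inr ⟨h, by omega⟩⟩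
    obtain ⟨l, x1, x2, h1, h2, h3, h4, h5⟩ :=
      encloses_rowPerm ha hp (c := c') (d := d') (by omega) (by omega) (by omega)
    have e1 := hsucc l
    have e2 := hsucc x1
    have e3 := hsucc x2
    refine ⟨q.succAbove l, q.succAbove x1, q.succAbove x2, by omega, by omega, by omega, ?_, ?_⟩ <;>
      rw [insertFixed_succAbove, insertFixed_succAbove, ← Fin.lt_def,
        Fin.succAbove_lt_succAbove_iff]
    · exact h4
    · exact h5

/-- If `b < b'`, the strand at `2b + 1` is vertical for `b`, but for `b'` it is the left strand of a
pair and moves to the right. -/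
lemma rowPermOdd_injective {a a' : Fin p → Fin 2} {b b' : Fin (p + 1)}
    (h : rowPermOdd a b = rowPermOdd a' b') : a = a' ∧ b = b' := by
  have key : ∀ {a a' : Fin p → Fin 2} {b b' : Fin (p + 1)}, rowPermOdd a b = rowPermOdd a' b' →
      ¬ b.1 < b'.1 := by
    intro a a' b b' h hlt
    have hb := b'.2
    let q : Fin (2 * p + 2 + 1) := ⟨2 * b.1 + 1, by omega⟩
    let q' : Fin (2 * p + 2 + 1) := ⟨2 * b'.1 + 1, by omega⟩
    let x : Fin (2 * p + 2) := ⟨2 * b.1 + 1, by omega⟩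
    have hx : q'.succAbove x = q := Fin.ext (by
      rcases succAbove_val q' x with ⟨-, e⟩ | ⟨e, -⟩
      · rw [e]
      · simp only [q', x] at e
        omega)
    have h1 : insertFixed q (rowPerm a) q = insertFixed q' (rowPerm a') q :=
      congrArg (fun e => e q) h
    rw [insertFixed_self, ← hx, insertFixed_succAbove] at h1
    have h2 := congrArg Fin.val (Fin.succAbove_right_injective h1)
    have h3 := lt_rowPerm_left a' ⟨b.1, by omega⟩ (i := x) rfl
    simp only [x] at h2 h3
    omega
  have hbb : b = b' := Fin.ext (by
    have h1 := key h
    have h2 := key h.symm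
    omega)
  subst hbb
  exact ⟨rowPerm_injective (insertFixed_injective _ h), rfl⟩

end BinaryBraid

/-! ### From permutations to the assertions on products. -/

namespace Braid

open GapWord BinaryBraid

variable {n : ℕ}

/-- Products of permutation braids any two of which are left weighted. -/
theorem prod_properties {k : ℕ} (hk : 1 ≤ k) (f : Fin k → Equiv.Perm (Fin n))
    (hf : ∀ i j, LeftWeighted (f i) (f j)) (h1 : ∀ i, f i ≠ 1) (hrev : ∀ i, f i ≠ Fin.revPerm)
    (henc : ∀ i c d, c < d → d < n → ¬ (c = 0 ∧ d + 1 = n) → Encloses (f i) c d) :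
    IsLeftCanonicalForm (List.ofFn fun i => permBraid (f i)).prod 0
        (List.ofFn fun i => permBraid (f i)) ∧
      IsRigid (List.ofFn fun i => permBraid (f i)).prod ∧
      (∀ i j, startingSet (permBraid (f j)) ⊆ finishingSet (permBraid (f i))) ∧
      ¬ ∃ 𝒞, IsStandardReductionSystem (List.ofFn fun i => permBraid (f i)).prod 𝒞 := by
  have hsub : ∀ i j, startingSet (permBraid (f j)) ⊆ finishingSet (permBraid (f i)) :=
    fun i j s hs => mem_finishingSet_permBraid (hf i j s (descent_of_mem_startingSet hs))
  have hmem : ∀ x ∈ List.ofFn fun i => permBraid (f i), ∃ i, permBraid (f i) = x := fun x hx =>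
    (List.mem_ofFn' _ _).1 hx
  have hcan : IsLeftCanonicalForm (List.ofFn fun i => permBraid (f i)).prod 0
      (List.ofFn fun i => permBraid (f i)) := by
    refine ⟨by simp, fun x hx => ?_, fun x hx => ?_, fun x hx => ?_, ?_⟩
    · obtain ⟨i, rfl⟩ := hmem x hx
      exact isPermutationBraid_permBraid _
    · obtain ⟨i, rfl⟩ := hmem x hx
      intro e
      exact h1 i (permBraid_injective (e.trans permBraid_one.symm))
    · obtain ⟨i, rfl⟩ := hmem x hx
      intro e
      exact hrev i (permBraid_injective e)
    · exact (List.pairwise_ofFn.2 fun i j _ => hsub i j).isChain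
  have hne : (List.ofFn fun i => permBraid (f i)) ≠ [] := by
    simp only [ne_eq, List.ofFn_eq_nil_iff]
    omega
  refine ⟨hcan, ⟨0, _, hne, hcan, ?_⟩, hsub, ?_⟩
  · obtain ⟨i, hi⟩ := hmem _ (List.head_mem hne)
    obtain ⟨j, hj⟩ := hmem _ (List.getLast_mem hne)
    rw [← hi, ← hj]
    simpa [tauPow] using hsub j i
  · obtain ⟨k, rfl⟩ : ∃ m, k = m + 1 := ⟨k - 1, by omega⟩
    have hchain : (List.ofFn f).IsChain LeftWeighted :=
      (List.pairwise_ofFn.2 fun i j _ => hf i j).isChain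
    rw [List.ofFn_succ] at hchain
    have := not_exists_isStandardReductionSystem (f 0) _ hchain fun C => by
      have hlt : C.first.1 < C.last.1 := C.first_lt_last
      obtain ⟨l, x1, x2, h2, h3, h4, h5, h6⟩ := henc 0 _ _ hlt C.last.2 C.not_peripheral
      exact ⟨l, x1, x2, by omega, by omega, by omega, h5, h6⟩
    rw [← List.ofFn_succ, List.map_ofFn] at this
    exact this

lemma permBraid_ofFn_injective {k : ℕ} {f g : Fin k → Equiv.Perm (Fin n)}
    (hf : ∀ i j, LeftWeighted (f i) (f j)) (hg : ∀ i j, LeftWeighted (g i) (g j))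
    (h : (List.ofFn fun i => permBraid (f i)).prod = (List.ofFn fun i => permBraid (g i)).prod) :
    f = g := by
  refine List.ofFn_injective (leftWeighted_unique
    (List.pairwise_ofFn.2 fun i j _ => hf i j).isChain
    (List.pairwise_ofFn.2 fun i j _ => hg i j).isChain (by simp) ?_)
  rw [List.map_ofFn, List.map_ofFn]
  exact h

end Braid

theorem lemma2p2 (k p : ℕ) (hk : 1 ≤ k) (hp : 2 ≤ p) :
    -- braids on `n = 2p + 2` strands
    ((∀ A : BinaryBraid.AdmissibleMatrix k p,
        Braid.IsLeftCanonicalForm (BinaryBraid.alphaEven A) 0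
          (List.ofFn fun i => BinaryBraid.rowBraid (A.1 i)) ∧
        Braid.IsRigid (BinaryBraid.alphaEven A) ∧
        (∀ i j : Fin k, Braid.startingSet (BinaryBraid.rowBraid (A.1 j)) ⊆
          Braid.finishingSet (BinaryBraid.rowBraid (A.1 i))) ∧
        ¬ ∃ 𝒞 : Set (Braid.StandardCircle (2 * p + 2)),
          Braid.IsStandardReductionSystem (BinaryBraid.alphaEven A) 𝒞) ∧
      Function.Injective
        (BinaryBraid.alphaEven : BinaryBraid.AdmissibleMatrix k p → Braid (2 * p + 2))) ∧
    -- braids on `n = 2p + 3` strands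
    ((∀ A : BinaryBraid.AdmissibleMatrix k p × Fin (p + 1),
        Braid.IsLeftCanonicalForm (BinaryBraid.alphaOdd A) 0
          (List.ofFn fun i => BinaryBraid.rowBraidOdd (A.1.1 i) A.2) ∧
        Braid.IsRigid (BinaryBraid.alphaOdd A) ∧
        (∀ i j : Fin k, Braid.startingSet (BinaryBraid.rowBraidOdd (A.1.1 j) A.2) ⊆
          Braid.finishingSet (BinaryBraid.rowBraidOdd (A.1.1 i) A.2)) ∧
        ¬ ∃ 𝒞 : Set (Braid.StandardCircle (2 * p + 3)),
          Braid.IsStandardReductionSystem (BinaryBraid.alphaOdd A) 𝒞) ∧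
      Function.Injective
        (BinaryBraid.alphaOdd :
          BinaryBraid.AdmissibleMatrix k p × Fin (p + 1) → Braid (2 * p + 3))) := by
  have hadm : ∀ (A : BinaryBraid.AdmissibleMatrix k p) i, BinaryBraid.IsAdmissible (A.1 i) :=
    fun A i j => A.2 i j
  have hlw : ∀ (A : BinaryBraid.AdmissibleMatrix k p) (i j : Fin k),
      Braid.LeftWeighted (BinaryBraid.rowPerm (A.1 i)) (BinaryBraid.rowPerm (A.1 j)) :=
    fun A i j => BinaryBraid.leftWeighted_rowPerm (hadm A j) hp
  have hlw' : ∀ (A : BinaryBraid.AdmissibleMatrix k p) (b : Fin (p + 1)) (i j : Fin k),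
      Braid.LeftWeighted (BinaryBraid.rowPermOdd (A.1 i) b) (BinaryBraid.rowPermOdd (A.1 j) b) :=
    fun A b i j => BinaryBraid.leftWeighted_rowPermOdd (hadm A i) (hadm A j) hp b
  -- The first strand ends at `2`, or at `3` if the vertical strand is inserted before that end.
  -- Since `p ≥ 2`, this excludes both the identity and the reversal, that is, the factors `1` and
  -- `Δ`.
  have hfirst : ∀ (A : BinaryBraid.AdmissibleMatrix k p) (b : Fin (p + 1)) (i : Fin k),
      (BinaryBraid.rowPermOdd (A.1 i) b 0).1 = 2 ∨ (BinaryBraid.rowPermOdd (A.1 i) b 0).1 = 3 := by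
    intro A b i
    have hb := b.2
    let q : Fin (2 * p + 2 + 1) := ⟨2 * b.1 + 1, by omega⟩
    have h0 : q.succAbove (0 : Fin (2 * p + 2)) = 0 := Fin.ext (by
      rcases BinaryBraid.succAbove_val q 0 with ⟨-, e⟩ | ⟨e, -⟩
      · rw [e]
        rfl
      · simp [q] at e)
    have h1 := BinaryBraid.insertFixed_succAbove q (BinaryBraid.rowPerm (A.1 i)) 0
    have h2 := BinaryBraid.rowPerm_first _ (hadm A i) hp (i := 0) rfl
    rw [h0] at h1
    have h3 := BinaryBraid.succAbove_val q (BinaryBraid.rowPerm (A.1 i) 0)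
    change (BinaryBraid.insertFixed q _ 0).1 = 2 ∨ (BinaryBraid.insertFixed q _ 0).1 = 3
    rw [h1]
    omega
  refine ⟨⟨fun A => ?_, fun A A' h => ?_⟩, ⟨fun A => ?_, fun A A' h => ?_⟩⟩
  · refine Braid.prod_properties hk (fun i => BinaryBraid.rowPerm (A.1 i)) (hlw A) (fun i e => ?_)
      (fun i e => ?_) (fun i c d h1 h2 h3 => BinaryBraid.encloses_rowPerm (hadm A i) hp h1 (by omega)
        (by omega))
    · have h2 := BinaryBraid.rowPerm_first _ (hadm A i) hp (i := 0) rfl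
      simp [e] at h2
    · have h2 := BinaryBraid.rowPerm_first _ (hadm A i) hp (i := 0) rfl
      simp [e] at h2
  · have := Braid.permBraid_ofFn_injective (hlw A) (hlw A') h
    exact Subtype.ext (funext fun i => BinaryBraid.rowPerm_injective (congrFun this i))
  · obtain ⟨A, b⟩ := A
    refine Braid.prod_properties hk (fun i => BinaryBraid.rowPermOdd (A.1 i) b) (hlw' A b)
      (fun i e => ?_) (fun i e => ?_) (fun i c d h1 h2 h3 =>
        BinaryBraid.encloses_rowPermOdd (hadm A i) hp b h1 (by omega) (by omega))
    · have h2 := hfirst A b i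
      simp [e] at h2
    · have h2 := hfirst A b i
      simp [e] at h2
      omega
  · obtain ⟨A, b⟩ := A
    obtain ⟨A', b'⟩ := A'
    have := Braid.permBraid_ofFn_injective (hlw' A b) (hlw' A' b') h
    have key := fun i => BinaryBraid.rowPermOdd_injective (congrFun this i)
    -- At least one row is needed to recover `b`, which is where `k ≥ 1` enters.
    exact Prod.ext (Subtype.ext (funext fun i => (key i).1)) (key ⟨0, hk⟩).2
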